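/- Let $\mathbb D$ be the open unit disk, $H(\mathbb D)$ the space of analytic functions on $\mathbb D$, and $dA=\frac1\pi\,dx\,dy$ the normalized area measure. For $0<p<\infty$ and $\alpha>-1$ let the weighted Dirichlet space $D^p_\alpha$ consist of all $f\in H(\mathbb D)$ with $$\|f\|_{D^p_\alpha}=\Big(|f(0)|^p+\int_{\mathbb D}|f'(z)|^p(1-|z|^2)^\alpha\,dA(z)\Big)^{1/p}<\infty .$$ For $g\in H(\mathbb D)$ let $(T_gf)(z)=\int_0^z f(\omega)g'(\omega)\,d\omega$. We say that $T_g:D^p_\alpha\to D^q_\beta$ is compact if $T_g$ maps $D^p_\alpha$ into $D^q_\beta$ and, for every bounded sequence $(f_n)$ in $D^p_\alpha$, the sequence $(T_gf_n)$ has a subsequence that converges in $D^q_\beta$. For an arc $I\subset\partial\mathbb D$ of normalized length $|I|\in(0,1]$ let $S(I)=\{re^{i\theta}: e^{i\theta}\in I,\ 1-|I|\le r<1\}$. For $s>0$, a positive Borel measure $\mu$ on $\mathbb D$ is called a vanishing $s$-Carleson measure if $\mu(S(I))=o(|I|^s)$ as $|I|\to0$, uniformly over all arcs $I$. **Theorem.**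 Let $\alpha,\beta>-1$, $0<p<q<\infty$, $g\in H(\mathbb D)$, and $d\mu_{g,q,\beta}(z)=(1-|z|^2)^\beta|g'(z)|^q\,dA(z)$. 1. If $p<\alpha+2$, then $T_g:D^p_\alpha\to D^q_\beta$ is compact if and only if $\mu_{g,q,\beta}$ is a vanishing $\frac{q(\alpha+2-p)}{p}$-Carleson measure. 2. If $p=\alpha+2$, then $T_g:D^p_\alpha\to D^q_\beta$ is compact if and only if $\mu_{g,q,\beta}(S(I))=o\big((\log\frac1{|I|})^{(1/p-1)q}\big)$ as $|I|\to0$, uniformly over all arcs $I$. 3. If $p>\alpha+2$, then $T_g:D^p_\alpha\to D^q_\beta$ is compact if and only if $\mu_{g,q,\beta}$ is a finite measure, or equivalently, if and only if $g\in D^q_\beta$. -/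

import Mathlib

open MeasureTheory Filter Topology
open scoped ENNReal NNReal

noncomputable section

/-- The open unit disk of the complex plane. -/
def unitDisk : Set ℂ := Metric.ball 0 1

/-- Analytic functions on the unit disk, represented by functions `ℂ → ℂ` of which only the
values on the disk matter. -/
def AnalyticOnDisk (f : ℂ → ℂ) : Prop := DifferentiableOn ℂ f unitDisk

/-- The normalized area measure `dA = dx dy / π` on the unit disk. -/
def areaDisk : Measure ℂ := (ENNReal.ofReal Real.pi)⁻¹ • (volume : Measure ℂ).restrict unitDisk

/-- The (quasi-)norm of the weighted Dirichlet space with exponent `p` and weight `α`,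
with value `∞` allowed:
`(|f(0)|^p + ∫_𝔻 |f'(z)|^p (1 - |z|^2)^α dA(z))^(1/p)`. -/
def dirichletNorm (p α : ℝ) (f : ℂ → ℂ) : ℝ≥0∞ :=
  (‖f 0‖ₑ ^ p
    + ∫⁻ z, ‖deriv f z‖ₑ ^ p * ENNReal.ofReal ((1 - ‖z‖ ^ 2) ^ α) ∂areaDisk) ^ (1 / p)

/-- Membership in the weighted Dirichlet space. -/
def MemDirichlet (p α : ℝ) (f : ℂ → ℂ) : Prop :=
  AnalyticOnDisk f ∧ dirichletNorm p α f < ∞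

/-- The Volterra type operator `(T_g f)(z) = ∫_0^z f(ω) g'(ω) dω`; the integral is taken along
the segment `ω = t z`, `0 ≤ t ≤ 1`. -/
def volterraOp (g f : ℂ → ℂ) : ℂ → ℂ := fun z =>
  ∫ t in (0 : ℝ)..1, f ((t : ℂ) * z) * deriv g ((t : ℂ) * z) * z

/-- `T` is a compact operator from the weighted Dirichlet space `(p, α)` to the weighted
Dirichlet space `(q, β)`: it maps the first space into the second one, and the image of each
bounded sequence has a subsequence that converges in the second space. -/
def IsCompactDirichlet (p α q β : ℝ) (T : (ℂ → ℂ) → (ℂ → ℂ)) : Prop :=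
  (∀ f, MemDirichlet p α f → MemDirichlet q β (T f)) ∧
  ∀ f : ℕ → ℂ → ℂ, (∀ n, MemDirichlet p α (f n)) →
    (∃ C : ℝ≥0, ∀ n, dirichletNorm p α (f n) ≤ C) →
    ∃ (φ : ℕ → ℕ) (h : ℂ → ℂ), StrictMono φ ∧ MemDirichlet q β h ∧
      Tendsto (fun n => dirichletNorm q β (T (f (φ n)) - h)) atTop (𝓝 0)

/-- The Carleson square `S(I)` over the arc `I = {e^{iθ} : a ≤ θ ≤ a + 2 π l}` of the unit
circle, whose normalized length is `|I| = l`. -/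
def carlesonSquare (a l : ℝ) : Set ℂ :=
  {z | ∃ r θ : ℝ, 1 - l ≤ r ∧ r < 1 ∧ a ≤ θ ∧ θ ≤ a + 2 * Real.pi * l ∧
    z = (r : ℂ) * Complex.exp ((θ : ℂ) * Complex.I)}

/-- `μ(S(I)) = o(ψ(|I|))` as `|I| → 0`, uniformly over all arcs `I`. -/
def CarlesonLittleO (μ : Measure ℂ) (ψ : ℝ → ℝ) : Prop :=
  ∀ ε : ℝ, 0 < ε → ∃ δ : ℝ, 0 < δ ∧ ∀ a l : ℝ, 0 < l → l ≤ 1 → l < δ →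
    μ (carlesonSquare a l) ≤ ENNReal.ofReal (ε * ψ l)

/-- `μ` is a vanishing `s`-Carleson measure. -/
def IsVanishingCarleson (s : ℝ) (μ : Measure ℂ) : Prop :=
  CarlesonLittleO μ (fun l => l ^ s)

/-- The measure `dμ_{g,q,β}(z) = (1 - |z|^2)^β |g'(z)|^q dA(z)` on the unit disk. -/
def volterraMeasure (g : ℂ → ℂ) (q β : ℝ) : Measure ℂ :=
  areaDisk.withDensity fun z => ENNReal.ofReal ((1 - ‖z‖ ^ 2) ^ β) * ‖deriv g z‖ₑ ^ q

end

/-! Since (T_g f)' = f g', the Dirichlet integral of T_g f is the integral of |f|^q against μ =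
`volterraMeasure g q β`. Compactness of T_g is thus compactness of the embedding of D^p_α into
L^q(μ).

Sufficiency. Cut the radius through z at the levels 1 - 2^(-k) and let y_k be the size of the
increment of f over the k-th piece. Sub-mean value estimates for |f'|^p give y_k^p ≤ 2^(k(α+2-p))
d_k, where d_k is a multiple of the energy of f in the k-th dyadic annulus, so that ∑ d_k ≲ E, the
Dirichlet integral. A Hedberg-type splitting of ∑ y_k at the best index yields |f(z) - f(0)|^q ≤ c
E^((q-p)/p) ∑ W_k y_k^p (`RadialControl`). Here W_k = 2^(kη(q-p)) with η = (α+2-p)/p if p < α+2, and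
W_k = (k+2)^(q(1-1/p)) if p = α+2. Each y_k^p is bounded by a local integral of |f'|^p, so Fubini
reduces the embedding to the μ-measure of single Carleson squares
(`exists_lintegral_tsum_radialIncrement_le`), and the weights match the two box conditions. If p >
α+2, the increments decay geometrically and f is bounded by its norm. The hypothesis on μ makes the
embedding small near the circle (`VanishingEmbedding`); with Montel's theorem inside, this gives
compactness (`isCompactDirichlet_of_vanishing`).

Necessity. Compactness sends a bounded sequence that is pointwise null to one with a subsequence
null in L^q(μ). This is tested on l^(b-η) (1 - w̄z)^(-b), or on (log 1/l)^(-1/p) log(1 - w̄z) in the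
critical case, with w at height l below the centre of the arc. Forelli-Rudin integrals bound their
norms, and they are large on the Carleson square. If p > α+2, the constant function 1 suffices. -/

/-! ### Sub-mean value inequalities for powers of holomorphic functions -/

/-- Integration in polar coordinates over a disk. -/
lemma lintegral_ball_eq_polar {G : ℂ → ℝ≥0∞} (hG : Measurable G) (c : ℂ) (R : ℝ) :
    ∫⁻ z in Metric.ball c R, G z =
      ∫⁻ r in Set.Ioo 0 R, ENNReal.ofReal r *
        ∫⁻ θ in Set.Ioo (-Real.pi) Real.pi, G (circleMap c r θ) := by
  have hmp := measurePreserving_add_left (volume : Measure ℂ) c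
  have h1 : ∫⁻ z in Metric.ball c R, G z = ∫⁻ z in Metric.ball 0 R, G (c + z) := by
    have := hmp.setLIntegral_comp_preimage (s := Metric.ball c R) Metric.isOpen_ball.measurableSet hG
    rw [← this]
    congr 2
    ext z
    simp [dist_eq_norm]
  have hF : Measurable fun z => (Metric.ball (0 : ℂ) R).indicator (fun z => G (c + z)) z :=
    (hG.comp (measurable_const_add c)).indicator Metric.isOpen_ball.measurableSet
  rw [h1, ← lintegral_indicator Metric.isOpen_ball.measurableSet,
    ← Complex.lintegral_comp_polarCoord_symm]
  have ht : polarCoord.target = Set.Ioi (0 : ℝ) ×ˢ Set.Ioo (-Real.pi) Real.pi := rfl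
  have hm : Measurable fun p : ℝ × ℝ => ENNReal.ofReal p.1 •
      (Metric.ball (0 : ℂ) R).indicator (fun z => G (c + z)) (Complex.polarCoord.symm p) := by
    have h2 : Measurable fun p : ℝ × ℝ => Complex.polarCoord.symm p := by
      simp only [Complex.polarCoord_symm_apply]
      fun_prop
    exact (ENNReal.measurable_ofReal.comp measurable_fst).smul (hF.comp h2)
  rw [ht, Measure.volume_eq_prod, setLIntegral_prod _ hm.aemeasurable]
  rw [← lintegral_indicator measurableSet_Ioi, ← lintegral_indicator measurableSet_Ioo]
  congr 1
  ext r
  by_cases hr : 0 < r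
  swap
  · simp [hr]
  by_cases hR : r < R
  swap
  · have h3 : ∀ θ : ℝ, Complex.polarCoord.symm (r, θ) ∉ Metric.ball (0 : ℂ) R := by
      intro θ
      rw [mem_ball_zero_iff, Complex.norm_polarCoord_symm, abs_of_pos hr]
      exact hR
    have h4 : ∀ θ : ℝ, (Metric.ball (0 : ℂ) R).indicator (fun z => G (c + z))
        (Complex.polarCoord.symm (r, θ)) = 0 := fun θ => Set.indicator_of_notMem (h3 θ) _
    rw [Set.indicator_of_mem (show r ∈ Set.Ioi 0 from hr),
      Set.indicator_of_notMem (show r ∉ Set.Ioo 0 R from fun h => hR h.2)]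
    simp only [h4, smul_zero, lintegral_zero]
  · have h3 : ∀ θ : ℝ, Complex.polarCoord.symm (r, θ) ∈ Metric.ball (0 : ℂ) R := by
      intro θ
      rw [mem_ball_zero_iff, Complex.norm_polarCoord_symm, abs_of_pos hr]
      exact hR
    rw [Set.indicator_of_mem (show r ∈ Set.Ioi 0 from hr),
      Set.indicator_of_mem (show r ∈ Set.Ioo 0 R from ⟨hr, hR⟩)]
    simp only [Set.indicator_of_mem (h3 _), smul_eq_mul]
    rw [lintegral_const_mul']
    · congr 2
      ext θ
      rw [Complex.polarCoord_symm_apply, circleMap, Complex.exp_mul_I]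
      simp
    · exact ENNReal.ofReal_ne_top

lemma enorm_le_lintegral_circle {h : ℂ → ℂ} {c : ℂ} {r : ℝ} (hr : 0 < r)
    (hh : DiffContOnCl ℂ h (Metric.ball c r)) :
    ENNReal.ofReal (2 * Real.pi) * ‖h c‖ₑ ≤
      ∫⁻ θ in Set.Ioo (-Real.pi) Real.pi, ‖h (circleMap c r θ)‖ₑ := by
  have h1 : Real.circleAverage h c r = h c := by
    apply DiffContOnCl.circleAverage
    rwa [abs_of_pos hr]
  have h2 : Function.Periodic (fun θ => h (circleMap c r θ)) (2 * Real.pi) := fun θ => by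
    simp only [periodic_circleMap c r θ]
  have h3 : ∫ θ in (0 : ℝ)..2 * Real.pi, h (circleMap c r θ) =
      ∫ θ in Set.Ioo (-Real.pi) Real.pi, h (circleMap c r θ) := by
    have := h2.intervalIntegral_add_eq 0 (-Real.pi)
    rw [zero_add, show -Real.pi + 2 * Real.pi = Real.pi by ring] at this
    rw [this, intervalIntegral.integral_of_le (by linarith [Real.pi_pos]), integral_Ioc_eq_integral_Ioo]
  have h4 : (2 * Real.pi : ℝ) • h c = ∫ θ in Set.Ioo (-Real.pi) Real.pi, h (circleMap c r θ) := by
    rw [← h3, ← h1, Real.circleAverage, smul_smul, mul_inv_cancel₀ (by positivity), one_smul]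
  refine le_trans (le_of_eq ?_) (enorm_integral_le_lintegral_enorm _)
  rw [← h4, enorm_smul, Real.enorm_of_nonneg (by positivity)]

lemma lintegral_Ioo_ofReal_id {R : ℝ} (hR : 0 < R) :
    ∫⁻ r in Set.Ioo 0 R, ENNReal.ofReal r = ENNReal.ofReal (R ^ 2 / 2) := by
  rw [← ofReal_integral_eq_lintegral_ofReal]
  · rw [← integral_Ioc_eq_integral_Ioo, ← intervalIntegral.integral_of_le hR.le, integral_id]
    simp
  · exact (continuous_id.integrableOn_Icc (a := 0) (b := R)).mono_set Set.Ioo_subset_Icc_self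
  · filter_upwards [ae_restrict_mem measurableSet_Ioo] with r hr using hr.1.le

/-- The area version of the sub-mean value property. -/
lemma enorm_le_lintegral_ball {h : ℂ → ℂ} {c : ℂ} {R : ℝ} (hR : 0 < R) (hm : Measurable h)
    (hh : DifferentiableOn ℂ h (Metric.closedBall c R)) :
    ENNReal.ofReal (Real.pi * R ^ 2) * ‖h c‖ₑ ≤ ∫⁻ z in Metric.ball c R, ‖h z‖ₑ := by
  rw [lintegral_ball_eq_polar hm.enorm]
  calc ENNReal.ofReal (Real.pi * R ^ 2) * ‖h c‖ₑ
      = (∫⁻ r in Set.Ioo 0 R, ENNReal.ofReal r) * (ENNReal.ofReal (2 * Real.pi) * ‖h c‖ₑ) := by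
        rw [lintegral_Ioo_ofReal_id hR, ← mul_assoc, ← ENNReal.ofReal_mul (by positivity)]
        congr 2
        ring
    _ = ∫⁻ r in Set.Ioo 0 R, ENNReal.ofReal r * (ENNReal.ofReal (2 * Real.pi) * ‖h c‖ₑ) := by
        rw [lintegral_mul_const _ ENNReal.measurable_ofReal]
    _ ≤ _ := by
        apply setLIntegral_mono' measurableSet_Ioo
        intro r hr
        gcongr
        apply enorm_le_lintegral_circle hr.1
        apply DifferentiableOn.diffContOnCl
        apply hh.mono
        refine Metric.closure_ball_subset_closedBall.trans (Metric.closedBall_subset_closedBall hr.2.le)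

/-- Subharmonicity of |h|^p is bypassed by a maximum argument. Let (R - |z - c|)^(2/p) |h(z)| attain
its maximum m at z₀, and let d be half the distance from z₀ to the circle. On the disk of radius d
about z₀, |h| ≤ m d^(-2/p). Writing |h| = |h|^(1-p) |h|^p there, the area mean value inequality at
z₀ bounds m, hence the value at the centre. -/
lemma enorm_rpow_le_lintegral_ball_of_le_one {p : ℝ} (hp : 0 < p) (hp1 : p ≤ 1) {h : ℂ → ℂ} {c : ℂ}
    {R : ℝ} (hR : 0 < R) (hm : Measurable h) (hh : DifferentiableOn ℂ h (Metric.closedBall c R)) :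
    ENNReal.ofReal (R ^ 2) * ‖h c‖ₑ ^ p ≤
      ENNReal.ofReal (2 ^ (2 / p)) * ∫⁻ z in Metric.ball c R, ‖h z‖ₑ ^ p := by
  set I := ∫⁻ z in Metric.ball c R, ‖h z‖ₑ ^ p with hI
  by_cases hIt : I = ∞
  · rw [hIt, ENNReal.mul_top (by simp; positivity)]
    exact le_top
  set Φ : ℂ → ℝ := fun z => (R - dist z c) ^ (2 / p) * ‖h z‖ with hΦ
  have hp2 : 0 < 2 / p := by positivity
  have hcont : ContinuousOn Φ (Metric.closedBall c R) := by
    apply ContinuousOn.mul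
    · apply ContinuousOn.rpow_const
      · fun_prop
      · intro x _
        right
        exact hp2.le
    · exact hh.continuousOn.norm
  obtain ⟨z₀, hz₀, hmax⟩ := (isCompact_closedBall c R).exists_isMaxOn
    ⟨c, Metric.mem_closedBall_self hR.le⟩ hcont
  have hmax : ∀ w ∈ Metric.closedBall c R, Φ w ≤ Φ z₀ := hmax
  set m := Φ z₀ with hmdef
  have hz₀' : dist z₀ c ≤ R := hz₀
  have hm0 : 0 ≤ m := mul_nonneg (Real.rpow_nonneg (by linarith) _) (norm_nonneg _)
  -- the maximum controls the value at the centre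
  have hcm : R ^ (2 / p) * ‖h c‖ ≤ m := by
    have := hmax c (Metric.mem_closedBall_self hR.le)
    simpa [hΦ] using this
  have key : ENNReal.ofReal (m ^ p) ≤ ENNReal.ofReal (2 ^ (2 / p)) * I := by
    rcases hm0.eq_or_lt with h0 | hpos
    · rw [← h0, Real.zero_rpow hp.ne']
      simp
    have hd : 0 < R - dist z₀ c := by
      rcases hz₀'.lt_or_eq with h1 | h1
      · linarith
      · exfalso
        rw [hmdef, hΦ] at hpos
        simp only [h1, sub_self, Real.zero_rpow hp2.ne', zero_mul, lt_irrefl] at hpos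
    set d := (R - dist z₀ c) / 2 with hddef
    have hd0 : 0 < d := by positivity
    have hsub : Metric.closedBall z₀ d ⊆ Metric.closedBall c R :=
      Metric.closedBall_subset_closedBall' (by linarith)
    have hbd : ∀ w ∈ Metric.ball z₀ d, ‖h w‖ ≤ m * d ^ (-(2 / p)) := by
      intro w hw
      have hw' := hmax w (hsub (Metric.ball_subset_closedBall hw))
      have hdw : d ≤ R - dist w c := by
        have := dist_triangle w z₀ c
        have := Metric.mem_ball.1 hw
        linarith
      have : d ^ (2 / p) * ‖h w‖ ≤ m :=
        le_trans (mul_le_mul_of_nonneg_right (Real.rpow_le_rpow hd0.le hdw hp2.le)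
          (norm_nonneg _)) hw'
      rw [Real.rpow_neg hd0.le, ← div_eq_mul_inv, le_div_iff₀ (by positivity)]
      linarith
    have h1 := enorm_le_lintegral_ball hd0 hm (hh.mono hsub)
    have h2 : ∫⁻ z in Metric.ball z₀ d, ‖h z‖ₑ ≤
        ENNReal.ofReal ((m * d ^ (-(2 / p))) ^ (1 - p)) * I := by
      calc ∫⁻ z in Metric.ball z₀ d, ‖h z‖ₑ
          ≤ ∫⁻ z in Metric.ball z₀ d,
              ENNReal.ofReal ((m * d ^ (-(2 / p))) ^ (1 - p)) * ‖h z‖ₑ ^ p := by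
            apply setLIntegral_mono' Metric.isOpen_ball.measurableSet
            intro w hw
            calc ‖h w‖ₑ = ‖h w‖ₑ ^ (1 - p) * ‖h w‖ₑ ^ p := by
                  rw [← ENNReal.rpow_add_of_nonneg _ _ (by linarith) hp.le]
                  simp
              _ ≤ _ := by
                  gcongr
                  rw [← ENNReal.ofReal_rpow_of_nonneg (by positivity) (by linarith)]
                  apply ENNReal.rpow_le_rpow _ (by linarith)
                  rw [← ofReal_norm]
                  exact ENNReal.ofReal_le_ofReal (hbd w hw)
        _ = ENNReal.ofReal ((m * d ^ (-(2 / p))) ^ (1 - p)) *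
              ∫⁻ z in Metric.ball z₀ d, ‖h z‖ₑ ^ p := by
            rw [lintegral_const_mul' _ _ ENNReal.ofReal_ne_top]
        _ ≤ _ := by
            refine mul_le_mul_right (lintegral_mono_set (Metric.ball_subset_ball' ?_)) _
            linarith
    have h3 := h1.trans h2
    rw [← ENNReal.ofReal_toReal hIt] at h3 ⊢
    rw [← ofReal_norm, ← ENNReal.ofReal_mul (by positivity), ← ENNReal.ofReal_mul (by positivity)]
      at h3
    rw [← ENNReal.ofReal_mul (by positivity)]
    apply ENNReal.ofReal_le_ofReal
    have h4 := (ENNReal.ofReal_le_ofReal_iff (by positivity)).1 h3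
    have h5 : m = (2 * d) ^ (2 / p) * ‖h z₀‖ := by
      rw [hddef, mul_div_cancel₀ _ two_ne_zero]
    rw [Real.mul_rpow (by positivity) hd0.le] at h5
    -- The exponent 2/p is chosen so that a factor d² appears here and cancels the area of the disk.
    have h6 : (d ^ (-(2 / p))) ^ (1 - p) = (d ^ (2 / p))⁻¹ * d ^ 2 := by
      rw [← Real.rpow_mul hd0.le, ← Real.rpow_neg hd0.le, ← Real.rpow_natCast d 2,
        ← Real.rpow_add hd0]
      congr 1
      field_simp
      push_cast
      ring
    rw [Real.mul_rpow hm0 (by positivity), h6] at h4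
    set D := d ^ (2 / p)
    have hD : 0 < D := by positivity
    have h7 : Real.pi * m ≤ 2 ^ (2 / p) * (m ^ (1 - p) * I.toReal) := by
      have hd2 : 0 < d ^ 2 := by positivity
      have : (Real.pi * m) * d ^ 2 ≤ (2 ^ (2 / p) * (m ^ (1 - p) * I.toReal)) * d ^ 2 := by
        calc (Real.pi * m) * d ^ 2 = 2 ^ (2 / p) * D * (Real.pi * d ^ 2 * ‖h z₀‖) := by
              rw [h5]; ring
          _ ≤ 2 ^ (2 / p) * D * (m ^ (1 - p) * (D⁻¹ * d ^ 2) * I.toReal) := by gcongr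
          _ = _ := by field_simp
      exact le_of_mul_le_mul_right this hd2
    have h8 : m ^ (1 - p) * m ^ p = m := by
      rw [← Real.rpow_add hpos]
      simp
    have h9 : 0 < m ^ (1 - p) := by positivity
    refine le_of_mul_le_mul_left ?_ h9
    have := Real.pi_gt_three
    calc m ^ (1 - p) * m ^ p = m := h8
      _ ≤ Real.pi * m := by nlinarith
      _ ≤ _ := by linarith
  refine le_trans ?_ key
  rw [← ofReal_norm, ENNReal.ofReal_rpow_of_nonneg (norm_nonneg _) hp.le,
    ← ENNReal.ofReal_mul (by positivity)]
  apply ENNReal.ofReal_le_ofReal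
  calc R ^ 2 * ‖h c‖ ^ p = (R ^ (2 / p) * ‖h c‖) ^ p := by
        rw [Real.mul_rpow (by positivity) (norm_nonneg _), ← Real.rpow_mul hR.le,
          div_mul_cancel₀ _ hp.ne']
        simp
    _ ≤ m ^ p := by gcongr

/-- Powers of moduli of holomorphic functions are bounded by their means over disks. -/
lemma exists_enorm_rpow_le_lintegral_ball {p : ℝ} (hp : 0 < p) :
    ∃ C : ℝ≥0, ∀ (h : ℂ → ℂ) (c : ℂ) (R : ℝ), 0 < R → Measurable h →
      DifferentiableOn ℂ h (Metric.closedBall c R) →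
      ENNReal.ofReal (R ^ 2) * ‖h c‖ₑ ^ p ≤ C * ∫⁻ z in Metric.ball c R, ‖h z‖ₑ ^ p := by
  -- Passing from h to h^m lowers the exponent to p/m ≤ 1.
  set m := ⌈p⌉₊
  have hm : 0 < m := Nat.ceil_pos.2 hp
  have hm' : (0 : ℝ) < m := by exact_mod_cast hm
  have hpm : 0 < p / m := by positivity
  have hpm1 : p / m ≤ 1 := by
    rw [div_le_one hm']
    exact Nat.le_ceil p
  refine ⟨Real.toNNReal (2 ^ (2 / (p / m))), fun h c R hR hmeas hh => ?_⟩
  have := enorm_rpow_le_lintegral_ball_of_le_one hpm hpm1 hR (hmeas.pow_const m) (hh.pow m)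
  have e : ∀ z, ‖h z ^ m‖ₑ ^ (p / m) = ‖h z‖ₑ ^ p := by
    intro z
    rw [enorm_pow, ← ENNReal.rpow_natCast, ← ENNReal.rpow_mul, mul_div_cancel₀ _ hm'.ne']
  simp only [e] at this
  exact this


/-! ### Dyadic increments along radii and their local energy -/

/-- The point of modulus `min (1 - 2⁻ᵏ) ‖z‖` on the radius through `z`. -/
noncomputable def radialPoint (k : ℕ) (z : ℂ) : ℂ :=
  ((min (1 - (1 / 2 : ℝ) ^ k) ‖z‖ / ‖z‖ : ℝ) : ℂ) * z

/-- The increment of `f` between two consecutive dyadic points of the radius through `z`. -/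
noncomputable def radialIncrement (f : ℂ → ℂ) (k : ℕ) (z : ℂ) : ℝ :=
  ‖f (radialPoint (k + 1) z) - f (radialPoint k z)‖

/-- Pairs `(z, w)` such that the radius through `z` reaches the level `1 - 2⁻ᵏ` and `w` is close to
its point at that level. -/
def radialRegion (k : ℕ) : Set (ℂ × ℂ) :=
  {x | 1 - (1 / 2 : ℝ) ^ k ≤ ‖x.1‖ ∧ ‖x.1‖ < 1 ∧ ‖x.2 - radialPoint k x.1‖ < 3 / 4 * (1 / 2) ^ k}

/-- The annulus of points at distance comparable to `2⁻ᵏ` from the unit circle. -/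
def dyadicAnnulus (k : ℕ) : Set ℂ :=
  {w | (1 / 2 : ℝ) ^ k / 4 < 1 - ‖w‖ ∧ 1 - ‖w‖ < 2 * (1 / 2) ^ k}

lemma half_pow_pos (k : ℕ) : (0 : ℝ) < (1 / 2) ^ k := by positivity

lemma half_pow_le_one (k : ℕ) : (1 / 2 : ℝ) ^ k ≤ 1 := pow_le_one₀ (by norm_num) (by norm_num)

lemma norm_radialPoint (k : ℕ) (z : ℂ) : ‖radialPoint k z‖ = min (1 - (1 / 2 : ℝ) ^ k) ‖z‖ := by
  have h0 : 0 ≤ min (1 - (1 / 2 : ℝ) ^ k) ‖z‖ :=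
    le_min (by linarith [half_pow_le_one k]) (norm_nonneg z)
  rw [radialPoint, norm_mul, Complex.norm_real, Real.norm_of_nonneg (by positivity)]
  by_cases hz : ‖z‖ = 0
  · rw [hz] at h0 ⊢
    simp only [mul_zero]
    exact le_antisymm h0 (min_le_right _ _)
  · field_simp

lemma radialPoint_zero (z : ℂ) : radialPoint 0 z = 0 := by
  simp [radialPoint]

lemma radialPoint_of_le {k : ℕ} {z : ℂ} (h : ‖z‖ ≤ 1 - (1 / 2 : ℝ) ^ k) : radialPoint k z = z := by
  rw [radialPoint, min_eq_right h]
  by_cases hz : z = 0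
  · simp [hz]
  · rw [div_self (by simpa using hz)]
    simp

lemma norm_radialPoint_succ_sub_le (k : ℕ) (z : ℂ) :
    ‖radialPoint (k + 1) z - radialPoint k z‖ ≤ (1 / 2 : ℝ) ^ k / 2 := by
  have hk := half_pow_pos k
  have h1 : (1 / 2 : ℝ) ^ (k + 1) = (1 / 2) ^ k / 2 := by rw [pow_succ]; ring
  rw [radialPoint, radialPoint, ← sub_mul, ← Complex.ofReal_sub, norm_mul, Complex.norm_real,
    ← sub_div, norm_div, norm_norm]
  by_cases hz : ‖z‖ = 0
  · rw [hz]
    simp only [mul_zero]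
    positivity
  rw [div_mul_cancel₀ _ hz, Real.norm_eq_abs, h1]
  calc _ ≤ max |1 - (1 / 2 : ℝ) ^ k / 2 - (1 - (1 / 2 : ℝ) ^ k)| |‖z‖ - ‖z‖| :=
        abs_min_sub_min_le_max _ _ _ _
    _ ≤ _ := by
      rw [sub_self, abs_zero]
      refine max_le ?_ (by positivity)
      rw [abs_of_nonneg (by linarith)]
      linarith

lemma norm_radialPoint_lt_one (k : ℕ) (z : ℂ) : ‖radialPoint k z‖ ≤ 1 - (1 / 2 : ℝ) ^ k := by
  rw [norm_radialPoint]
  exact min_le_left _ _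

lemma radialIncrement_nonneg (f : ℂ → ℂ) (k : ℕ) (z : ℂ) : 0 ≤ radialIncrement f k z :=
  norm_nonneg _

lemma radialIncrement_of_le (f : ℂ → ℂ) {k : ℕ} {z : ℂ} (h : ‖z‖ ≤ 1 - (1 / 2 : ℝ) ^ k) :
    radialIncrement f k z = 0 := by
  have h2 : (1 / 2 : ℝ) ^ (k + 1) ≤ (1 / 2) ^ k :=
    pow_le_pow_of_le_one (by norm_num) (by norm_num) (Nat.le_succ k)
  rw [radialIncrement, radialPoint_of_le h, radialPoint_of_le (by linarith), sub_self, norm_zero]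

/-- The increments telescope, because the radial points start at 0 and have reached z by level n. -/
lemma norm_sub_le_sum_radialIncrement (f : ℂ → ℂ) {n : ℕ} {z : ℂ}
    (h : ‖z‖ ≤ 1 - (1 / 2 : ℝ) ^ n) :
    ‖f z - f 0‖ ≤ ∑ k ∈ Finset.range n, radialIncrement f k z := by
  have := dist_le_range_sum_dist (fun k => f (radialPoint k z)) n
  rw [radialPoint_zero, radialPoint_of_le h, dist_comm, dist_eq_norm] at this
  refine this.trans (Finset.sum_le_sum fun k _ => ?_)
  rw [dist_comm, dist_eq_norm, radialIncrement]

lemma exists_le_one_sub_half_pow {x : ℝ} (hx : x < 1) : ∃ n : ℕ, x ≤ 1 - (1 / 2 : ℝ) ^ n := by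
  obtain ⟨n, hn⟩ := exists_pow_lt_of_lt_one (sub_pos.2 hx) (by norm_num : (1 / 2 : ℝ) < 1)
  exact ⟨n, by linarith⟩

lemma measurable_radialPoint (k : ℕ) : Measurable (radialPoint k) := by
  unfold radialPoint
  fun_prop

lemma measurableSet_radialRegion (k : ℕ) : MeasurableSet (radialRegion k) := by
  have h := (measurable_radialPoint k).comp (measurable_fst : Measurable (Prod.fst : ℂ × ℂ → ℂ))
  refine MeasurableSet.inter ?_ (MeasurableSet.inter ?_ ?_)
  · exact measurableSet_le measurable_const measurable_fst.norm
  · exact measurableSet_lt measurable_fst.norm measurable_const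
  · exact measurableSet_lt (measurable_snd.sub h).norm measurable_const

lemma measurableSet_dyadicAnnulus (k : ℕ) : MeasurableSet (dyadicAnnulus k) := by
  refine MeasurableSet.inter ?_ ?_
  · exact measurableSet_lt measurable_const (measurable_const.sub measurable_norm)
  · exact measurableSet_lt (measurable_const.sub measurable_norm) measurable_const

lemma dyadicAnnulus_subset (k : ℕ) : dyadicAnnulus k ⊆ unitDisk := by
  intro w hw
  have := half_pow_pos k
  rw [unitDisk, mem_ball_zero_iff]
  linarith [hw.1]

lemma mem_dyadicAnnulus_of_mem_radialRegion {k : ℕ} {z w : ℂ} (h : (z, w) ∈ radialRegion k) :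
    w ∈ dyadicAnnulus k := by
  obtain ⟨h1, h2, h3⟩ := h
  simp only at h1 h2 h3
  have h4 := norm_radialPoint k z
  rw [min_eq_left h1] at h4
  have h5 := norm_sub_norm_le w (radialPoint k z)
  have h6 := norm_sub_norm_le (radialPoint k z) w
  rw [norm_sub_rev] at h6
  have := half_pow_pos k
  constructor <;> linarith

/-- The mean value inequality on a disk of radius comparable to 2^(-k) bounds the increment by
2^(-k) sup |f'|, and the sub-mean value property bounds sup |f'|^p by 2^(2k) times a local integral.
-/
lemma exists_radialIncrement_rpow_le {p : ℝ} (hp : 0 < p) :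
    ∃ C : ℝ≥0, ∀ (f : ℂ → ℂ), AnalyticOnDisk f → ∀ (k : ℕ) (z : ℂ), z ∈ unitDisk →
      ENNReal.ofReal (radialIncrement f k z) ^ p ≤
        C * ENNReal.ofReal (((1 / 2 : ℝ) ^ k) ^ (p - 2)) *
          ∫⁻ w, (radialRegion k).indicator (fun x => ‖deriv f x.2‖ₑ ^ p) (z, w) := by
  obtain ⟨C, hC⟩ := exists_enorm_rpow_le_lintegral_ball hp
  -- The 16 comes from sub-mean value disks of radius δ/4; the added 1 keeps the constant nonzero,
  -- so that the bound is trivial when the integral is infinite.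
  refine ⟨16 * C + 1, fun f hf k z hz => ?_⟩
  rw [unitDisk, mem_ball_zero_iff] at hz
  by_cases hact : ‖z‖ ≤ 1 - (1 / 2 : ℝ) ^ k
  · rw [radialIncrement_of_le f hact]
    simp [hp]
  push Not at hact
  set δ : ℝ := (1 / 2) ^ k with hδ
  have hδ0 : 0 < δ := half_pow_pos k
  set Q := radialPoint k z with hQ
  have hQn : ‖Q‖ ≤ 1 - δ := norm_radialPoint_lt_one k z
  have hint : ∫⁻ w, (radialRegion k).indicator (fun x => ‖deriv f x.2‖ₑ ^ p) (z, w) =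
      ∫⁻ w in Metric.ball Q (3 / 4 * δ), ‖deriv f w‖ₑ ^ p := by
    rw [← lintegral_indicator Metric.isOpen_ball.measurableSet]
    congr 1
    ext w
    by_cases hw : w ∈ Metric.ball Q (3 / 4 * δ)
    · rw [Set.indicator_of_mem hw, Set.indicator_of_mem]
      exact ⟨hact.le, hz, mem_ball_iff_norm.1 hw⟩
    · rw [Set.indicator_of_notMem hw, Set.indicator_of_notMem]
      intro h
      exact hw (mem_ball_iff_norm.2 h.2.2)
  rw [hint]
  set I := ∫⁻ w in Metric.ball Q (3 / 4 * δ), ‖deriv f w‖ₑ ^ p with hI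
  by_cases hIt : I = ∞
  · rw [hIt, ENNReal.mul_top]
    · exact le_top
    · refine mul_ne_zero (by simp) ?_
      rw [Ne, ENNReal.ofReal_eq_zero, not_le]
      positivity
  have hopen : IsOpen unitDisk := Metric.isOpen_ball
  have hd : DifferentiableOn ℂ (deriv f) unitDisk := hf.deriv hopen
  -- Consecutive radial points are at most δ/2 apart and each point between them gets a disk of
  -- radius δ/4. This explains the radius 3δ/4 in `radialRegion`, which stays inside the unit disk
  -- because |Q| ≤ 1 - δ.
  have hsubd : ∀ ζ ∈ Metric.closedBall Q (δ / 2), Metric.closedBall ζ (δ / 4) ⊆ unitDisk := by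
    intro ζ hζ w hw
    rw [mem_closedBall_iff_norm] at hζ hw
    rw [unitDisk, mem_ball_zero_iff]
    have := norm_add_le (w - ζ) (ζ - Q + Q)
    have := norm_add_le (ζ - Q) Q
    simp only [sub_add_cancel] at *
    linarith
  have hpt : ∀ ζ ∈ Metric.closedBall Q (δ / 2),
      ‖deriv f ζ‖ ≤ (16 * C * (δ ^ 2)⁻¹ * I.toReal) ^ (1 / p) := by
    intro ζ hζ
    have h1 := hC (deriv f) ζ (δ / 4) (by positivity) (measurable_deriv f)
      (hd.mono (hsubd ζ hζ))
    have h2 : ∫⁻ w in Metric.ball ζ (δ / 4), ‖deriv f w‖ₑ ^ p ≤ I := by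
      apply lintegral_mono_set
      apply Metric.ball_subset_ball'
      have := Metric.mem_closedBall.1 hζ
      linarith
    have h3 := h1.trans (mul_le_mul_right h2 _)
    rw [← ENNReal.ofReal_toReal hIt, ← ofReal_norm, ENNReal.ofReal_rpow_of_nonneg (norm_nonneg _) hp.le,
      ← ENNReal.ofReal_coe_nnreal, ← ENNReal.ofReal_mul (by positivity),
      ← ENNReal.ofReal_mul (by positivity), ENNReal.ofReal_le_ofReal_iff (by positivity)] at h3
    rw [one_div, Real.le_rpow_inv_iff_of_pos (norm_nonneg _) (by positivity) hp]
    have : 16 * C * (δ ^ 2)⁻¹ * I.toReal = 16 * (δ ^ 2)⁻¹ * (C * I.toReal) := by ring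
    rw [this]
    calc ‖deriv f ζ‖ ^ p = 16 * (δ ^ 2)⁻¹ * ((δ / 4) ^ 2 * ‖deriv f ζ‖ ^ p) := by
          field_simp; norm_num
      _ ≤ _ := by gcongr
  have hmv : radialIncrement f k z ≤ (16 * C * (δ ^ 2)⁻¹ * I.toReal) ^ (1 / p) * (δ / 2) := by
    have hQ' : radialPoint (k + 1) z ∈ Metric.closedBall Q (δ / 2) := by
      rw [mem_closedBall_iff_norm]
      exact norm_radialPoint_succ_sub_le k z
    have := (convex_closedBall Q (δ / 2)).norm_image_sub_le_of_norm_deriv_le (𝕜 := ℂ) (f := f)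
      (fun ζ hζ => hf.differentiableAt (hopen.mem_nhds
        (hsubd ζ hζ (Metric.mem_closedBall_self (by positivity))))) hpt
      (Metric.mem_closedBall_self (by positivity)) hQ'
    refine this.trans ?_
    gcongr
    exact norm_radialPoint_succ_sub_le k z
  rw [ENNReal.ofReal_rpow_of_nonneg (radialIncrement_nonneg f k z) hp.le,
    ← ENNReal.ofReal_toReal hIt, ← ENNReal.ofReal_coe_nnreal, ← ENNReal.ofReal_mul (by positivity),
    ← ENNReal.ofReal_mul (by positivity)]
  apply ENNReal.ofReal_le_ofReal
  calc radialIncrement f k z ^ p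
      ≤ ((16 * C * (δ ^ 2)⁻¹ * I.toReal) ^ (1 / p) * δ) ^ p := by
        apply Real.rpow_le_rpow (radialIncrement_nonneg f k z) _ hp.le
        refine hmv.trans ?_
        gcongr
        linarith
    _ = 16 * C * δ ^ (p - 2) * I.toReal := by
        rw [Real.mul_rpow (by positivity) hδ0.le, ← Real.rpow_mul (by positivity),
          one_div_mul_cancel hp.ne', Real.rpow_one, Real.rpow_sub hδ0, Real.rpow_two]
        field_simp
    _ ≤ _ := by
        push_cast
        gcongr
        linarith

/-- The part of the Dirichlet integral of `f` over a dyadic annulus. -/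
noncomputable def annulusEnergy (p α : ℝ) (f : ℂ → ℂ) (k : ℕ) : ℝ≥0∞ :=
  ENNReal.ofReal (((1 / 2 : ℝ) ^ k) ^ α) * ∫⁻ w in dyadicAnnulus k, ‖deriv f w‖ₑ ^ p

/-- The Dirichlet integral of `f`. -/
noncomputable def dirichletEnergy (p α : ℝ) (f : ℂ → ℂ) : ℝ≥0∞ :=
  ∫⁻ z, ‖deriv f z‖ₑ ^ p * ENNReal.ofReal ((1 - ‖z‖ ^ 2) ^ α) ∂areaDisk

/-- The window of index k + 3 ends where that of index k begins, so v lies in at most three windows.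
-/
lemma tsum_indicator_dyadic_le (v : ℝ) (c : ℝ≥0∞) :
    ∑' k : ℕ, {k : ℕ | (1 / 2 : ℝ) ^ k / 4 < v ∧ v < 2 * (1 / 2) ^ k}.indicator (fun _ => c) k
      ≤ 3 * c := by
  classical
  set S := {k : ℕ | (1 / 2 : ℝ) ^ k / 4 < v ∧ v < 2 * (1 / 2) ^ k} with hS
  by_cases hne : ∃ k, k ∈ S
  · set k₀ := Nat.find hne
    have h₀ : k₀ ∈ S := Nat.find_spec hne
    have hsup : ∀ k ∉ Finset.Ico k₀ (k₀ + 3), S.indicator (fun _ => c) k = 0 := by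
      intro k hk
      apply Set.indicator_of_notMem
      intro hkS
      have h1 : k₀ ≤ k := Nat.find_min' hne hkS
      have h2 : k₀ + 3 ≤ k := by
        by_contra h
        exact hk (Finset.mem_Ico.2 ⟨h1, by omega⟩)
      have h3 : (1 / 2 : ℝ) ^ k ≤ (1 / 2) ^ (k₀ + 3) :=
        pow_le_pow_of_le_one (by norm_num) (by norm_num) h2
      rw [pow_add] at h3
      have h4 := h₀.1
      have h5 := hkS.2
      norm_num at h3 h4 h5
      linarith
    rw [tsum_eq_sum hsup]
    calc _ ≤ ∑ k ∈ Finset.Ico k₀ (k₀ + 3), c :=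
          Finset.sum_le_sum fun k _ => Set.indicator_le_self _ _ _
      _ = 3 * c := by simp
  · push Not at hne
    simp [hne]

lemma rpow_le_of_comparable {a b : ℝ} (α : ℝ) (hb : 0 < b) (h1 : b ≤ 4 * a) (h2 : a ≤ 4 * b) :
    a ^ α ≤ 4 ^ |α| * b ^ α := by
  have ha : 0 < a := by linarith
  rcases le_total 0 α with h | h
  · rw [abs_of_nonneg h, ← Real.mul_rpow (by norm_num) hb.le]
    exact Real.rpow_le_rpow ha.le h2 h
  · rw [abs_of_nonpos h, Real.rpow_neg (by norm_num), ← Real.inv_rpow (by norm_num),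
      ← Real.mul_rpow (by norm_num) hb.le]
    exact Real.rpow_le_rpow_of_nonpos (by positivity) (by linarith) h

lemma exists_tsum_annulusEnergy_le (p α : ℝ) :
    ∃ C : ℝ≥0, ∀ f, ∑' k, annulusEnergy p α f k ≤ C * dirichletEnergy p α f := by
  -- The 3 counts overlapping annuli, 4^|α| compares (2^(-k))^α with (1 - |w|²)^α for either sign of
  -- α, and π undoes the normalization of area.
  refine ⟨Real.toNNReal (3 * 4 ^ |α|) * Real.toNNReal Real.pi, fun f => ?_⟩
  have hmeas : Measurable fun w => ‖deriv f w‖ₑ ^ p := (measurable_deriv f).enorm.pow_const p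
  have hD : dirichletEnergy p α f = (ENNReal.ofReal Real.pi)⁻¹ *
      ∫⁻ z in unitDisk, ‖deriv f z‖ₑ ^ p * ENNReal.ofReal ((1 - ‖z‖ ^ 2) ^ α) := by
    rw [dirichletEnergy, areaDisk, lintegral_smul_measure, smul_eq_mul]
  have hpi : ENNReal.ofReal Real.pi ≠ 0 := by simpa using Real.pi_pos
  rw [hD, ENNReal.coe_mul, mul_assoc, ← ENNReal.ofReal,
    show ((Real.toNNReal Real.pi : ℝ≥0) : ℝ≥0∞) = ENNReal.ofReal Real.pi from rfl,
    ← mul_assoc (ENNReal.ofReal Real.pi),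
    ENNReal.mul_inv_cancel hpi ENNReal.ofReal_ne_top, one_mul]
  have hA : ∀ k, annulusEnergy p α f k = ∫⁻ w in unitDisk, (dyadicAnnulus k).indicator
      (fun w => ENNReal.ofReal (((1 / 2 : ℝ) ^ k) ^ α) * ‖deriv f w‖ₑ ^ p) w := by
    intro k
    rw [lintegral_indicator (measurableSet_dyadicAnnulus k),
      Measure.restrict_restrict (measurableSet_dyadicAnnulus k),
      Set.inter_eq_left.2 (dyadicAnnulus_subset k), lintegral_const_mul _ hmeas, annulusEnergy]
  simp only [hA]
  rw [← lintegral_tsum fun k => ((hmeas.const_mul _).indicator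
    (measurableSet_dyadicAnnulus k)).aemeasurable,
    ← lintegral_const_mul' _ _ ENNReal.ofReal_ne_top]
  apply setLIntegral_mono' Metric.isOpen_ball.measurableSet
  intro w hw
  rw [mem_ball_zero_iff] at hw
  have hv : 0 < 1 - ‖w‖ := by linarith
  refine le_trans (ENNReal.tsum_le_tsum fun k => ?_) (le_trans (tsum_indicator_dyadic_le (1 - ‖w‖)
    (ENNReal.ofReal (4 ^ |α|) * (‖deriv f w‖ₑ ^ p * ENNReal.ofReal ((1 - ‖w‖ ^ 2) ^ α)))) ?_)
  · by_cases hk : w ∈ dyadicAnnulus k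
    · rw [Set.indicator_of_mem hk, Set.indicator_of_mem (show k ∈ {k : ℕ | (1 / 2 : ℝ) ^ k / 4 < 1 - ‖w‖ ∧
        1 - ‖w‖ < 2 * (1 / 2) ^ k} from hk)]
      rw [mul_comm (‖deriv f w‖ₑ ^ p), ← mul_assoc, ← ENNReal.ofReal_mul (by positivity)]
      gcongr
      have h1 := hk.1
      have h2 := hk.2
      have h3 := norm_nonneg w
      have h4 : 1 - ‖w‖ ^ 2 = (1 - ‖w‖) * (1 + ‖w‖) := by ring
      apply rpow_le_of_comparable
      · rw [h4]; positivity
      · nlinarith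
      · nlinarith
    · rw [Set.indicator_of_notMem hk]
      exact zero_le
  · rw [← mul_assoc, ENNReal.ofReal_mul (by norm_num)]
    simp


/-! ### Carleson squares and integration of the increments -/

lemma two_div_pi_mul_abs_le_norm_one_sub_exp {τ : ℝ} (h : |τ| ≤ Real.pi) :
    2 / Real.pi * |τ| ≤ ‖1 - Complex.exp (τ * Complex.I)‖ := by
  rw [norm_sub_rev, mul_comm (τ : ℂ), Complex.norm_exp_I_mul_ofReal_sub_one, norm_mul,
    Real.norm_eq_abs, Real.norm_eq_abs, abs_two]
  have h2 : |τ / 2| ≤ Real.pi / 2 := by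
    rw [abs_div, abs_two]
    linarith
  have := Real.mul_abs_le_abs_sin h2
  rw [abs_div, abs_two] at this
  linarith

/-- Closeness of w to the level-k radial point of z forces arg z to be within 2π 2^(-k) of arg w,
while |z| ≥ 1 - 2^(-k); a square of twice the side 2^(-k) over the arc centred at arg w therefore
suffices. For k = 0 the truncated subtraction gives side 1, and the square is the whole disk. -/
lemma exists_slice_radialRegion_subset (k : ℕ) (w : ℂ) :
    ∃ a : ℝ, {z | (z, w) ∈ radialRegion k} ⊆ carlesonSquare a ((1 / 2) ^ (k - 1)) := by
  rcases Nat.eq_zero_or_pos k with rfl | hk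
  · refine ⟨-Real.pi, fun z hz => ⟨‖z‖, Complex.arg z, by simp, hz.2.1, ?_, ?_, ?_⟩⟩
    · exact (Complex.neg_pi_lt_arg z).le
    · have := Complex.arg_le_pi z
      simp
      linarith
    · exact (Complex.norm_mul_exp_arg_mul_I z).symm
  set δ : ℝ := (1 / 2) ^ k with hδ
  have hδ0 : 0 < δ := half_pow_pos k
  have hδ2 : δ ≤ 1 / 2 := by
    have := pow_le_pow_of_le_one (by norm_num : (0 : ℝ) ≤ 1 / 2) (by norm_num) hk
    rwa [pow_one] at this
  have hl : (1 / 2 : ℝ) ^ (k - 1) = 2 * δ := by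
    obtain ⟨j, rfl⟩ := Nat.exists_eq_add_of_le' hk
    rw [hδ, pow_succ, Nat.add_sub_cancel]
    ring
  set φ := Complex.arg w with hφ
  refine ⟨φ - 2 * Real.pi * δ, fun z hz => ?_⟩
  have hann := mem_dyadicAnnulus_of_mem_radialRegion hz
  obtain ⟨h1, h2, h3⟩ := hz
  simp only at h1 h2 h3
  set τ := Complex.arg (z * Complex.exp (-φ * Complex.I)) with hτ
  have hz0 : 0 < ‖z‖ := by linarith
  have hzτ : z = ‖z‖ * Complex.exp (((φ + τ : ℝ) : ℂ) * Complex.I) := by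
    have h4 := Complex.norm_mul_exp_arg_mul_I (z * Complex.exp (-φ * Complex.I))
    have h5 : ‖Complex.exp (-φ * Complex.I)‖ = 1 := by
      have := Complex.norm_exp_ofReal_mul_I (-φ)
      simpa using this
    rw [norm_mul, h5, mul_one, ← hτ] at h4
    have h6 : Complex.exp (-φ * Complex.I) * Complex.exp (φ * Complex.I) = 1 := by
      rw [← Complex.exp_add]
      simp
    calc z = z * (Complex.exp (-φ * Complex.I) * Complex.exp (φ * Complex.I)) := by rw [h6, mul_one]
      _ = (z * Complex.exp (-φ * Complex.I)) * Complex.exp (φ * Complex.I) := by ring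
      _ = _ := by
        rw [← h4, mul_assoc, ← Complex.exp_add]
        congr 2
        push_cast
        ring
  have hQ : radialPoint k z =
      ((1 - δ : ℝ) : ℂ) * (Complex.exp (φ * Complex.I) * Complex.exp (τ * Complex.I)) := by
    rw [radialPoint, min_eq_left h1, ← Complex.exp_add, ← add_mul, ← Complex.ofReal_add]
    nth_rewrite 2 [hzτ]
    rw [← mul_assoc, ← Complex.ofReal_mul, div_mul_cancel₀ _ hz0.ne']
  have hw : w = ‖w‖ * Complex.exp (φ * Complex.I) := (Complex.norm_mul_exp_arg_mul_I w).symm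
  have hdist : ‖(‖w‖ : ℂ) - ((1 - δ : ℝ) : ℂ) * Complex.exp (τ * Complex.I)‖ < 3 / 4 * δ := by
    have : w - radialPoint k z = Complex.exp (φ * Complex.I) *
        ((‖w‖ : ℂ) - ((1 - δ : ℝ) : ℂ) * Complex.exp (τ * Complex.I)) := by
      rw [hQ]
      nth_rewrite 1 [hw]
      ring
    rw [this, norm_mul, Complex.norm_exp_ofReal_mul_I, one_mul] at h3
    exact h3
  have hpi := Real.pi_pos
  have hτpi : |τ| ≤ Real.pi := Complex.abs_arg_le_pi _
  have h7 := two_div_pi_mul_abs_le_norm_one_sub_exp hτpi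
  -- Here 15/4 = 2 + 3/4 + 1: the distance of w from the circle, the distance of w from the radial
  -- point, and the distance of that point from the circle.
  have h8 : ‖1 - Complex.exp (τ * Complex.I)‖ ≤ 15 / 4 * δ := by
    have e : 1 - Complex.exp (τ * Complex.I) = ((1 - ‖w‖ : ℝ) : ℂ) +
        (((‖w‖ : ℂ) - ((1 - δ : ℝ) : ℂ) * Complex.exp (τ * Complex.I)) -
          (δ : ℂ) * Complex.exp (τ * Complex.I)) := by
      push_cast
      ring
    have e1 : ‖((1 - ‖w‖ : ℝ) : ℂ)‖ ≤ 2 * δ := by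
      rw [Complex.norm_real, Real.norm_eq_abs, abs_of_pos (by linarith [hann.1])]
      exact hann.2.le
    have e2 : ‖(δ : ℂ) * Complex.exp (τ * Complex.I)‖ = δ := by
      rw [norm_mul, Complex.norm_exp_ofReal_mul_I, mul_one, Complex.norm_real,
        Real.norm_of_nonneg hδ0.le]
    rw [e]
    refine (norm_add_le _ _).trans ?_
    have := norm_sub_le ((‖w‖ : ℂ) - ((1 - δ : ℝ) : ℂ) * Complex.exp (τ * Complex.I))
      ((δ : ℂ) * Complex.exp (τ * Complex.I))
    linarith
  have h9 : |τ| ≤ 2 * Real.pi * δ := by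
    have h10 := h7.trans h8
    rw [div_mul_eq_mul_div, div_le_iff₀ hpi] at h10
    nlinarith
  obtain ⟨h11, h12⟩ := abs_le.1 h9
  refine ⟨‖z‖, φ + τ, ?_, h2, ?_, ?_, hzτ⟩
  · rw [hl]; linarith
  · linarith
  · rw [hl]; linarith

/-- The local disk lies in the k-th annulus. This form forgets the direction of z, so the increments
of one function along all radii share a single majorant. -/
lemma exists_radialIncrement_rpow_le_annulusEnergy {p : ℝ} (hp : 0 < p) (α : ℝ) :
    ∃ C : ℝ≥0, ∀ (f : ℂ → ℂ), AnalyticOnDisk f → ∀ (k : ℕ) (z : ℂ), z ∈ unitDisk →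
      ENNReal.ofReal (radialIncrement f k z) ^ p ≤
        C * ENNReal.ofReal (((1 / 2 : ℝ) ^ k) ^ (-(α + 2 - p))) * annulusEnergy p α f k := by
  obtain ⟨C, hC⟩ := exists_radialIncrement_rpow_le hp
  refine ⟨C, fun f hf k z hz => (hC f hf k z hz).trans ?_⟩
  have hk := half_pow_pos k
  rw [annulusEnergy, mul_assoc, mul_assoc, ← mul_assoc (ENNReal.ofReal _) (ENNReal.ofReal _),
    ← ENNReal.ofReal_mul (by positivity), ← Real.rpow_add hk,
    show -(α + 2 - p) + α = p - 2 by ring, ← lintegral_indicator (measurableSet_dyadicAnnulus k)]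
  gcongr with w
  by_cases hw : (z, w) ∈ radialRegion k
  · rw [Set.indicator_of_mem hw, Set.indicator_of_mem (mem_dyadicAnnulus_of_mem_radialRegion hw)]
  · rw [Set.indicator_of_notMem hw]
    exact zero_le

/-- Integrating the increments against a measure whose Carleson squares are controlled. -/
lemma exists_lintegral_tsum_radialIncrement_le {p : ℝ} (hp : 0 < p) (α : ℝ) :
    ∃ C : ℝ≥0, ∀ (μ : Measure ℂ) [SFinite μ] (W : ℕ → ℝ≥0∞) (B : ℝ≥0∞),
      (∀ k a, W k * μ (carlesonSquare a ((1 / 2) ^ (k - 1))) ≤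
        B * ENNReal.ofReal (((1 / 2 : ℝ) ^ k) ^ (α + 2 - p))) →
      ∀ f, AnalyticOnDisk f →
        ∫⁻ z in unitDisk, ∑' k, W k * ENNReal.ofReal (radialIncrement f k z) ^ p ∂μ ≤
          C * B * dirichletEnergy p α f := by
  obtain ⟨C, hC⟩ := exists_radialIncrement_rpow_le hp
  obtain ⟨C', hC'⟩ := exists_tsum_annulusEnergy_le p α
  refine ⟨C * C', fun μ _ W B hB f hf => ?_⟩
  set Φ : ℂ → ℝ≥0∞ := fun w => ‖deriv f w‖ₑ ^ p with hΦdef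
  have hΦ : Measurable Φ := (measurable_deriv f).enorm.pow_const p
  have hind : ∀ k, Measurable ((radialRegion k).indicator fun x : ℂ × ℂ => Φ x.2) := fun k =>
    (hΦ.comp measurable_snd).indicator (measurableSet_radialRegion k)
  have hGm : ∀ k, Measurable fun z => ∫⁻ w, (radialRegion k).indicator (fun x => Φ x.2) (z, w) :=
    fun k => (hind k).lintegral_prod_right'
  have hG : ∀ k, W k * ∫⁻ z in unitDisk,
      (∫⁻ w, (radialRegion k).indicator (fun x => Φ x.2) (z, w)) ∂μ ≤
        B * ENNReal.ofReal (((1 / 2 : ℝ) ^ k) ^ (α + 2 - p)) * ∫⁻ w in dyadicAnnulus k, Φ w := by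
    intro k
    -- After Fubini, w is fixed and the admissible z fill part of a single Carleson square, so only
    -- one-box information on μ is needed.
    rw [lintegral_lintegral_swap
      (f := fun z w => (radialRegion k).indicator (fun x => Φ x.2) (z, w)) (hind k).aemeasurable]
    have hin : ∀ w, W k * ∫⁻ z in unitDisk, (radialRegion k).indicator (fun x => Φ x.2) (z, w) ∂μ ≤
        B * ENNReal.ofReal (((1 / 2 : ℝ) ^ k) ^ (α + 2 - p)) * (dyadicAnnulus k).indicator Φ w := by
      intro w
      by_cases hw : w ∈ dyadicAnnulus k
      · rw [Set.indicator_of_mem hw]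
        obtain ⟨a, ha⟩ := exists_slice_radialRegion_subset k w
        calc W k * ∫⁻ z in unitDisk, (radialRegion k).indicator (fun x => Φ x.2) (z, w) ∂μ
            ≤ W k * ∫⁻ z, {z | (z, w) ∈ radialRegion k}.indicator (fun _ => Φ w) z ∂μ := by
              refine mul_le_mul_right ((setLIntegral_le_lintegral _ _).trans
                (lintegral_mono fun z => ?_)) _
              by_cases hz : (z, w) ∈ radialRegion k
              · rw [Set.indicator_of_mem hz,
                  Set.indicator_of_mem (show z ∈ {z | (z, w) ∈ radialRegion k} from hz)]
              · rw [Set.indicator_of_notMem hz]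
                exact zero_le
          _ ≤ W k * (Φ w * μ {z | (z, w) ∈ radialRegion k}) := by
              gcongr
              exact lintegral_indicator_const_le _ _
          _ ≤ W k * (Φ w * μ (carlesonSquare a ((1 / 2) ^ (k - 1)))) := by
              gcongr
          _ = (W k * μ (carlesonSquare a ((1 / 2) ^ (k - 1)))) * Φ w := by ring
          _ ≤ _ := mul_le_mul_left (hB k a) _
      · have : ∀ z, (radialRegion k).indicator (fun x => Φ x.2) (z, w) = 0 := fun z =>
          Set.indicator_of_notMem (fun h => hw (mem_dyadicAnnulus_of_mem_radialRegion h)) _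
        simp [this]
    have hWm : Measurable fun w =>
        ∫⁻ z in unitDisk, (radialRegion k).indicator (fun x => Φ x.2) (z, w) ∂μ :=
      (hind k).lintegral_prod_left'
    rw [← lintegral_const_mul _ hWm, ← lintegral_indicator (measurableSet_dyadicAnnulus k),
      ← lintegral_const_mul _ (hΦ.indicator (measurableSet_dyadicAnnulus k))]
    exact lintegral_mono hin
  calc ∫⁻ z in unitDisk, ∑' k, W k * ENNReal.ofReal (radialIncrement f k z) ^ p ∂μ
      ≤ ∫⁻ z in unitDisk, ∑' k, W k * (C * ENNReal.ofReal (((1 / 2 : ℝ) ^ k) ^ (p - 2)) *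
          ∫⁻ w, (radialRegion k).indicator (fun x => Φ x.2) (z, w)) ∂μ := by
        apply setLIntegral_mono' Metric.isOpen_ball.measurableSet
        intro z hz
        gcongr with k
        exact hC f hf k z hz
    _ = ∑' k, (C * ENNReal.ofReal (((1 / 2 : ℝ) ^ k) ^ (p - 2))) * (W k * ∫⁻ z in unitDisk,
          (∫⁻ w, (radialRegion k).indicator (fun x => Φ x.2) (z, w)) ∂μ) := by
        rw [lintegral_tsum fun k => (((hGm k).const_mul _).const_mul _).aemeasurable]
        congr 1
        ext k
        rw [lintegral_const_mul _ ((hGm k).const_mul _), lintegral_const_mul _ (hGm k)]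
        ring
    _ ≤ ∑' k, C * B * annulusEnergy p α f k := by
        refine ENNReal.tsum_le_tsum fun k => (mul_le_mul_right (hG k) _).trans (le_of_eq ?_)
        have hk := half_pow_pos k
        have hα : ENNReal.ofReal (((1 / 2 : ℝ) ^ k) ^ α) =
            ENNReal.ofReal (((1 / 2 : ℝ) ^ k) ^ (p - 2)) *
              ENNReal.ofReal (((1 / 2 : ℝ) ^ k) ^ (α + 2 - p)) := by
          rw [← ENNReal.ofReal_mul (by positivity), ← Real.rpow_add hk]
          ring_nf
        rw [annulusEnergy, hα]
        ring
    _ ≤ _ := by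
        rw [ENNReal.tsum_mul_left, ENNReal.coe_mul]
        refine (mul_le_mul_right (hC' f) _).trans (le_of_eq ?_)
        ring


/-! ### Hedberg-type inequalities for sequences -/

/-- Optimisation of a two-sided power bound. -/
lemma le_of_forall_le_rpow_add_rpow {u v X a b : ℝ} (hu : 0 < u) (hv : 0 < v) (ha : 0 < a)
    (hb : 0 ≤ b) (h0 : X ≤ b) (h : ∀ s : ℝ, 1 ≤ s → X ≤ a * s ^ u + b * s ^ (-v)) :
    X ≤ 2 * (a ^ (v / (u + v)) * b ^ (u / (u + v))) := by
  have huv : 0 < u + v := by positivity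
  rcases hb.eq_or_lt with rfl | hb'
  · rw [Real.zero_rpow (by positivity)]
    simpa using h0
  have hsum : v / (u + v) + u / (u + v) = 1 := by field_simp; ring
  rcases le_total b a with hba | hab
  · have : b ≤ a ^ (v / (u + v)) * b ^ (u / (u + v)) := by
      calc b = b ^ (v / (u + v)) * b ^ (u / (u + v)) := by
            rw [← Real.rpow_add hb', hsum, Real.rpow_one]
        _ ≤ _ := by gcongr
    linarith
  -- This value of s makes the two terms equal. It is admissible only when a ≤ b; otherwise the
  -- bound X ≤ b is already enough.
  · have h1 : 1 ≤ (b / a) ^ (1 / (u + v)) := by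
      apply Real.one_le_rpow _ (by positivity)
      rwa [one_le_div ha]
    refine (h _ h1).trans (le_of_eq ?_)
    rw [← Real.rpow_mul (by positivity), ← Real.rpow_mul (by positivity),
      Real.div_rpow hb ha.le, Real.div_rpow hb ha.le, two_mul]
    have e1 : v / (u + v) = 1 - 1 / (u + v) * u := by field_simp; ring
    have e2 : u / (u + v) = 1 + 1 / (u + v) * (-v) := by field_simp; ring
    have e3 : 1 / (u + v) * (-v) = 1 / (u + v) * u - 1 := by field_simp; ring
    congr 1
    · rw [e1, Real.rpow_sub ha, Real.rpow_one, show u / (u + v) = 1 / (u + v) * u by ring]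
      field_simp
    · rw [e2, Real.rpow_add hb', Real.rpow_one, e1, e3, Real.rpow_sub ha, Real.rpow_sub ha,
        Real.rpow_one]
      field_simp

/-- A sequence bounded by two geometric progressions, one increasing and one decreasing. -/
lemma exists_sum_le_of_geometric_bounds {u v : ℝ} (hu : 0 < u) (hv : 0 < v) :
    ∃ c : ℝ, 0 < c ∧ ∀ (n : ℕ) (y : ℕ → ℝ) (a b : ℝ), 0 < a → 0 ≤ b → (∀ k, 0 ≤ y k) →
      (∀ k, y k ≤ a * ((2 : ℝ) ^ k) ^ u) → (∀ k, y k ≤ b * ((2 : ℝ) ^ k) ^ (-v)) →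
      ∑ k ∈ Finset.range n, y k ≤ c * (a ^ (v / (u + v)) * b ^ (u / (u + v))) := by
  have huv : 0 < u + v := by positivity
  set U : ℝ := 2 ^ u with hU
  set V : ℝ := 2 ^ (-v) with hV
  have hU1 : 1 < U := Real.one_lt_rpow (by norm_num) hu
  have hV0 : 0 < V := by positivity
  have hV1 : V < 1 := Real.rpow_lt_one_of_one_lt_of_neg (by norm_num) (by linarith)
  have hpu : ∀ k : ℕ, ((2 : ℝ) ^ k) ^ u = U ^ k := fun k => by
    rw [hU, ← Real.rpow_natCast, ← Real.rpow_natCast, ← Real.rpow_mul (by norm_num),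
      ← Real.rpow_mul (by norm_num), mul_comm]
  have hpv : ∀ k : ℕ, ((2 : ℝ) ^ k) ^ (-v) = V ^ k := fun k => by
    rw [hV, ← Real.rpow_natCast, ← Real.rpow_natCast, ← Real.rpow_mul (by norm_num),
      ← Real.rpow_mul (by norm_num), mul_comm]
  set c := U / (U - 1) + 1 / (1 - V) with hc
  have hc1 : 0 < U / (U - 1) := div_pos (by linarith) (by linarith)
  have hc2 : 0 < 1 / (1 - V) := div_pos one_pos (by linarith)
  have hc0 : 0 < c := by positivity
  refine ⟨2 * c, by positivity, fun n y a b ha hb hy h1 h2 => ?_⟩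
  have htail : ∀ K : ℕ, ∑ j ∈ Finset.range n, y (K + j) ≤ c * (b * V ^ K) := by
    intro K
    calc ∑ j ∈ Finset.range n, y (K + j) ≤ ∑ j ∈ Finset.range n, b * V ^ K * V ^ j := by
          refine Finset.sum_le_sum fun j _ => (h2 _).trans (le_of_eq ?_)
          rw [hpv, pow_add]
          ring
      _ = b * V ^ K * ((1 - V ^ n) / (1 - V)) := by
          rw [← Finset.mul_sum, geom_sum_eq hV1.ne, ← neg_div_neg_eq]
          ring_nf
      _ ≤ b * V ^ K * (1 / (1 - V)) := by
          gcongr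
          have := pow_pos hV0 n
          linarith
      _ ≤ b * V ^ K * c := by
          gcongr
          linarith
      _ = _ := by ring
  have key : ∑ k ∈ Finset.range n, y k ≤
      2 * ((c * a) ^ (v / (u + v)) * (c * b) ^ (u / (u + v))) := by
    apply le_of_forall_le_rpow_add_rpow hu hv (by positivity) (by positivity)
    · simpa [mul_assoc] using htail 0
    · intro s hs
      -- The sum is cut at 2^K ≈ s: the increasing progression bounds the head and the decreasing
      -- one the tail. The best s is then supplied by `le_of_forall_le_rpow_add_rpow`.
      set K := ⌈Real.logb 2 s⌉₊ with hK
      have hs0 : 0 < s := by linarith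
      have hlog : 0 ≤ Real.logb 2 s := Real.logb_nonneg (by norm_num) hs
      have hK1 : s ≤ (2 : ℝ) ^ K := by
        rw [← Real.rpow_natCast, ← Real.logb_le_iff_le_rpow (by norm_num) hs0]
        exact Nat.le_ceil _
      have hK2 : (2 : ℝ) ^ K ≤ 2 * s := by
        have h3 : (K : ℝ) ≤ Real.logb 2 s + 1 := (Nat.ceil_lt_add_one hlog).le
        calc (2 : ℝ) ^ K = 2 ^ (K : ℝ) := (Real.rpow_natCast _ _).symm
          _ ≤ 2 ^ (Real.logb 2 s + 1) := Real.rpow_le_rpow_of_exponent_le (by norm_num) h3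
          _ = 2 * s := by
            rw [Real.rpow_add (by norm_num), Real.rpow_logb (by norm_num) (by norm_num) hs0,
              Real.rpow_one, mul_comm]
      have hhead : ∑ k ∈ Finset.range K, y k ≤ c * a * s ^ u := by
        calc ∑ k ∈ Finset.range K, y k ≤ ∑ k ∈ Finset.range K, a * U ^ k :=
              Finset.sum_le_sum fun k _ => (h1 k).trans (le_of_eq (by rw [hpu]))
          _ = a * ((U ^ K - 1) / (U - 1)) := by rw [← Finset.mul_sum, geom_sum_eq hU1.ne']
          _ ≤ a * ((U * s ^ u) / (U - 1)) := by
              gcongr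
              have : U ^ K ≤ U * s ^ u := by
                rw [← hpu, hU, ← Real.mul_rpow (by norm_num) hs0.le]
                exact Real.rpow_le_rpow (by positivity) hK2 hu.le
              linarith
          _ = (U / (U - 1)) * a * s ^ u := by ring
          _ ≤ c * a * s ^ u := by
              gcongr
              linarith
      have hVK : V ^ K ≤ s ^ (-v) := by
        rw [← hpv]
        exact Real.rpow_le_rpow_of_nonpos hs0 hK1 (by linarith)
      calc ∑ k ∈ Finset.range n, y k ≤ ∑ k ∈ Finset.range (K + n), y k :=
            Finset.sum_le_sum_of_subset_of_nonneg
              (Finset.range_subset_range.2 (Nat.le_add_left n K)) fun k _ _ => hy k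
        _ = ∑ k ∈ Finset.range K, y k + ∑ j ∈ Finset.range n, y (K + j) :=
            Finset.sum_range_add y K n
        _ ≤ c * a * s ^ u + c * (b * V ^ K) := add_le_add hhead (htail K)
        _ ≤ c * a * s ^ u + c * (b * s ^ (-v)) := by gcongr
        _ = _ := by ring
  refine key.trans (le_of_eq ?_)
  have hsum : v / (u + v) + u / (u + v) = 1 := by field_simp; ring
  rw [Real.mul_rpow hc0.le ha.le, Real.mul_rpow hc0.le hb,
    show ∀ x y z w : ℝ, 2 * (x * y * (z * w)) = 2 * (x * z) * (y * w) by intros; ring,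
    ← Real.rpow_add hc0, hsum, Real.rpow_one]

lemma mul_rpow_mul_rpow_rpow {c N Y p q A B : ℝ} (hc : 0 ≤ c) (hN : 0 ≤ N) (hY : 0 ≤ Y)
    (hA : A * q = q - p) (hB : 1 / p * B * q = 1) :
    (c * (N ^ A * (Y ^ (1 / p)) ^ B)) ^ q = c ^ q * N ^ (q - p) * Y := by
  rw [Real.mul_rpow hc (by positivity), Real.mul_rpow (by positivity) (by positivity),
    ← Real.rpow_mul hN, ← Real.rpow_mul hY, ← Real.rpow_mul hY, hA, hB, Real.rpow_one, mul_assoc]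

/-- Pointwise Hedberg-type inequality, power weights. -/
lemma exists_sum_rpow_le_of_le_rpow {p q η : ℝ} (hp : 0 < p) (hpq : p < q) (hη : 0 < η) :
    ∃ c : ℝ, 0 < c ∧ ∀ (n : ℕ) (y : ℕ → ℝ) (N : ℝ), 0 < N → (∀ k, 0 ≤ y k) →
      (∀ k, n ≤ k → y k = 0) → (∀ k, y k ≤ N * ((2 : ℝ) ^ k) ^ η) →
      (∑ k ∈ Finset.range n, y k) ^ q ≤
        c * N ^ (q - p) * ∑ k ∈ Finset.range n, ((2 : ℝ) ^ k) ^ (η * (q - p)) * y k ^ p := by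
  have hq : 0 < q := hp.trans hpq
  have hv : 0 < η * (q - p) / p := div_pos (mul_pos hη (by linarith)) hp
  obtain ⟨c, hc, H⟩ := exists_sum_le_of_geometric_bounds hη hv
  refine ⟨c ^ q, by positivity, fun n y N hN hy hy0 h1 => ?_⟩
  set Y := ∑ k ∈ Finset.range n, ((2 : ℝ) ^ k) ^ (η * (q - p)) * y k ^ p with hY
  have hY0 : 0 ≤ Y := Finset.sum_nonneg fun k _ => by have := hy k; positivity
  -- A single term of the sum Y already forces geometric decay of y_k at rate η(q-p)/p, against the
  -- growth rate η. These two rates produce the exponents (q-p)/q on N and p/q on Y^(1/p) · Y^0 up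
  -- to the final power q, that is, N^(q-p) Y.
  have h2 : ∀ k, y k ≤ Y ^ (1 / p) * ((2 : ℝ) ^ k) ^ (-(η * (q - p) / p)) := by
    intro k
    by_cases hk : k < n
    · have h3 : ((2 : ℝ) ^ k) ^ (η * (q - p)) * y k ^ p ≤ Y :=
        Finset.single_le_sum (f := fun k => ((2 : ℝ) ^ k) ^ (η * (q - p)) * y k ^ p)
          (fun k _ => by have := hy k; positivity) (Finset.mem_range.2 hk)
      have h4 : ((2 : ℝ) ^ k) ^ (η * (q - p) / p) * y k ≤ Y ^ (1 / p) := by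
        rw [one_div, Real.le_rpow_inv_iff_of_pos (by have := hy k; positivity) hY0 hp,
          Real.mul_rpow (by positivity) (hy k), ← Real.rpow_mul (by positivity),
          div_mul_cancel₀ _ hp.ne']
        exact h3
      rw [Real.rpow_neg (by positivity), ← div_eq_mul_inv, le_div_iff₀ (by positivity)]
      linarith
    · rw [hy0 k (not_lt.1 hk)]
      positivity
  have h3 := H n y N (Y ^ (1 / p)) hN (by positivity) hy h1 h2
  calc (∑ k ∈ Finset.range n, y k) ^ q ≤ (c * (N ^ (η * (q - p) / p / (η + η * (q - p) / p)) *
        (Y ^ (1 / p)) ^ (η / (η + η * (q - p) / p)))) ^ q :=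
        Real.rpow_le_rpow (Finset.sum_nonneg fun k _ => hy k) h3 hq.le
    _ = c ^ q * N ^ (q - p) * Y := by
        have hs : η + η * (q - p) / p = η * q / p := by field_simp; ring
        rw [hs]
        exact mul_rpow_mul_rpow_rpow hc.le hN.le hY0 (by field_simp) (by field_simp)

lemma sum_rpow_neg_le {σ : ℝ} (hσ : 1 < σ) (K n : ℕ) :
    ∑ j ∈ Finset.range n, ((K : ℝ) + j + 2) ^ (-σ) ≤ 1 / (σ - 1) * ((K : ℝ) + 1) ^ (1 - σ) := by
  have hanti : AntitoneOn (fun x : ℝ => x ^ (-σ)) (Set.Icc ((K : ℝ) + 1) ((K : ℝ) + 1 + n)) := by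
    intro x hx y _ hxy
    have : (0 : ℝ) ≤ K := Nat.cast_nonneg K
    exact Real.rpow_le_rpow_of_nonpos (by linarith [hx.1]) hxy (by linarith)
  have h := hanti.sum_le_integral
  have hK : (0 : ℝ) ≤ K := Nat.cast_nonneg K
  have hn : (0 : ℝ) ≤ n := Nat.cast_nonneg n
  rw [integral_rpow] at h
  · calc ∑ j ∈ Finset.range n, ((K : ℝ) + j + 2) ^ (-σ)
        = ∑ j ∈ Finset.range n, ((K : ℝ) + 1 + ((j + 1 : ℕ) : ℝ)) ^ (-σ) := by
          refine Finset.sum_congr rfl fun j _ => ?_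
          push_cast
          ring_nf
      _ ≤ _ := h
      _ = 1 / (σ - 1) * (((K : ℝ) + 1) ^ (1 - σ) - ((K : ℝ) + 1 + n) ^ (1 - σ)) := by
          rw [show -σ + 1 = 1 - σ by ring, ← neg_sub σ 1, div_neg, ← neg_div, neg_sub, div_eq_inv_mul,
            one_div]
      _ ≤ _ := by
          have h1 : 0 ≤ 1 / (σ - 1) := by
            apply div_nonneg <;> linarith
          apply mul_le_mul_of_nonneg_left _ h1
          have : 0 ≤ ((K : ℝ) + 1 + n) ^ (1 - σ) := by positivity
          linarith
  · right
    refine ⟨by linarith, ?_⟩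
    rw [Set.uIcc_of_le (by linarith)]
    intro h
    linarith [h.1]

/-- Pointwise Hedberg-type inequality, logarithmic weights. -/
lemma exists_sum_rpow_le_of_sum_rpow_le {p q : ℝ} (hp : 1 < p) (hpq : p < q) :
    ∃ c : ℝ, 0 < c ∧ ∀ (n : ℕ) (y : ℕ → ℝ) (N : ℝ), 0 < N → (∀ k, 0 ≤ y k) →
      (∀ k, n ≤ k → y k = 0) → (∑ k ∈ Finset.range n, y k ^ p ≤ N ^ p) →
      (∑ k ∈ Finset.range n, y k) ^ q ≤
        c * N ^ (q - p) * ∑ k ∈ Finset.range n, ((k : ℝ) + 2) ^ (q * (1 - 1 / p)) * y k ^ p := by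
  have hp0 : 0 < p := by linarith
  have hq : 0 < q := hp0.trans hpq
  set σ := q / p with hσ
  have hσ1 : 1 < σ := by rwa [hσ, one_lt_div hp0]
  set u := 1 - 1 / p with hu
  have hu0 : 0 < u := by
    rw [hu, sub_pos, div_lt_one hp0]
    exact hp
  -- With weight exponent zero in the hypothesis, the geometric rates become power rates in the cut
  -- index K: the head is at most K^u N and the tail at most a multiple of K^(-v) Y^(1/p), both by
  -- Hölder.
  set v := (σ - 1) * u with hv
  have hv0 : 0 < v := mul_pos (by linarith) hu0
  set c := 2 ^ u + (1 / (σ - 1)) ^ u with hc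
  have hc1 : (0 : ℝ) < 2 ^ u := by positivity
  have hc2 : (0 : ℝ) < (1 / (σ - 1)) ^ u := Real.rpow_pos_of_pos (div_pos one_pos (by linarith)) _
  have hc0 : 0 < c := by positivity
  have hconj : p.HolderConjugate (1 / u) := by
    rw [Real.holderConjugate_iff]
    refine ⟨hp, ?_⟩
    rw [hu]
    simp
  refine ⟨(2 * c) ^ q, by positivity, fun n y N hN hy hy0 h1 => ?_⟩
  set Y := ∑ k ∈ Finset.range n, ((k : ℝ) + 2) ^ (q * u) * y k ^ p with hY
  have hY0 : 0 ≤ Y := Finset.sum_nonneg fun k _ => by have := hy k; positivity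
  have hsub : ∀ (g : ℕ → ℝ) (m : ℕ), (∀ k, 0 ≤ g k) → (∀ k, n ≤ k → g k = 0) →
      ∑ k ∈ Finset.range m, g k ≤ ∑ k ∈ Finset.range n, g k := by
    intro g m hg hg0
    calc ∑ k ∈ Finset.range m, g k ≤ ∑ k ∈ Finset.range (n + m), g k :=
          Finset.sum_le_sum_of_subset_of_nonneg
            (Finset.range_subset_range.2 (Nat.le_add_left m n)) fun k _ _ => hg k
      _ = _ := by
        rw [Finset.sum_range_add, Finset.sum_eq_zero (s := Finset.range m)
          (fun j _ => hg0 _ (Nat.le_add_right n j)), add_zero]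
  have htail : ∀ K : ℕ, ∑ j ∈ Finset.range n, y (K + j) ≤
      c * (Y ^ (1 / p) * ((K : ℝ) + 1) ^ (-v)) := by
    intro K
    -- Hölder with the weight (K+j+2)^(σu): its p-th power is the weight in Y, and its dual sum is ∑
    -- (K+j+2)^(-σ), which converges because σ = q/p > 1.
    have hH := Real.inner_le_Lp_mul_Lq_of_nonneg (Finset.range n) hconj
      (f := fun j => y (K + j) * ((K : ℝ) + j + 2) ^ (σ * u))
      (g := fun j => ((K : ℝ) + j + 2) ^ (-(σ * u)))
      (fun j _ => by have := hy (K + j); positivity) (fun j _ => by positivity)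
    have e1 : ∀ j : ℕ, y (K + j) * ((K : ℝ) + j + 2) ^ (σ * u) * ((K : ℝ) + j + 2) ^ (-(σ * u)) =
        y (K + j) := by
      intro j
      rw [mul_assoc, ← Real.rpow_add (by positivity)]
      simp
    simp only [e1] at hH
    refine hH.trans ?_
    have e2 : ∑ j ∈ Finset.range n, (y (K + j) * ((K : ℝ) + j + 2) ^ (σ * u)) ^ p ≤ Y := by
      refine le_trans (le_of_eq ?_) ((Finset.sum_le_sum_of_subset_of_nonneg
        (s := Finset.Ico K (K + n)) (t := Finset.range (K + n)) (by
          intro x hx; simp at hx ⊢; exact hx.2)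
        (f := fun k : ℕ => ((k : ℝ) + 2) ^ (q * u) * y k ^ p)
        (fun k _ _ => by have := hy k; positivity)).trans
        (hsub _ _ (fun k => by have := hy k; positivity) fun k hk => by
          rw [hy0 k hk, Real.zero_rpow hp0.ne', mul_zero]))
      rw [Finset.sum_Ico_eq_sum_range]
      simp only [Nat.add_sub_cancel_left]
      refine Finset.sum_congr rfl fun j _ => ?_
      rw [Real.mul_rpow (hy _) (by positivity), ← Real.rpow_mul (by positivity), mul_comm]
      congr 2
      · push_cast; ring
      · rw [hσ]; field_simp
    have e3 : ∑ j ∈ Finset.range n, (((K : ℝ) + j + 2) ^ (-(σ * u))) ^ (1 / u) ≤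
        1 / (σ - 1) * ((K : ℝ) + 1) ^ (1 - σ) := by
      refine le_trans (le_of_eq ?_) (sum_rpow_neg_le hσ1 K n)
      refine Finset.sum_congr rfl fun j _ => ?_
      rw [← Real.rpow_mul (by positivity)]
      congr 1
      field_simp
    rw [one_div_one_div]
    calc _ ≤ Y ^ (1 / p) * (1 / (σ - 1) * ((K : ℝ) + 1) ^ (1 - σ)) ^ u := by
          gcongr
          exact Finset.sum_nonneg fun j _ => by have := hy (K + j); positivity
      _ = (1 / (σ - 1)) ^ u * (Y ^ (1 / p) * ((K : ℝ) + 1) ^ (-v)) := by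
          rw [Real.mul_rpow (div_nonneg one_pos.le (by linarith)) (by positivity),
            ← Real.rpow_mul (by positivity), show (1 - σ) * u = -v by rw [hv]; ring]
          ring
      _ ≤ _ := by
          gcongr
          linarith
  have key : ∑ k ∈ Finset.range n, y k ≤
      2 * ((c * N) ^ (v / (u + v)) * (c * Y ^ (1 / p)) ^ (u / (u + v))) := by
    apply le_of_forall_le_rpow_add_rpow hu0 hv0 (by positivity) (by positivity)
    · have := htail 0
      simpa using this
    · intro s hs
      have hs0 : 0 < s := by linarith
      -- The cut is now at index s itself instead of log₂ s.
      set K := ⌈s⌉₊ with hK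
      have hK1 : s ≤ K := Nat.le_ceil s
      have hK2 : (K : ℝ) ≤ 2 * s := by
        have := Nat.ceil_lt_add_one hs0.le
        linarith
      have hhead : ∑ k ∈ Finset.range K, y k ≤ c * N * s ^ u := by
        have h2 := Real.rpow_sum_le_const_mul_sum_rpow (Finset.range K) y hp.le
        have h3 : ∑ k ∈ Finset.range K, |y k| ^ p ≤ N ^ p := by
          simp only [abs_of_nonneg (hy _)]
          exact (hsub _ K (fun k => Real.rpow_nonneg (hy k) _)
            fun k hk => by rw [hy0 k hk, Real.zero_rpow hp0.ne']).trans h1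
        simp only [abs_of_nonneg (hy _), Finset.card_range] at h2 h3
        have h4 : (∑ k ∈ Finset.range K, y k) ^ p ≤ ((K : ℝ) ^ u * N) ^ p := by
          rw [Real.mul_rpow (by positivity) hN.le, ← Real.rpow_mul (by positivity),
            show u * p = p - 1 by rw [hu]; field_simp]
          exact h2.trans (by gcongr)
        have h5 := (Real.rpow_le_rpow_iff (Finset.sum_nonneg fun k _ => hy k) (by positivity)
          hp0).1 h4
        calc _ ≤ (K : ℝ) ^ u * N := h5
          _ ≤ (2 * s) ^ u * N := by gcongr
          _ = 2 ^ u * N * s ^ u := by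
            rw [Real.mul_rpow (by norm_num) hs0.le]
            ring
          _ ≤ _ := by
            gcongr
            linarith
      calc ∑ k ∈ Finset.range n, y k ≤ ∑ k ∈ Finset.range (K + n), y k :=
            Finset.sum_le_sum_of_subset_of_nonneg
              (Finset.range_subset_range.2 (Nat.le_add_left n K)) fun k _ _ => hy k
        _ = ∑ k ∈ Finset.range K, y k + ∑ j ∈ Finset.range n, y (K + j) :=
            Finset.sum_range_add y K n
        _ ≤ c * N * s ^ u + c * (Y ^ (1 / p) * ((K : ℝ) + 1) ^ (-v)) := add_le_add hhead (htail K)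
        _ ≤ c * N * s ^ u + c * (Y ^ (1 / p) * s ^ (-v)) := by
            gcongr 2
            gcongr 1
            exact Real.rpow_le_rpow_of_nonpos hs0 (by linarith) (by linarith)
        _ = _ := by ring
  have hsum : v / (u + v) + u / (u + v) = 1 := by field_simp; ring
  have huv : u + v = σ * u := by rw [hv]; ring
  calc (∑ k ∈ Finset.range n, y k) ^ q
      ≤ (2 * ((c * N) ^ (v / (u + v)) * (c * Y ^ (1 / p)) ^ (u / (u + v)))) ^ q :=
        Real.rpow_le_rpow (Finset.sum_nonneg fun k _ => hy k) key hq.le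
    _ = (2 * c * (N ^ (v / (u + v)) * (Y ^ (1 / p)) ^ (u / (u + v)))) ^ q := by
        rw [Real.mul_rpow hc0.le hN.le, Real.mul_rpow hc0.le (by positivity),
          show ∀ x y z w : ℝ, 2 * (x * y * (z * w)) = 2 * (x * z) * (y * w) by intros; ring,
          ← Real.rpow_add hc0, hsum, Real.rpow_one]
    _ = (2 * c) ^ q * N ^ (q - p) * Y := by
        rw [huv]
        exact mul_rpow_mul_rpow_rpow (by positivity) hN.le hY0 (by rw [hv, hσ]; field_simp)
          (by rw [hσ]; field_simp)


/-! ### Pointwise bounds and embeddings for Dirichlet functions -/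

lemma dirichletNorm_eq (p α : ℝ) (f : ℂ → ℂ) :
    dirichletNorm p α f = (‖f 0‖ₑ ^ p + dirichletEnergy p α f) ^ (1 / p) := rfl

lemma dirichletNorm_lt_top_iff {p : ℝ} (hp : 0 < p) (α : ℝ) (f : ℂ → ℂ) :
    dirichletNorm p α f < ∞ ↔ dirichletEnergy p α f < ∞ := by
  rw [dirichletNorm_eq, ENNReal.rpow_lt_top_iff_of_pos (by positivity), ENNReal.add_lt_top,
    and_iff_right (ENNReal.rpow_lt_top_of_nonneg hp.le enorm_ne_top)]

lemma enorm_zero_le_dirichletNorm {p : ℝ} (hp : 0 < p) (α : ℝ) (f : ℂ → ℂ) :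
    ‖f 0‖ₑ ≤ dirichletNorm p α f := by
  rw [dirichletNorm_eq, one_div, ENNReal.le_rpow_inv_iff hp]
  exact le_self_add

lemma dirichletEnergy_le_dirichletNorm_rpow {p : ℝ} (hp : 0 < p) (α : ℝ) (f : ℂ → ℂ) :
    dirichletEnergy p α f ≤ dirichletNorm p α f ^ p := by
  rw [dirichletNorm_eq, ← ENNReal.rpow_mul, one_div_mul_cancel hp.ne', ENNReal.rpow_one]
  exact le_add_self

lemma ennreal_add_rpow_le (a b : ℝ≥0∞) {q : ℝ} (hq : 0 < q) :
    (a + b) ^ q ≤ 2 ^ q * (a ^ q + b ^ q) := by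
  wlog hab : a ≤ b generalizing a b
  · rw [add_comm a, add_comm (a ^ q)]
    exact this b a (le_of_not_ge hab)
  calc (a + b) ^ q ≤ (2 * b) ^ q := by
        apply ENNReal.rpow_le_rpow _ hq.le
        rw [two_mul]
        gcongr
    _ = 2 ^ q * b ^ q := ENNReal.mul_rpow_of_nonneg _ _ hq.le
    _ ≤ _ := by
        gcongr
        exact le_add_self

/-- The increments along radii are controlled by a summable sequence. -/
lemma exists_radialIncrement_rpow_le_real {p : ℝ} (hp : 0 < p) (α : ℝ) :
    ∃ C : ℝ, 0 < C ∧ ∀ f, AnalyticOnDisk f → dirichletEnergy p α f ≠ ∞ → ∃ d : ℕ → ℝ,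
      (∀ k, 0 ≤ d k) ∧ (∀ n, ∑ k ∈ Finset.range n, d k ≤ C * (dirichletEnergy p α f).toReal) ∧
      ∀ z ∈ unitDisk, ∀ k, radialIncrement f k z ^ p ≤ ((2 : ℝ) ^ k) ^ (α + 2 - p) * d k := by
  obtain ⟨C₀, h₀⟩ := exists_radialIncrement_rpow_le_annulusEnergy hp α
  obtain ⟨C₁, h₁⟩ := exists_tsum_annulusEnergy_le p α
  refine ⟨C₀ * C₁ + 1, by positivity, fun f hf hE => ?_⟩
  have hsum := h₁ f
  have htop : C₁ * dirichletEnergy p α f ≠ ∞ := ENNReal.mul_ne_top ENNReal.coe_ne_top hE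
  have hk : ∀ k, annulusEnergy p α f k ≠ ∞ := fun k =>
    ne_top_of_le_ne_top htop ((ENNReal.le_tsum k).trans hsum)
  refine ⟨fun k => C₀ * (annulusEnergy p α f k).toReal, fun k => by positivity, fun n => ?_,
    fun z hz k => ?_⟩
  · rw [← Finset.mul_sum, ← ENNReal.toReal_sum fun k _ => hk k]
    have h2 := ENNReal.toReal_mono htop ((ENNReal.sum_le_tsum (Finset.range n)).trans hsum)
    rw [ENNReal.toReal_mul, ENNReal.coe_toReal] at h2
    have h3 : 0 ≤ (dirichletEnergy p α f).toReal := ENNReal.toReal_nonneg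
    have h4 := mul_le_mul_of_nonneg_left h2 C₀.2
    simp only [NNReal.val_eq_coe] at h4
    linarith
  · have h2 := h₀ f hf k z hz
    rw [← ENNReal.ofReal_toReal (hk k), ENNReal.ofReal_rpow_of_nonneg
      (radialIncrement_nonneg f k z) hp.le, ← ENNReal.ofReal_coe_nnreal,
      ← ENNReal.ofReal_mul (by positivity), ← ENNReal.ofReal_mul (by positivity),
      ENNReal.ofReal_le_ofReal_iff (by positivity)] at h2
    refine h2.trans (le_of_eq ?_)
    have : ((1 / 2 : ℝ) ^ k) ^ (-(α + 2 - p)) = ((2 : ℝ) ^ k) ^ (α + 2 - p) := by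
      rw [Real.rpow_neg (by positivity), ← Real.inv_rpow (by positivity), one_div, inv_pow, inv_inv]
    rw [this]
    ring

/-- Control of `f` by a weighted sum of its increments along radii. -/
def RadialControl (p α q : ℝ) (W : ℕ → ℝ) : Prop :=
  ∃ c : ℝ≥0, ∀ f, AnalyticOnDisk f → dirichletEnergy p α f ≠ ∞ → ∀ z ∈ unitDisk,
    ‖f z - f 0‖ₑ ^ q ≤ c * dirichletEnergy p α f ^ ((q - p) / p) *
      ∑' k, ENNReal.ofReal (W k) * ENNReal.ofReal (radialIncrement f k z) ^ p

/-- Along a single radius only the increments y_k and the annulus energies d_k matter, so control of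
f becomes an inequality between sequences with N^p a multiple of the Dirichlet integral. -/
lemma radialControl_of_sequence_bound {p α q : ℝ} (hp : 0 < p) (hpq : p < q) {W : ℕ → ℝ}
    (hW : ∀ k, 0 ≤ W k)
    (H : ∃ c : ℝ, 0 < c ∧ ∀ (n : ℕ) (y d : ℕ → ℝ) (N : ℝ), 0 < N → (∀ k, 0 ≤ y k) →
      (∀ k, n ≤ k → y k = 0) → (∀ k, 0 ≤ d k) → (∀ n, ∑ k ∈ Finset.range n, d k ≤ N ^ p) →
      (∀ k, y k ^ p ≤ ((2 : ℝ) ^ k) ^ (α + 2 - p) * d k) →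
      (∑ k ∈ Finset.range n, y k) ^ q ≤
        c * N ^ (q - p) * ∑ k ∈ Finset.range n, W k * y k ^ p) :
    RadialControl p α q W := by
  obtain ⟨c, hc, H⟩ := H
  obtain ⟨C, hC, hd⟩ := exists_radialIncrement_rpow_le_real hp α
  have hq : 0 < q := hp.trans hpq
  refine ⟨Real.toNNReal (c * C ^ ((q - p) / p)), fun f hf hE z hz => ?_⟩
  have hz' : ‖z‖ < 1 := by simpa [unitDisk] using hz
  obtain ⟨n, hn⟩ := exists_le_one_sub_half_pow hz'
  obtain ⟨d, hd0, hdsum, hdinc⟩ := hd f hf hE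
  set E := (dirichletEnergy p α f).toReal with hEdef
  have hE0 : 0 ≤ E := ENNReal.toReal_nonneg
  have hinc := norm_sub_le_sum_radialIncrement f hn
  have hinc0 : ∀ k, n ≤ k → radialIncrement f k z = 0 := fun k hk => by
    apply radialIncrement_of_le
    have : (1 / 2 : ℝ) ^ k ≤ (1 / 2) ^ n := pow_le_pow_of_le_one (by norm_num) (by norm_num) hk
    linarith
  have hqp : 0 < (q - p) / p := div_pos (by linarith) hp
  -- The sequence inequality needs N > 0. Zero energy is treated apart: all increments vanish and
  -- f(z) = f(0).
  rcases hE0.eq_or_lt with h0 | hpos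
  · have hzero : ∀ k, radialIncrement f k z = 0 := by
      intro k
      have h1 := hdsum (k + 1)
      rw [← h0, mul_zero] at h1
      have h2 := Finset.single_le_sum (f := d) (fun i _ => hd0 i)
        (Finset.mem_range.2 (Nat.lt_succ_self k))
      have h3 : d k = 0 := le_antisymm (h2.trans h1) (hd0 k)
      have h4 := hdinc z hz k
      rw [h3, mul_zero] at h4
      have h5 := radialIncrement_nonneg f k z
      by_contra h6
      have : 0 < radialIncrement f k z ^ p := Real.rpow_pos_of_pos (lt_of_le_of_ne h5 (Ne.symm h6)) _
      linarith
    simp only [hzero, Finset.sum_const_zero] at hinc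
    have h7 : f z - f 0 = 0 := norm_le_zero_iff.1 hinc
    rw [h7]
    simp [hq]
  · have hN : 0 < (C * E) ^ (1 / p) := by positivity
    have hNp : ((C * E) ^ (1 / p)) ^ p = C * E := by
      rw [← Real.rpow_mul (by positivity), one_div_mul_cancel hp.ne', Real.rpow_one]
    have key := H n (fun k => radialIncrement f k z) d _ hN (fun k => radialIncrement_nonneg f k z)
      hinc0 hd0 (by rw [hNp]; exact hdsum) (hdinc z hz)
    have key2 : ‖f z - f 0‖ ^ q ≤ c * C ^ ((q - p) / p) * E ^ ((q - p) / p) *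
        ∑ k ∈ Finset.range n, W k * radialIncrement f k z ^ p := by
      refine (Real.rpow_le_rpow (norm_nonneg _) hinc hq.le).trans (key.trans (le_of_eq ?_))
      rw [← Real.rpow_mul (by positivity), one_div_mul_eq_div, Real.mul_rpow hC.le hE0]
      ring
    have hsum : ∑' k, ENNReal.ofReal (W k) * ENNReal.ofReal (radialIncrement f k z) ^ p =
        ENNReal.ofReal (∑ k ∈ Finset.range n, W k * radialIncrement f k z ^ p) := by
      rw [tsum_eq_sum (s := Finset.range n), ENNReal.ofReal_sum_of_nonneg]
      · refine Finset.sum_congr rfl fun k _ => ?_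
        rw [ENNReal.ofReal_mul (hW k), ENNReal.ofReal_rpow_of_nonneg
          (radialIncrement_nonneg f k z) hp.le]
      · intro k _
        exact mul_nonneg (hW k) (Real.rpow_nonneg (radialIncrement_nonneg f k z) _)
      · intro k hk
        rw [hinc0 k (by simpa using hk)]
        simp [hp]
    rw [hsum, ← ENNReal.ofReal_toReal hE, ← hEdef, ENNReal.ofReal_rpow_of_nonneg hE0 hqp.le,
      ← ENNReal.ofReal, ← ENNReal.ofReal_mul (by positivity), ← ENNReal.ofReal_mul (by positivity),
      ← ofReal_norm, ENNReal.ofReal_rpow_of_nonneg (norm_nonneg _) hq.le]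
    exact ENNReal.ofReal_le_ofReal key2

/-- Bounding each d_k by the whole sum gives y_k ≤ N 2^(kη), the growth that the power-weight
inequality requires. -/
lemma radialControl_of_lt {p α q : ℝ} (hp : 0 < p) (hpq : p < q) (h : p < α + 2) :
    RadialControl p α q fun k => ((2 : ℝ) ^ k) ^ ((α + 2 - p) / p * (q - p)) := by
  have hη : 0 < (α + 2 - p) / p := div_pos (by linarith) hp
  obtain ⟨c, hc, H⟩ := exists_sum_rpow_le_of_le_rpow hp hpq hη
  refine radialControl_of_sequence_bound hp hpq (fun k => by positivity)
    ⟨c, hc, fun n y d N hN hy hy0 hd hdN hyd => H n y N hN hy hy0 fun k => ?_⟩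
  have h1 : d k ≤ N ^ p := (Finset.single_le_sum (f := d) (fun i _ => hd i)
    (Finset.mem_range.2 (Nat.lt_succ_self k))).trans (hdN (k + 1))
  rw [← Real.rpow_le_rpow_iff (hy k) (by positivity) hp, Real.mul_rpow hN.le (by positivity),
    ← Real.rpow_mul (by positivity), div_mul_cancel₀ _ hp.ne', mul_comm]
  exact (hyd k).trans (by gcongr)

/-- At the critical exponent the factor 2^(k(α+2-p)) is 1, so the y_k^p themselves are summable and
the logarithmic version applies. -/
lemma radialControl_of_eq {p α q : ℝ} (hp : 1 < p) (hpq : p < q) (h : p = α + 2) :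
    RadialControl p α q fun k => ((k : ℝ) + 2) ^ (q * (1 - 1 / p)) := by
  obtain ⟨c, hc, H⟩ := exists_sum_rpow_le_of_sum_rpow_le hp hpq
  refine radialControl_of_sequence_bound (by linarith) hpq (fun k => by positivity)
    ⟨c, hc, fun n y d N hN hy hy0 hd hdN hyd => H n y N hN hy hy0 ?_⟩
  refine (Finset.sum_le_sum fun k _ => ?_).trans (hdN n)
  have := hyd k
  rwa [show α + 2 - p = 0 by linarith, Real.rpow_zero, one_mul] at this

/-- The k-th increment is at most a multiple of the norm times 2^(k(α+2-p)/p), so a bound for the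
sum of these rates is a bound for f. It serves both compact subdisks, where finitely many levels
occur, and the supercritical case, where the geometric series converges. -/
lemma exists_enorm_le_of_sum_bound {p α : ℝ} (hp : 0 < p) {s : Set ℂ} (hs : s ⊆ unitDisk) {M : ℝ}
    (hM : 0 ≤ M) (H : ∀ z ∈ s, ∃ n : ℕ, ‖z‖ ≤ 1 - (1 / 2 : ℝ) ^ n ∧
      ∑ k ∈ Finset.range n, ((2 : ℝ) ^ k) ^ ((α + 2 - p) / p) ≤ M) :
    ∃ C : ℝ≥0, ∀ f, MemDirichlet p α f → ∀ z ∈ s, ‖f z‖ₑ ≤ C * dirichletNorm p α f := by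
  obtain ⟨C, hC, hd⟩ := exists_radialIncrement_rpow_le_real hp α
  refine ⟨Real.toNNReal (C ^ (1 / p) * M) + 1, fun f hf z hz => ?_⟩
  have hE : dirichletEnergy p α f ≠ ∞ := ((dirichletNorm_lt_top_iff hp α f).1 hf.2).ne
  obtain ⟨n, hn, hsum⟩ := H z hz
  obtain ⟨d, hd0, hdsum, hdinc⟩ := hd f hf.1 hE
  set E := (dirichletEnergy p α f).toReal with hEdef
  have hE0 : 0 ≤ E := ENNReal.toReal_nonneg
  have h1 : ∀ k, radialIncrement f k z ≤ (C * E) ^ (1 / p) * ((2 : ℝ) ^ k) ^ ((α + 2 - p) / p) := by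
    intro k
    have h1 : d k ≤ C * E := (Finset.single_le_sum (f := d) (fun i _ => hd0 i)
      (Finset.mem_range.2 (Nat.lt_succ_self k))).trans (hdsum (k + 1))
    rw [← Real.rpow_le_rpow_iff (radialIncrement_nonneg f k z) (by positivity) hp,
      Real.mul_rpow (by positivity) (by positivity), ← Real.rpow_mul (by positivity),
      ← Real.rpow_mul (by positivity), one_div_mul_cancel hp.ne', div_mul_cancel₀ _ hp.ne',
      Real.rpow_one, mul_comm]
    exact (hdinc z (hs hz) k).trans (by gcongr)
  have h2 : ‖f z - f 0‖ ≤ C ^ (1 / p) * M * E ^ (1 / p) := by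
    refine (norm_sub_le_sum_radialIncrement f hn).trans
      ((Finset.sum_le_sum fun k _ => h1 k).trans ?_)
    rw [← Finset.mul_sum, Real.mul_rpow hC.le hE0]
    calc _ ≤ C ^ (1 / p) * E ^ (1 / p) * M := by gcongr
      _ = _ := by ring
  have h3 : ‖f z - f 0‖ₑ ≤ Real.toNNReal (C ^ (1 / p) * M) * dirichletNorm p α f := by
    calc ‖f z - f 0‖ₑ ≤ ENNReal.ofReal (C ^ (1 / p) * M * E ^ (1 / p)) := by
          rw [← ofReal_norm]
          exact ENNReal.ofReal_le_ofReal h2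
      _ = ENNReal.ofReal (C ^ (1 / p) * M) * dirichletEnergy p α f ^ (1 / p) := by
          rw [ENNReal.ofReal_mul (by positivity), ← ENNReal.ofReal_rpow_of_nonneg hE0 (by positivity),
            hEdef, ENNReal.ofReal_toReal hE]
      _ ≤ _ := by
          rw [dirichletNorm_eq]
          refine mul_le_mul_right (ENNReal.rpow_le_rpow le_add_self (by positivity)) _
  calc ‖f z‖ₑ = ‖(f z - f 0) + f 0‖ₑ := by rw [sub_add_cancel]
    _ ≤ ‖f z - f 0‖ₑ + ‖f 0‖ₑ := enorm_add_le _ _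
    _ ≤ Real.toNNReal (C ^ (1 / p) * M) * dirichletNorm p α f + dirichletNorm p α f :=
        add_le_add h3 (enorm_zero_le_dirichletNorm hp α f)
    _ = _ := by
        push_cast
        ring

/-- Point evaluations are locally uniformly bounded. -/
lemma exists_enorm_le_on_closedBall {p : ℝ} (hp : 0 < p) (α : ℝ) {ρ : ℝ} (hρ : ρ < 1) :
    ∃ C : ℝ≥0, ∀ f, MemDirichlet p α f → ∀ z ∈ Metric.closedBall (0 : ℂ) ρ,
      ‖f z‖ₑ ≤ C * dirichletNorm p α f := by
  obtain ⟨n, hn⟩ := exists_le_one_sub_half_pow hρ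
  refine exists_enorm_le_of_sum_bound hp (Metric.closedBall_subset_ball hρ)
    (Finset.sum_nonneg fun k _ => by positivity) fun z hz => ⟨n, ?_, le_rfl⟩
  rw [mem_closedBall_zero_iff] at hz
  exact hz.trans hn

/-- Above the critical exponent the space consists of bounded functions. -/
lemma exists_enorm_le_of_gt {p α : ℝ} (hp : 0 < p) (h : α + 2 < p) :
    ∃ C : ℝ≥0, ∀ f, MemDirichlet p α f → ∀ z ∈ unitDisk, ‖f z‖ₑ ≤ C * dirichletNorm p α f := by
  set V : ℝ := 2 ^ ((α + 2 - p) / p) with hV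
  have hV0 : 0 < V := by positivity
  have hV1 : V < 1 := Real.rpow_lt_one_of_one_lt_of_neg (by norm_num)
    (div_neg_of_neg_of_pos (by linarith) hp)
  refine exists_enorm_le_of_sum_bound (M := 1 / (1 - V)) hp le_rfl
    (div_nonneg one_pos.le (by linarith)) fun z hz => ?_
  have hz' : ‖z‖ < 1 := by simpa [unitDisk] using hz
  obtain ⟨n, hn⟩ := exists_le_one_sub_half_pow hz'
  refine ⟨n, hn, ?_⟩
  have hpv : ∀ k : ℕ, ((2 : ℝ) ^ k) ^ ((α + 2 - p) / p) = V ^ k := fun k => by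
    rw [hV, ← Real.rpow_natCast, ← Real.rpow_natCast, ← Real.rpow_mul (by norm_num),
      ← Real.rpow_mul (by norm_num), mul_comm]
  simp only [hpv]
  rw [geom_sum_eq hV1.ne, ← neg_div_neg_eq, neg_sub, neg_sub]
  gcongr
  have := pow_pos hV0 n
  linarith

lemma unitDisk_subset_carlesonSquare : unitDisk ⊆ carlesonSquare (-Real.pi) 1 := by
  intro z hz
  have hz' : ‖z‖ < 1 := by simpa [unitDisk] using hz
  refine ⟨‖z‖, Complex.arg z, by simp, hz', (Complex.neg_pi_lt_arg z).le, ?_,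
    (Complex.norm_mul_exp_arg_mul_I z).symm⟩
  have := Complex.arg_le_pi z
  linarith

/-- The embedding theorem under a weighted one-box condition. -/
lemma RadialControl.exists_lintegral_le {p α q : ℝ} (hp : 0 < p) (hpq : p < q) {W : ℕ → ℝ}
    (hW : RadialControl p α q W) (hW0 : 1 ≤ W 0) :
    ∃ C : ℝ≥0, ∀ (μ : Measure ℂ) [SFinite μ] (B : ℝ≥0),
      (∀ k a, ENNReal.ofReal (W k) * μ (carlesonSquare a ((1 / 2) ^ (k - 1))) ≤
        B * ENNReal.ofReal (((1 / 2 : ℝ) ^ k) ^ (α + 2 - p))) →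
      ∀ f, MemDirichlet p α f →
        ∫⁻ z in unitDisk, ‖f z‖ₑ ^ q ∂μ ≤ C * B * dirichletNorm p α f ^ q := by
  obtain ⟨c, hc⟩ := hW
  obtain ⟨C, hC⟩ := exists_lintegral_tsum_radialIncrement_le hp α
  have hq : 0 < q := hp.trans hpq
  refine ⟨2 ^ q * (c * C + 1), fun μ _ B hB f hf => ?_⟩
  have hE : dirichletEnergy p α f ≠ ∞ := ((dirichletNorm_lt_top_iff hp α f).1 hf.2).ne
  have hqp : 0 < (q - p) / p := div_pos (by linarith) hp
  -- The box of level 0 is the whole disk. Together with W 0 ≥ 1 this controls the contribution of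
  -- the constant f(0).
  have hμ : μ unitDisk ≤ B := by
    have h1 := hB 0 (-Real.pi)
    simp only [pow_zero, Real.one_rpow, ENNReal.ofReal_one, mul_one] at h1
    calc μ unitDisk ≤ 1 * μ (carlesonSquare (-Real.pi) 1) := by
          rw [one_mul]
          exact measure_mono unitDisk_subset_carlesonSquare
      _ ≤ ENNReal.ofReal (W 0) * μ (carlesonSquare (-Real.pi) 1) := by
          gcongr
          simpa using hW0
      _ ≤ B := h1
  have h2 : ∫⁻ z in unitDisk, ‖f z - f 0‖ₑ ^ q ∂μ ≤ c * C * B * dirichletNorm p α f ^ q := by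
    calc ∫⁻ z in unitDisk, ‖f z - f 0‖ₑ ^ q ∂μ
        ≤ ∫⁻ z in unitDisk, c * dirichletEnergy p α f ^ ((q - p) / p) *
          ∑' k, ENNReal.ofReal (W k) * ENNReal.ofReal (radialIncrement f k z) ^ p ∂μ := by
          apply setLIntegral_mono' Metric.isOpen_ball.measurableSet
          intro z hz
          exact hc f hf.1 hE z hz
      _ = c * dirichletEnergy p α f ^ ((q - p) / p) * ∫⁻ z in unitDisk,
          ∑' k, ENNReal.ofReal (W k) * ENNReal.ofReal (radialIncrement f k z) ^ p ∂μ := by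
          rw [lintegral_const_mul']
          exact ENNReal.mul_ne_top ENNReal.coe_ne_top (ENNReal.rpow_ne_top_of_nonneg hqp.le hE)
      _ ≤ c * dirichletEnergy p α f ^ ((q - p) / p) * (C * B * dirichletEnergy p α f) := by
          gcongr
          exact hC μ (fun k => ENNReal.ofReal (W k)) B hB f hf.1
      _ = c * C * B * (dirichletEnergy p α f ^ ((q - p) / p) * dirichletEnergy p α f ^ (1 : ℝ)) := by
          rw [ENNReal.rpow_one]
          ring
      _ = c * C * B * dirichletEnergy p α f ^ (q / p) := by
          rw [← ENNReal.rpow_add_of_nonneg _ _ hqp.le zero_le_one]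
          congr 2
          field_simp
          ring
      _ ≤ c * C * B * (dirichletNorm p α f ^ p) ^ (q / p) := by
          gcongr
          exact dirichletEnergy_le_dirichletNorm_rpow hp α f
      _ = _ := by
          rw [← ENNReal.rpow_mul, mul_div_cancel₀ _ hp.ne']
  have h2q : ((2 ^ q : ℝ≥0) : ℝ≥0∞) = 2 ^ q := by
    rw [ENNReal.coe_rpow_of_nonneg _ hq.le]
    norm_num
  have h2t : (2 : ℝ≥0∞) ^ q ≠ ∞ := by
    rw [← h2q]
    exact ENNReal.coe_ne_top
  calc ∫⁻ z in unitDisk, ‖f z‖ₑ ^ q ∂μ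
      ≤ ∫⁻ z in unitDisk, 2 ^ q * (‖f z - f 0‖ₑ ^ q + ‖f 0‖ₑ ^ q) ∂μ := by
        refine lintegral_mono fun z => ?_
        refine le_trans ?_ (ennreal_add_rpow_le _ _ hq)
        apply ENNReal.rpow_le_rpow _ hq.le
        calc ‖f z‖ₑ = ‖(f z - f 0) + f 0‖ₑ := by rw [sub_add_cancel]
          _ ≤ _ := enorm_add_le _ _
    _ = 2 ^ q * (∫⁻ z in unitDisk, ‖f z - f 0‖ₑ ^ q ∂μ + ‖f 0‖ₑ ^ q * μ unitDisk) := by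
        rw [lintegral_const_mul' _ _ h2t, lintegral_add_right _ measurable_const, setLIntegral_const]
    _ ≤ 2 ^ q * (c * C * B * dirichletNorm p α f ^ q + dirichletNorm p α f ^ q * B) := by
        gcongr
        exact enorm_zero_le_dirichletNorm hp α f
    _ = _ := by
        push_cast
        rw [h2q]
        ring


/-! ### Smallness of the embedding near the circle -/

/-- The annulus `ρ < |z| < 1`. -/
def outerAnnulus (ρ : ℝ) : Set ℂ := {z | ρ < ‖z‖ ∧ ‖z‖ < 1}

lemma measurableSet_outerAnnulus (ρ : ℝ) : MeasurableSet (outerAnnulus ρ) :=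
  (measurableSet_lt measurable_const measurable_norm).inter
    (measurableSet_lt measurable_norm measurable_const)

lemma outerAnnulus_subset_unitDisk (ρ : ℝ) : outerAnnulus ρ ⊆ unitDisk := fun z hz => by
  simpa [unitDisk] using hz.2

/-- The embedding into `L^q(μ)` is small near the boundary. -/
def VanishingEmbedding (p α q : ℝ) (μ : Measure ℂ) : Prop :=
  ∀ ε : ℝ≥0, 0 < ε → ∃ ρ < 1, ∀ f, MemDirichlet p α f →
    ∫⁻ z in outerAnnulus ρ, ‖f z‖ₑ ^ q ∂μ ≤ ε * dirichletNorm p α f ^ q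

lemma tendsto_measure_outerAnnulus (μ : Measure ℂ) [IsFiniteMeasure μ] :
    Tendsto (fun n : ℕ => μ (outerAnnulus (1 - 1 / ((n : ℝ) + 1)))) atTop (𝓝 0) := by
  have hanti : Antitone fun n : ℕ => outerAnnulus (1 - 1 / ((n : ℝ) + 1)) := by
    intro m n hmn z hz
    refine ⟨lt_of_le_of_lt ?_ hz.1, hz.2⟩
    have : 1 / ((n : ℝ) + 1) ≤ 1 / ((m : ℝ) + 1) := Nat.one_div_le_one_div hmn
    linarith
  have h := tendsto_measure_iInter_atTop (μ := μ)
    (fun n : ℕ => (measurableSet_outerAnnulus (1 - 1 / ((n : ℝ) + 1))).nullMeasurableSet) hanti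
    ⟨0, measure_ne_top _ _⟩
  have hempty : ⋂ n : ℕ, outerAnnulus (1 - 1 / ((n : ℝ) + 1)) = ∅ := by
    rw [Set.eq_empty_iff_forall_notMem]
    intro z hz
    rw [Set.mem_iInter] at hz
    have h1 := (hz 0).2
    obtain ⟨n, hn⟩ := exists_nat_one_div_lt (sub_pos.2 h1)
    have := (hz n).1
    linarith
  rwa [hempty, measure_empty] at h

/-- The embedding theorem is applied to μ restricted to an outer annulus, with a small box constant
B. Boxes of high level are small by the little-o condition; the finitely many low levels are handled
by the total mass of the annulus, which tends to 0 as ρ → 1. -/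
lemma vanishingEmbedding_of_littleO {p α q : ℝ} (hp : 0 < p) (hpq : p < q) {W : ℕ → ℝ}
    (hW : RadialControl p α q W) (hW0 : 1 ≤ W 0) (hWpos : ∀ k, 0 ≤ W k) {ψ : ℝ → ℝ}
    {μ : Measure ℂ} [IsFiniteMeasure μ] (hμ : CarlesonLittleO μ ψ) {K₀ : ℕ} {c₀ : ℝ} (hc₀ : 0 ≤ c₀)
    (hψ : ∀ k, K₀ ≤ k → W k * ψ ((1 / 2) ^ (k - 1)) ≤ c₀ * ((1 / 2 : ℝ) ^ k) ^ (α + 2 - p)) :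
    VanishingEmbedding p α q μ := by
  intro ε hε
  obtain ⟨C, hC⟩ := hW.exists_lintegral_le hp hpq hW0
  set B : ℝ≥0 := ε / (C + 1) with hB
  have hB0 : 0 < B := by positivity
  obtain ⟨δ, hδ, hδ'⟩ := hμ (B / (c₀ + 1)) (by positivity)
  -- The box of level k has side 2^(-(k-1)), so the little-o condition is available from level K₁ +
  -- 1 on.
  obtain ⟨K₁, hK₁⟩ := exists_pow_lt_of_lt_one hδ (by norm_num : (1 / 2 : ℝ) < 1)
  have hpos : ∀ k : ℕ, 0 < B * ENNReal.ofReal (((1 / 2 : ℝ) ^ k) ^ (α + 2 - p)) := fun k => by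
    apply ENNReal.mul_pos (by simpa using hB0.ne')
    rw [Ne, ENNReal.ofReal_eq_zero, not_le]
    positivity
  have hsmall : ∀ᶠ n : ℕ in atTop, ∀ k ∈ Finset.range (max K₀ (K₁ + 1)),
      ENNReal.ofReal (W k) * μ (outerAnnulus (1 - 1 / ((n : ℝ) + 1))) ≤
        B * ENNReal.ofReal (((1 / 2 : ℝ) ^ k) ^ (α + 2 - p)) := by
    rw [Filter.eventually_all_finset]
    intro k _
    have h1 := ENNReal.Tendsto.const_mul (a := ENNReal.ofReal (W k))
      (tendsto_measure_outerAnnulus μ) (Or.inr ENNReal.ofReal_ne_top)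
    rw [mul_zero] at h1
    filter_upwards [h1.eventually_lt_const (hpos k)] with n hn using hn.le
  obtain ⟨n, hn⟩ := hsmall.exists
  set ρ : ℝ := 1 - 1 / ((n : ℝ) + 1) with hρ
  refine ⟨ρ, ?_, fun f hf => ?_⟩
  · have : 0 < 1 / ((n : ℝ) + 1) := by positivity
    linarith
  have hbox : ∀ k a, ENNReal.ofReal (W k) *
      (μ.restrict (outerAnnulus ρ)) (carlesonSquare a ((1 / 2) ^ (k - 1))) ≤
        B * ENNReal.ofReal (((1 / 2 : ℝ) ^ k) ^ (α + 2 - p)) := by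
    intro k a
    by_cases hk : k < max K₀ (K₁ + 1)
    · refine le_trans ?_ (hn k (Finset.mem_range.2 hk))
      refine mul_le_mul_right ((measure_mono (Set.subset_univ _)).trans (le_of_eq ?_)) _
      rw [Measure.restrict_apply_univ]
    · have hk' : max K₀ (K₁ + 1) ≤ k := not_lt.1 hk
      have hk0 : K₀ ≤ k := (le_max_left _ _).trans hk'
      have hk1 : K₁ + 1 ≤ k := (le_max_right _ _).trans hk'
      have hl : (1 / 2 : ℝ) ^ (k - 1) < δ :=
        lt_of_le_of_lt (pow_le_pow_of_le_one (by norm_num) (by norm_num) (by omega)) hK₁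
      calc _ ≤ ENNReal.ofReal (W k) * μ (carlesonSquare a ((1 / 2) ^ (k - 1))) :=
            mul_le_mul_right (Measure.restrict_apply_le _ _) _
        _ ≤ ENNReal.ofReal (W k) * ENNReal.ofReal (B / (c₀ + 1) * ψ ((1 / 2) ^ (k - 1))) := by
            gcongr
            exact hδ' a _ (half_pow_pos _) (half_pow_le_one _) hl
        _ = ENNReal.ofReal (B / (c₀ + 1) * (W k * ψ ((1 / 2) ^ (k - 1)))) := by
            rw [← ENNReal.ofReal_mul (hWpos k)]
            ring_nf
        _ ≤ ENNReal.ofReal (B * ((1 / 2 : ℝ) ^ k) ^ (α + 2 - p)) := by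
            apply ENNReal.ofReal_le_ofReal
            calc _ ≤ B / (c₀ + 1) * (c₀ * ((1 / 2 : ℝ) ^ k) ^ (α + 2 - p)) :=
                  mul_le_mul_of_nonneg_left (hψ k hk0) (by positivity)
              _ = B * ((1 / 2 : ℝ) ^ k) ^ (α + 2 - p) * (c₀ / (c₀ + 1)) := by ring
              _ ≤ B * ((1 / 2 : ℝ) ^ k) ^ (α + 2 - p) * 1 := by
                  gcongr
                  rw [div_le_one (by positivity)]
                  linarith
              _ = _ := mul_one _
        _ = _ := by
            rw [ENNReal.ofReal_mul B.coe_nonneg]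
            simp
  have h2 := hC (μ.restrict (outerAnnulus ρ)) B hbox f hf
  rw [Measure.restrict_restrict (show MeasurableSet unitDisk from Metric.isOpen_ball.measurableSet),
    Set.inter_eq_right.2 (outerAnnulus_subset_unitDisk ρ)] at h2
  refine h2.trans ?_
  gcongr
  rw [← ENNReal.coe_mul]
  apply ENNReal.coe_le_coe.2
  rw [hB, mul_div_assoc']
  apply div_le_of_le_mul₀ (by positivity) (by positivity)
  rw [mul_comm]
  gcongr
  exact le_self_add

lemma measurable_volterraDensity (g : ℂ → ℂ) (q β : ℝ) :
    Measurable fun z => ENNReal.ofReal ((1 - ‖z‖ ^ 2) ^ β) * ‖deriv g z‖ₑ ^ q := by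
  have := measurable_deriv g
  fun_prop

instance (g : ℂ → ℂ) (q β : ℝ) : SFinite (volterraMeasure g q β) := by
  unfold volterraMeasure areaDisk
  infer_instance

lemma lintegral_areaDisk (F : ℂ → ℝ≥0∞) :
    ∫⁻ z, F z ∂areaDisk = (ENNReal.ofReal Real.pi)⁻¹ * ∫⁻ z in unitDisk, F z := by
  rw [areaDisk, lintegral_smul_measure, smul_eq_mul]

lemma ae_areaDisk_mem : ∀ᵐ z ∂areaDisk, z ∈ unitDisk := by
  rw [areaDisk]
  exact Measure.ae_smul_measure (ae_restrict_mem Metric.isOpen_ball.measurableSet) _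

lemma ae_volterraMeasure_mem (g : ℂ → ℂ) (q β : ℝ) : ∀ᵐ z ∂volterraMeasure g q β, z ∈ unitDisk :=
  (withDensity_absolutelyContinuous _ _).ae_le ae_areaDisk_mem

lemma restrict_volterraMeasure (g : ℂ → ℂ) (q β : ℝ) :
    (volterraMeasure g q β).restrict unitDisk = volterraMeasure g q β :=
  Measure.restrict_eq_self_of_ae_mem (ae_volterraMeasure_mem g q β)

instance : IsFiniteMeasure areaDisk := by
  refine ⟨?_⟩
  rw [areaDisk, Measure.smul_apply, Measure.restrict_apply_univ, smul_eq_mul]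
  refine ENNReal.mul_lt_top ?_ ?_
  · simpa using Real.pi_pos
  · exact measure_ball_lt_top

lemma lintegral_volterraMeasure (g : ℂ → ℂ) {q : ℝ} (hq : 0 < q) (β : ℝ) (F : ℂ → ℝ≥0∞) :
    ∫⁻ z, F z ∂volterraMeasure g q β =
      ∫⁻ z, ENNReal.ofReal ((1 - ‖z‖ ^ 2) ^ β) * ‖deriv g z‖ₑ ^ q * F z ∂areaDisk := by
  rw [volterraMeasure, lintegral_withDensity_eq_lintegral_mul_non_measurable _
    (measurable_volterraDensity g q β)]
  · rfl
  · refine Eventually.of_forall fun z => ENNReal.mul_lt_top ENNReal.ofReal_lt_top ?_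
    exact ENNReal.rpow_lt_top_of_nonneg hq.le enorm_ne_top

lemma volterraMeasure_univ (g : ℂ → ℂ) (q β : ℝ) :
    volterraMeasure g q β Set.univ = dirichletEnergy q β g := by
  rw [volterraMeasure, withDensity_apply _ MeasurableSet.univ, Measure.restrict_univ,
    dirichletEnergy]
  simp only [mul_comm]

lemma isFiniteMeasure_volterraMeasure_iff {g : ℂ → ℂ} (hg : AnalyticOnDisk g) {q : ℝ} (hq : 0 < q)
    (β : ℝ) : IsFiniteMeasure (volterraMeasure g q β) ↔ MemDirichlet q β g := by
  rw [MemDirichlet, and_iff_right hg, dirichletNorm_lt_top_iff hq, ← volterraMeasure_univ]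
  exact ⟨fun h => h.1, fun h => ⟨h⟩⟩

lemma volterraMeasure_closedBall_lt_top {g : ℂ → ℂ} (hg : AnalyticOnDisk g) {q : ℝ} (hq : 0 < q)
    (β : ℝ) {r : ℝ} (hr : r < 1) : volterraMeasure g q β (Metric.closedBall 0 r) < ∞ := by
  have hd : DifferentiableOn ℂ (deriv g) unitDisk := hg.deriv Metric.isOpen_ball
  have hcont : ContinuousOn (fun z => (1 - ‖z‖ ^ 2) ^ β * ‖deriv g z‖ ^ q)
      (Metric.closedBall (0 : ℂ) r) := by
    apply ContinuousOn.mul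
    · apply ContinuousOn.rpow_const
      · fun_prop
      · intro z hz
        rw [mem_closedBall_zero_iff] at hz
        left
        have := norm_nonneg z
        nlinarith
    · apply ContinuousOn.rpow_const
      · exact (hd.continuousOn.mono (Metric.closedBall_subset_ball hr)).norm
      · intro z _
        exact Or.inr hq.le
  obtain ⟨M, hM⟩ := (isCompact_closedBall (0 : ℂ) r).bddAbove_image hcont
  rw [volterraMeasure, withDensity_apply _ Metric.isClosed_closedBall.measurableSet]
  calc _ ≤ ∫⁻ z in Metric.closedBall (0 : ℂ) r, ENNReal.ofReal M ∂areaDisk := by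
        apply setLIntegral_mono' Metric.isClosed_closedBall.measurableSet
        intro z hz
        have h1 := hM (Set.mem_image_of_mem _ hz)
        rw [mem_closedBall_zero_iff] at hz
        have h2 : 0 ≤ 1 - ‖z‖ ^ 2 := by
          have := norm_nonneg z
          nlinarith
        rw [← ofReal_norm, ENNReal.ofReal_rpow_of_nonneg (norm_nonneg _) hq.le,
          ← ENNReal.ofReal_mul (by positivity)]
        exact ENNReal.ofReal_le_ofReal h1
    _ < ∞ := by
        rw [setLIntegral_const]
        exact ENNReal.mul_lt_top ENNReal.ofReal_lt_top (measure_lt_top _ _)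

/-- Consecutive arcs of angular length 2πl starting from -π cover the circle; the arc containing z
has index ⌊(arg z + π)/(2πl)⌋ ≤ 1/l. -/
lemma unitDisk_subset_closedBall_union_carlesonSquares {l : ℝ} (hl : 0 < l) :
    unitDisk ⊆ Metric.closedBall 0 (1 - l) ∪
      ⋃ j ∈ Finset.range (⌊1 / l⌋₊ + 1), carlesonSquare (2 * Real.pi * l * j - Real.pi) l := by
  intro z hz
  have hz' : ‖z‖ < 1 := by simpa [unitDisk] using hz
  by_cases h : ‖z‖ ≤ 1 - l
  · exact Or.inl (by simpa using h)
  right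
  push Not at h
  have hpi := Real.pi_pos
  have h1 := Complex.neg_pi_lt_arg z
  have h2 := Complex.arg_le_pi z
  set x := (Complex.arg z + Real.pi) / (2 * Real.pi * l) with hx
  have hx0 : 0 ≤ x := div_nonneg (by linarith) (by positivity)
  have hx1 : x ≤ 1 / l := by
    rw [hx, div_le_div_iff₀ (by positivity) hl]
    nlinarith
  have h3 := Nat.floor_le hx0
  have h4 := Nat.lt_floor_add_one x
  rw [hx, le_div_iff₀ (by positivity)] at h3
  rw [hx, div_lt_iff₀ (by positivity)] at h4
  simp only [Set.mem_iUnion]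
  refine ⟨⌊x⌋₊, ?_, ‖z‖, Complex.arg z, h.le, hz', ?_, ?_, (Complex.norm_mul_exp_arg_mul_I z).symm⟩
  · rw [Finset.mem_range]
    exact Nat.lt_succ_of_le (Nat.floor_mono hx1)
  · linarith
  · linarith

/-- Taking ε = 1 bounds all boxes of one fixed side; finitely many of them, with a compact disk on
which the density is bounded, cover everything. -/
lemma isFiniteMeasure_of_littleO {g : ℂ → ℂ} (hg : AnalyticOnDisk g) {q : ℝ} (hq : 0 < q) (β : ℝ)
    {ψ : ℝ → ℝ} (h : CarlesonLittleO (volterraMeasure g q β) ψ) :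
    IsFiniteMeasure (volterraMeasure g q β) := by
  obtain ⟨δ, hδ, H⟩ := h 1 one_pos
  set l := min 1 (δ / 2) with hl
  have hl0 : 0 < l := lt_min one_pos (by linarith)
  refine ⟨?_⟩
  rw [← restrict_volterraMeasure, Measure.restrict_apply_univ]
  refine lt_of_le_of_lt (measure_mono (unitDisk_subset_closedBall_union_carlesonSquares hl0)) ?_
  refine lt_of_le_of_lt (measure_union_le _ _) (ENNReal.add_lt_top.2 ⟨?_, ?_⟩)
  · exact volterraMeasure_closedBall_lt_top hg hq β (by linarith)
  · refine lt_of_le_of_lt (measure_biUnion_finset_le _ _) (ENNReal.sum_lt_top.2 fun j _ => ?_)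
    refine lt_of_le_of_lt (H _ l hl0 (min_le_left _ _) ?_) ENNReal.ofReal_lt_top
    exact lt_of_le_of_lt (min_le_right _ _) (by linarith)

lemma vanishingEmbedding_of_lt {p α q : ℝ} (hp : 0 < p) (hpq : p < q) (h : p < α + 2)
    {μ : Measure ℂ} [IsFiniteMeasure μ] (hμ : IsVanishingCarleson (q * (α + 2 - p) / p) μ) :
    VanishingEmbedding p α q μ := by
  -- From k = 1 on the box side is exactly 2 · 2^(-k), whence the constant c₀ and an equality.
  refine vanishingEmbedding_of_littleO hp hpq (radialControl_of_lt hp hpq h) (by simp)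
    (fun k => by positivity) hμ (K₀ := 1) (c₀ := 2 ^ (q * (α + 2 - p) / p)) (by positivity)
    fun k hk => le_of_eq ?_
  obtain ⟨j, rfl⟩ := Nat.exists_eq_add_of_le' hk
  simp only [Nat.add_sub_cancel]
  have e1 : (1 / 2 : ℝ) ^ j = 2 * (1 / 2) ^ (j + 1) := by rw [pow_succ]; ring
  have e2 : (2 : ℝ) ^ (j + 1) = ((1 / 2 : ℝ) ^ (j + 1))⁻¹ := by simp
  have hx := half_pow_pos (j + 1)
  rw [e1, e2, Real.mul_rpow (by norm_num) hx.le, Real.inv_rpow hx.le, ← Real.rpow_neg hx.le,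
    mul_left_comm, ← Real.rpow_add hx]
  congr 2
  field_simp
  ring

lemma vanishingEmbedding_of_eq {p α q : ℝ} (hp : 1 < p) (hpq : p < q) (h : p = α + 2)
    {μ : Measure ℂ} [IsFiniteMeasure μ]
    (hμ : CarlesonLittleO μ fun l => (Real.log (1 / l)) ^ ((1 / p - 1) * q)) :
    VanishingEmbedding p α q μ := by
  have hp0 : 0 < p := by linarith
  have hs : 0 ≤ q * (1 - 1 / p) := by
    apply mul_nonneg (by linarith)
    rw [sub_nonneg, div_le_one hp0]
    exact hp.le
  -- K₀ = 2 makes the side at most 1/2 and its logarithm positive. With k = j + 2 the ratio to be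
  -- bounded is (j+4)/((j+1) log 2) ≤ 4/log 2.
  refine vanishingEmbedding_of_littleO hp0 hpq (radialControl_of_eq hp hpq h)
    (Real.one_le_rpow (by simp) hs) (fun k => by positivity) hμ (K₀ := 2)
    (c₀ := (4 / Real.log 2) ^ (q * (1 - 1 / p))) (by positivity) fun k hk => ?_
  obtain ⟨j, rfl⟩ := Nat.exists_eq_add_of_le' hk
  have hlog := Real.log_pos one_lt_two
  have e1 : Real.log (1 / (1 / 2) ^ (j + 2 - 1)) = ((j : ℝ) + 1) * Real.log 2 := by
    rw [one_div_pow, one_div_one_div, show j + 2 - 1 = j + 1 by omega, Real.log_pow]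
    push_cast
    ring
  rw [e1, show (1 / p - 1) * q = -(q * (1 - 1 / p)) by ring, show α + 2 - p = 0 by linarith,
    Real.rpow_zero, mul_one, Real.rpow_neg (by positivity), ← Real.inv_rpow (by positivity),
    ← Real.mul_rpow (by positivity) (by positivity)]
  apply Real.rpow_le_rpow (by positivity) _ hs
  push_cast
  rw [← div_eq_mul_inv, div_le_div_iff₀ (by positivity) hlog]
  have hj : (0 : ℝ) ≤ j := Nat.cast_nonneg j
  nlinarith [mul_nonneg hj hlog.le]

lemma vanishingEmbedding_of_gt {p α q : ℝ} (hp : 0 < p) (hpq : p < q) (h : α + 2 < p)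
    {μ : Measure ℂ} [IsFiniteMeasure μ] : VanishingEmbedding p α q μ := by
  intro ε hε
  have hq : 0 < q := hp.trans hpq
  obtain ⟨C, hC⟩ := exists_enorm_le_of_gt hp h
  have h1 := ENNReal.Tendsto.const_mul (a := (C : ℝ≥0∞) ^ q)
    (tendsto_measure_outerAnnulus μ)
    (Or.inr (ENNReal.rpow_ne_top_of_nonneg hq.le ENNReal.coe_ne_top))
  rw [mul_zero] at h1
  obtain ⟨n, hn⟩ := (h1.eventually_lt_const (ENNReal.coe_pos.2 hε)).exists
  refine ⟨1 - 1 / ((n : ℝ) + 1), ?_, fun f hf => ?_⟩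
  · have : 0 < 1 / ((n : ℝ) + 1) := by positivity
    linarith
  calc _ ≤ ∫⁻ z in outerAnnulus (1 - 1 / ((n : ℝ) + 1)), (C * dirichletNorm p α f) ^ q ∂μ := by
        apply setLIntegral_mono' (measurableSet_outerAnnulus _)
        intro z hz
        exact ENNReal.rpow_le_rpow (hC f hf z (outerAnnulus_subset_unitDisk _ hz)) hq.le
    _ = C ^ q * μ (outerAnnulus (1 - 1 / ((n : ℝ) + 1))) * dirichletNorm p α f ^ q := by
        rw [setLIntegral_const, ENNReal.mul_rpow_of_nonneg _ _ hq.le]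
        ring
    _ ≤ _ := mul_le_mul_left hn.le _


/-! ### The Volterra operator and sufficiency for compactness -/

lemma isOpen_unitDisk : IsOpen unitDisk := Metric.isOpen_ball

lemma measurableSet_unitDisk : MeasurableSet unitDisk := isOpen_unitDisk.measurableSet

/-- The holomorphic function f g' has a primitive F on the disk, and the segment integral equals
F(z) - F(0) by the fundamental theorem of calculus. -/
lemma hasDerivAt_volterraOp {g f : ℂ → ℂ} (hg : AnalyticOnDisk g) (hf : AnalyticOnDisk f) {z : ℂ}
    (hz : z ∈ unitDisk) : HasDerivAt (volterraOp g f) (f z * deriv g z) z := by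
  have hh : DifferentiableOn ℂ (fun w => f w * deriv g w) unitDisk :=
    hf.mul (hg.deriv isOpen_unitDisk)
  obtain ⟨F, hF⟩ := DifferentiableOn.isExactOn_ball hh
  have heq : ∀ w ∈ unitDisk, volterraOp g f w = F w - F 0 := by
    intro w hw
    have hw' : ‖w‖ < 1 := by simpa [unitDisk] using hw
    have hmem : ∀ t ∈ Set.uIcc (0 : ℝ) 1, (t : ℂ) * w ∈ unitDisk := by
      intro t ht
      rw [Set.uIcc_of_le zero_le_one] at ht
      rw [unitDisk, mem_ball_zero_iff, norm_mul, Complex.norm_real, Real.norm_of_nonneg ht.1]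
      nlinarith [norm_nonneg w, ht.1, ht.2]
    have hder : ∀ t ∈ Set.uIcc (0 : ℝ) 1, HasDerivAt (fun t : ℝ => F ((t : ℂ) * w))
        (f ((t : ℂ) * w) * deriv g ((t : ℂ) * w) * w) t := by
      intro t ht
      have h1 : HasDerivAt (fun s : ℂ => s * w) w (t : ℂ) := by
        simpa using (hasDerivAt_id (t : ℂ)).mul_const w
      exact ((hF _ (hmem t ht)).comp (t : ℂ) h1).comp_ofReal
    have hint : IntervalIntegrable (fun t : ℝ => f ((t : ℂ) * w) * deriv g ((t : ℂ) * w) * w)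
        volume 0 1 := by
      apply ContinuousOn.intervalIntegrable
      apply ContinuousOn.mul _ continuousOn_const
      exact hh.continuousOn.comp (by fun_prop) hmem
    have := intervalIntegral.integral_eq_sub_of_hasDerivAt hder hint
    rw [volterraOp, this]
    simp
  have h2 : HasDerivAt (fun w => F w - F 0) (f z * deriv g z) z := (hF z hz).sub_const _
  refine h2.congr_of_eventuallyEq ?_
  filter_upwards [isOpen_unitDisk.mem_nhds hz] with w hw using heq w hw

lemma analyticOnDisk_volterraOp {g f : ℂ → ℂ} (hg : AnalyticOnDisk g) (hf : AnalyticOnDisk f) :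
    AnalyticOnDisk (volterraOp g f) := fun _ hz =>
  (hasDerivAt_volterraOp hg hf hz).differentiableAt.differentiableWithinAt

lemma volterraOp_zero (g f : ℂ → ℂ) : volterraOp g f 0 = 0 := by
  simp [volterraOp]

lemma dirichletEnergy_eq_lintegral {g H u : ℂ → ℂ} {q : ℝ} (hq : 0 < q) (β : ℝ)
    (h : ∀ z ∈ unitDisk, deriv H z = u z * deriv g z) :
    dirichletEnergy q β H = ∫⁻ z, ‖u z‖ₑ ^ q ∂volterraMeasure g q β := by
  rw [lintegral_volterraMeasure g hq, dirichletEnergy]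
  apply lintegral_congr_ae
  filter_upwards [ae_areaDisk_mem] with z hz
  rw [h z hz, enorm_mul, ENNReal.mul_rpow_of_nonneg _ _ hq.le]
  ring

lemma dirichletEnergy_volterraOp {g f : ℂ → ℂ} (hg : AnalyticOnDisk g) (hf : AnalyticOnDisk f)
    {q : ℝ} (hq : 0 < q) (β : ℝ) :
    dirichletEnergy q β (volterraOp g f) = ∫⁻ z, ‖f z‖ₑ ^ q ∂volterraMeasure g q β :=
  dirichletEnergy_eq_lintegral hq β fun _ hz => (hasDerivAt_volterraOp hg hf hz).deriv

lemma dirichletNorm_volterraOp_sub {g f₁ f₂ : ℂ → ℂ} (hg : AnalyticOnDisk g)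
    (h₁ : AnalyticOnDisk f₁) (h₂ : AnalyticOnDisk f₂) {q : ℝ} (hq : 0 < q) (β : ℝ) :
    dirichletNorm q β (volterraOp g f₁ - volterraOp g f₂) =
      (∫⁻ z, ‖f₁ z - f₂ z‖ₑ ^ q ∂volterraMeasure g q β) ^ (1 / q) := by
  rw [dirichletNorm_eq, dirichletEnergy_eq_lintegral (g := g) (u := fun z => f₁ z - f₂ z) hq β]
  · simp [volterraOp_zero, hq]
  · intro z hz
    rw [((hasDerivAt_volterraOp hg h₁ hz).sub (hasDerivAt_volterraOp hg h₂ hz)).deriv]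
    ring

lemma AnalyticOnDisk.aemeasurable {f : ℂ → ℂ} (hf : AnalyticOnDisk f) (g : ℂ → ℂ) (q β : ℝ) :
    AEMeasurable f (volterraMeasure g q β) := by
  rw [← restrict_volterraMeasure]
  exact hf.continuousOn.aemeasurable measurableSet_unitDisk

/-- Montel's theorem on the disk, with pointwise convergence. -/
lemma exists_subseq_tendsto_of_locally_bounded {F : ℕ → ℂ → ℂ} (hF : ∀ n, AnalyticOnDisk (F n))
    (hb : ∀ r < 1, ∃ M : ℝ, ∀ n, ∀ z ∈ Metric.closedBall (0 : ℂ) r, ‖F n z‖ ≤ M) :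
    ∃ (φ : ℕ → ℕ) (f : ℂ → ℂ), StrictMono φ ∧ AnalyticOnDisk f ∧
      ∀ z ∈ unitDisk, Tendsto (fun n => F (φ n) z) atTop (𝓝 (f z)) := by
  set a : ℕ → ℕ → ℂ := fun n k => ((k.factorial : ℂ))⁻¹ * iteratedDeriv k (F n) 0 with ha
  have hcoef : ∀ r : ℝ, 0 < r → r < 1 → ∃ M : ℝ, 0 ≤ M ∧ ∀ n k, ‖a n k‖ ≤ M / r ^ k := by
    intro r hr hr1
    obtain ⟨M, hM⟩ := hb r hr1
    have hM0 : 0 ≤ M := (norm_nonneg _).trans (hM 0 0 (by simp [hr.le]))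
    refine ⟨M, hM0, fun n k => ?_⟩
    have h1 : DiffContOnCl ℂ (F n) (Metric.ball 0 r) := by
      apply DifferentiableOn.diffContOnCl
      rw [closure_ball _ hr.ne']
      exact (hF n).mono (Metric.closedBall_subset_ball hr1)
    have h2 := Complex.norm_iteratedDeriv_le_of_forall_mem_sphere_norm_le k hr h1
      (fun z hz => hM n z (Metric.sphere_subset_closedBall hz))
    have hk : (0 : ℝ) < k.factorial := by exact_mod_cast k.factorial_pos
    simp only [ha]
    rw [norm_mul, norm_inv, Complex.norm_natCast, inv_mul_le_iff₀ hk, ← mul_div_assoc]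
    exact h2
  obtain ⟨M₀, _, hM₀⟩ := hcoef (1 / 2) (by norm_num) (by norm_num)
  -- Cauchy estimates at radius 1/2 put the Taylor coefficient sequences in a product of closed
  -- disks; its compactness replaces the diagonal argument. Estimates at radii close to 1 then
  -- dominate the series on the whole disk.
  obtain ⟨b, _, φ, hφ, hconv⟩ := (isCompact_univ_pi fun k : ℕ =>
    isCompact_closedBall (0 : ℂ) (M₀ / (1 / 2) ^ k)).tendsto_subseq (x := a)
    (fun n k _ => by simpa using hM₀ n k)
  have hconv' : ∀ k, Tendsto (fun n => a (φ n) k) atTop (𝓝 (b k)) := fun k =>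
    (tendsto_pi_nhds.1 hconv) k
  have hbk : ∀ r : ℝ, 0 < r → r < 1 → ∃ M : ℝ, 0 ≤ M ∧ (∀ n k, ‖a n k‖ ≤ M / r ^ k) ∧
      ∀ k, ‖b k‖ ≤ M / r ^ k := by
    intro r hr hr1
    obtain ⟨M, hM0, hM⟩ := hcoef r hr hr1
    exact ⟨M, hM0, hM, fun k => le_of_tendsto (hconv' k).norm (Eventually.of_forall fun n => hM _ k)⟩
  have hterm : ∀ (c : ℂ) (M r s : ℝ) (w : ℂ) (k : ℕ), 0 < r → ‖c‖ ≤ M / r ^ k → ‖w‖ ≤ s →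
      ‖c * w ^ k‖ ≤ M * (s / r) ^ k := by
    intro c M r s w k hr hc hw
    have hM : 0 ≤ M / r ^ k := (norm_nonneg _).trans hc
    rw [norm_mul, norm_pow, div_pow, mul_div_assoc', mul_div_right_comm]
    gcongr
  have hsumm : ∀ M s r : ℝ, 0 ≤ s → s < r → Summable fun k : ℕ => M * (s / r) ^ k := by
    intro M s r hs hsr
    apply Summable.mul_left
    apply summable_geometric_of_lt_one (div_nonneg hs (by linarith))
    rw [div_lt_one (by linarith)]
    exact hsr
  refine ⟨φ, fun z => ∑' k, b k * z ^ k, hφ, ?_, ?_⟩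
  · intro z hz
    have hz' : ‖z‖ < 1 := by simpa [unitDisk] using hz
    obtain ⟨s, hs1, hs2⟩ := exists_between hz'
    obtain ⟨r, hr1, hr2⟩ := exists_between hs2
    have hs0 : 0 ≤ s := (norm_nonneg z).trans hs1.le
    obtain ⟨M, hM0, -, hM⟩ := hbk r (by linarith) hr2
    have := Complex.differentiableOn_tsum_of_summable_norm (U := Metric.ball (0 : ℂ) s)
      (F := fun k w => b k * w ^ k) (hsumm M s r hs0 hr1)
      (fun k => by fun_prop) Metric.isOpen_ball
      (fun k w hw => hterm _ M r s w k (by linarith) (hM k) (by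
        rw [mem_ball_zero_iff] at hw; exact hw.le))
    exact (this.differentiableAt (Metric.isOpen_ball.mem_nhds
      (by rwa [mem_ball_zero_iff]))).differentiableWithinAt
  · intro z hz
    have hz' : ‖z‖ < 1 := by simpa [unitDisk] using hz
    obtain ⟨r, hr1, hr2⟩ := exists_between hz'
    have hr0 : 0 < r := lt_of_le_of_lt (norm_nonneg z) hr1
    obtain ⟨M, hM0, hMa, -⟩ := hbk r hr0 hr2
    have h1 := tendsto_tsum_of_dominated_convergence (𝓕 := atTop)
      (f := fun n k => a (φ n) k * z ^ k) (g := fun k => b k * z ^ k)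
      (hsumm M ‖z‖ r (norm_nonneg z) hr1) (fun k => (hconv' k).mul_const _)
      (Eventually.of_forall fun n k => hterm _ M r ‖z‖ z k hr0 (hMa _ k) le_rfl)
    refine h1.congr fun n => ?_
    rw [← Complex.taylorSeries_eq_on_ball (hF (φ n)) hz]
    refine tsum_congr fun k => ?_
    simp only [ha, smul_eq_mul, sub_zero]
    ring

lemma unitDisk_subset_closedBall_union (ρ : ℝ) :
    unitDisk ⊆ Metric.closedBall 0 ρ ∪ outerAnnulus ρ := by
  intro z hz
  by_cases h : ‖z‖ ≤ ρ
  · exact Or.inl (by simpa using h)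
  · exact Or.inr ⟨not_le.1 h, by simpa [unitDisk] using hz⟩

lemma lintegral_volterraMeasure_le_add (g : ℂ → ℂ) (q β ρ : ℝ) (F : ℂ → ℝ≥0∞) :
    ∫⁻ z, F z ∂volterraMeasure g q β ≤
      ∫⁻ z in Metric.closedBall 0 ρ, F z ∂volterraMeasure g q β +
        ∫⁻ z in outerAnnulus ρ, F z ∂volterraMeasure g q β := by
  calc ∫⁻ z, F z ∂volterraMeasure g q β = ∫⁻ z in unitDisk, F z ∂volterraMeasure g q β := by
        rw [restrict_volterraMeasure]
    _ ≤ _ := (lintegral_mono_set (unitDisk_subset_closedBall_union ρ)).trans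
        (lintegral_union_le _ _ _)

/-- Near the circle this is the vanishing embedding with ε = 1; on the remaining compact disk point
evaluations are uniformly bounded and μ is finite. -/
lemma exists_lintegral_le_of_vanishing {p α q β : ℝ} {g : ℂ → ℂ} (hp : 0 < p) (hq : 0 < q)
    [IsFiniteMeasure (volterraMeasure g q β)]
    (h : VanishingEmbedding p α q (volterraMeasure g q β)) :
    ∃ K : ℝ≥0∞, K ≠ ∞ ∧ ∀ f, MemDirichlet p α f →
      ∫⁻ z, ‖f z‖ₑ ^ q ∂volterraMeasure g q β ≤ K * dirichletNorm p α f ^ q := by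
  obtain ⟨ρ, hρ, H⟩ := h 1 one_pos
  obtain ⟨C, hC⟩ := exists_enorm_le_on_closedBall hp α hρ
  refine ⟨C ^ q * volterraMeasure g q β Set.univ + 1, ?_, fun f hf => ?_⟩
  · exact ENNReal.add_ne_top.2 ⟨ENNReal.mul_ne_top
      (ENNReal.rpow_ne_top_of_nonneg hq.le ENNReal.coe_ne_top) (measure_ne_top _ _), by simp⟩
  refine (lintegral_volterraMeasure_le_add g q β ρ _).trans ?_
  rw [add_mul]
  refine add_le_add ?_ (by simpa using H f hf)
  calc ∫⁻ z in Metric.closedBall 0 ρ, ‖f z‖ₑ ^ q ∂volterraMeasure g q β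
      ≤ ∫⁻ z in Metric.closedBall 0 ρ, (C * dirichletNorm p α f) ^ q ∂volterraMeasure g q β := by
        apply setLIntegral_mono' Metric.isClosed_closedBall.measurableSet
        intro z hz
        exact ENNReal.rpow_le_rpow (hC f hf z hz) hq.le
    _ ≤ (C * dirichletNorm p α f) ^ q * volterraMeasure g q β Set.univ := by
        rw [setLIntegral_const]
        gcongr
        exact Set.subset_univ _
    _ = _ := by
        rw [ENNReal.mul_rpow_of_nonneg _ _ hq.le]
        ring

/-- Fatou's lemma. -/
lemma lintegral_enorm_rpow_le_of_tendsto {μ : Measure ℂ} {F : ℕ → ℂ → ℂ} {f : ℂ → ℂ} {q : ℝ}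
    (hF : ∀ n, AEMeasurable (F n) μ)
    (hlim : ∀ᵐ z ∂μ, Tendsto (fun n => F n z) atTop (𝓝 (f z))) {K : ℝ≥0∞}
    (hK : ∀ n, ∫⁻ z, ‖F n z‖ₑ ^ q ∂μ ≤ K) : ∫⁻ z, ‖f z‖ₑ ^ q ∂μ ≤ K := by
  calc ∫⁻ z, ‖f z‖ₑ ^ q ∂μ = ∫⁻ z, liminf (fun n => ‖F n z‖ₑ ^ q) atTop ∂μ := by
        apply lintegral_congr_ae
        filter_upwards [hlim] with z hz
        exact (((ENNReal.continuous_rpow_const (y := q)).tendsto _).comp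
          hz.enorm).liminf_eq.symm
    _ ≤ liminf (fun n => ∫⁻ z, ‖F n z‖ₑ ^ q ∂μ) atTop :=
        lintegral_liminf_le' fun n => (hF n).enorm.pow_const q
    _ ≤ K := liminf_le_of_le (by isBoundedDefault) fun b hb => by
        obtain ⟨n, hn⟩ := hb.exists
        exact hn.trans (hK n)

/-- Montel gives a pointwise convergent subsequence f_n → F. Its distance to F in L^q(μ) is
uniformly small near the circle and tends to 0 inside by dominated convergence; T_g F is the limit
in D^q_β. -/
lemma isCompactDirichlet_of_vanishing {p α q β : ℝ} {g : ℂ → ℂ} (hg : AnalyticOnDisk g)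
    (hp : 0 < p) (hq : 0 < q) [IsFiniteMeasure (volterraMeasure g q β)]
    (h : VanishingEmbedding p α q (volterraMeasure g q β)) :
    IsCompactDirichlet p α q β (volterraOp g) := by
  set μ := volterraMeasure g q β with hμ
  obtain ⟨K, hK, hembed⟩ := exists_lintegral_le_of_vanishing hp hq h
  refine ⟨fun f hf => ⟨analyticOnDisk_volterraOp hg hf.1, ?_⟩, fun f hf hbound => ?_⟩
  · rw [dirichletNorm_lt_top_iff hq, dirichletEnergy_volterraOp hg hf.1 hq]
    exact lt_of_le_of_lt (hembed f hf) (ENNReal.mul_lt_top hK.lt_top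
      (ENNReal.rpow_lt_top_of_nonneg hq.le hf.2.ne))
  obtain ⟨C, hC⟩ := hbound
  have hlocal : ∀ r < 1, ∃ M : ℝ, ∀ n, ∀ z ∈ Metric.closedBall (0 : ℂ) r, ‖f n z‖ ≤ M := by
    intro r hr
    obtain ⟨C', hC'⟩ := exists_enorm_le_on_closedBall hp α hr
    refine ⟨C' * C, fun n z hz => ?_⟩
    have h1 : ‖f n z‖ₑ ≤ C' * C := (hC' (f n) (hf n) z hz).trans (mul_le_mul_right (hC n) _)
    rw [← ENNReal.coe_mul, enorm_eq_nnnorm, ENNReal.coe_le_coe] at h1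
    exact_mod_cast h1
  obtain ⟨φ, F, hφ, hFan, hlim⟩ := exists_subseq_tendsto_of_locally_bounded (fun n => (hf n).1) hlocal
  have hlimae : ∀ᵐ z ∂μ, Tendsto (fun n => f (φ n) z) atTop (𝓝 (F z)) := by
    filter_upwards [ae_volterraMeasure_mem g q β] with z hz using hlim z hz
  have hmeas : ∀ n, AEMeasurable (f (φ n)) μ := fun n => (hf (φ n)).1.aemeasurable g q β
  have hCq : (C : ℝ≥0∞) ^ q ≠ ∞ := ENNReal.rpow_ne_top_of_nonneg hq.le ENNReal.coe_ne_top
  have hFint : ∫⁻ z, ‖F z‖ₑ ^ q ∂μ ≤ K * C ^ q :=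
    lintegral_enorm_rpow_le_of_tendsto hmeas hlimae fun n =>
      (hembed _ (hf _)).trans (mul_le_mul_right (ENNReal.rpow_le_rpow (hC _) hq.le) _)
  refine ⟨φ, volterraOp g F, hφ, ⟨analyticOnDisk_volterraOp hg hFan, ?_⟩, ?_⟩
  · rw [dirichletNorm_lt_top_iff hq, dirichletEnergy_volterraOp hg hFan hq]
    exact lt_of_le_of_lt hFint (ENNReal.mul_lt_top hK.lt_top hCq.lt_top)
  have hint : Tendsto (fun n => ∫⁻ z, ‖f (φ n) z - F z‖ₑ ^ q ∂μ) atTop (𝓝 0) := by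
    rw [ENNReal.tendsto_nhds_zero]
    intro ε hε
    have h2q : (2 : ℝ≥0∞) ^ q ≠ ∞ := ENNReal.rpow_ne_top_of_nonneg hq.le (by simp)
    set A : ℝ≥0∞ := 2 ^ q * (C ^ q + C ^ q) with hA
    have hAt : A ≠ ∞ := ENNReal.mul_ne_top h2q (ENNReal.add_ne_top.2 ⟨hCq, hCq⟩)
    obtain ⟨η, hη0, hη⟩ : ∃ η : ℝ≥0, 0 < η ∧ η * A ≤ ε / 2 := by
      have h1 : Tendsto (fun η : ℝ≥0 => (η : ℝ≥0∞) * A) (𝓝[>] 0) (𝓝 0) := by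
        have h2 : Tendsto (fun η : ℝ≥0 => (η : ℝ≥0∞)) (𝓝[>] 0) (𝓝 0) :=
          (ENNReal.tendsto_coe.2 tendsto_id).mono_left nhdsWithin_le_nhds
        simpa using ENNReal.Tendsto.mul_const h2 (Or.inr hAt)
      have h3 := h1.eventually_lt_const (ENNReal.half_pos hε.ne')
      obtain ⟨η, h4, h5⟩ := (h3.and self_mem_nhdsWithin).exists
      exact ⟨η, h5, h4.le⟩
    obtain ⟨ρ, hρ, hρ'⟩ := h η hη0
    -- The embedding estimate cannot be applied to F directly, as no D^p_α bound for F has been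
    -- established; Fatou transfers it from the sequence.
    have hFρ : ∫⁻ z in outerAnnulus ρ, ‖F z‖ₑ ^ q ∂μ ≤ η * C ^ q :=
      lintegral_enorm_rpow_le_of_tendsto (fun n => (hmeas n).restrict)
        (ae_restrict_of_ae hlimae) fun n =>
        (hρ' _ (hf _)).trans (mul_le_mul_right (ENNReal.rpow_le_rpow (hC _) hq.le) _)
    have houter : ∀ n, ∫⁻ z in outerAnnulus ρ, ‖f (φ n) z - F z‖ₑ ^ q ∂μ ≤ ε / 2 := by
      intro n
      calc ∫⁻ z in outerAnnulus ρ, ‖f (φ n) z - F z‖ₑ ^ q ∂μ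
          ≤ ∫⁻ z in outerAnnulus ρ, 2 ^ q * (‖f (φ n) z‖ₑ ^ q + ‖F z‖ₑ ^ q) ∂μ :=
            lintegral_mono fun z => (ENNReal.rpow_le_rpow (enorm_sub_le) hq.le).trans
              (ennreal_add_rpow_le _ _ hq)
        _ = 2 ^ q * (∫⁻ z in outerAnnulus ρ, ‖f (φ n) z‖ₑ ^ q ∂μ +
              ∫⁻ z in outerAnnulus ρ, ‖F z‖ₑ ^ q ∂μ) := by
            rw [lintegral_const_mul' _ _ h2q,
              lintegral_add_left' ((hmeas n).restrict.enorm.pow_const q)]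
        _ ≤ 2 ^ q * (η * C ^ q + η * C ^ q) := by
            gcongr
            exact (hρ' _ (hf _)).trans (mul_le_mul_right (ENNReal.rpow_le_rpow (hC _) hq.le) _)
        _ = η * A := by rw [hA]; ring
        _ ≤ ε / 2 := hη
    obtain ⟨M, hM⟩ := hlocal ρ hρ
    have hinner : Tendsto (fun n => ∫⁻ z in Metric.closedBall 0 ρ, ‖f (φ n) z - F z‖ₑ ^ q ∂μ) atTop
        (𝓝 0) := by
      have h1 := tendsto_lintegral_of_dominated_convergence'
        (μ := μ.restrict (Metric.closedBall 0 ρ)) (F := fun n z => ‖f (φ n) z - F z‖ₑ ^ q)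
        (f := fun _ => 0) (fun _ => ENNReal.ofReal (2 * M) ^ q)
        (fun n => (((hmeas n).sub (hFan.aemeasurable g q β)).restrict.enorm.pow_const q))
        (fun n => by
          filter_upwards [ae_restrict_mem Metric.isClosed_closedBall.measurableSet] with z hz
          apply ENNReal.rpow_le_rpow _ hq.le
          rw [← ofReal_norm]
          apply ENNReal.ofReal_le_ofReal
          have h2 : ‖F z‖ ≤ M := le_of_tendsto (hlim z (Metric.closedBall_subset_ball hρ hz)).norm
            (Eventually.of_forall fun n => hM _ z hz)
          have h3 := hM (φ n) z hz
          have h4 := norm_sub_le (f (φ n) z) (F z)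
          linarith)
        (by
          rw [lintegral_const]
          exact ENNReal.mul_ne_top (ENNReal.rpow_ne_top_of_nonneg hq.le ENNReal.ofReal_ne_top)
            (measure_ne_top _ _))
        (by
          filter_upwards [ae_restrict_of_ae hlimae] with z hz
          have h2 : Tendsto (fun n => f (φ n) z - F z) atTop (𝓝 0) := by
            simpa using hz.sub_const (F z)
          have h3 := ((ENNReal.continuous_rpow_const (y := q)).tendsto _).comp h2.enorm
          simpa [hq, Function.comp_def] using h3)
      simpa using h1
    have h5 := ENNReal.tendsto_nhds_zero.1 hinner (ε / 2) (ENNReal.half_pos hε.ne')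
    filter_upwards [h5] with n hn
    calc _ ≤ _ := lintegral_volterraMeasure_le_add g q β ρ _
      _ ≤ ε / 2 + ε / 2 := add_le_add hn (houter n)
      _ = ε := ENNReal.add_halves ε
  have h6 := ((ENNReal.continuous_rpow_const (y := 1 / q)).tendsto _).comp hint
  rw [ENNReal.zero_rpow_of_pos (by positivity)] at h6
  refine h6.congr fun n => ?_
  rw [dirichletNorm_volterraOp_sub hg (hf _).1 hFan hq]
  rfl


/-! ### Forelli-Rudin integrals -/

lemma lintegral_Ioc_ofReal_eq {f : ℝ → ℝ} {a b : ℝ} (hab : a ≤ b)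
    (hf : IntervalIntegrable f volume a b) (h0 : ∀ x ∈ Set.Ioc a b, 0 ≤ f x) :
    ∫⁻ x in Set.Ioc a b, ENNReal.ofReal (f x) = ENNReal.ofReal (∫ x in a..b, f x) := by
  rw [intervalIntegral.integral_of_le hab, ofReal_integral_eq_lintegral_ofReal hf.1]
  filter_upwards [ae_restrict_mem measurableSet_Ioc] with x hx using h0 x hx

lemma integral_rpow_neg_le {c x y : ℝ} (hc : 1 < c) (hx : 0 < x) (hxy : x ≤ y) :
    ∫ t in x..y, t ^ (-c) ≤ 1 / (c - 1) * x ^ (1 - c) := by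
  rw [integral_rpow]
  · have hy : 0 < y := lt_of_lt_of_le hx hxy
    rw [show -c + 1 = 1 - c by ring, ← neg_sub c 1, div_neg, ← neg_div, neg_sub, div_eq_inv_mul,
      ← one_div, neg_sub]
    have h1 : 0 ≤ 1 / (c - 1) := div_nonneg zero_le_one (by linarith)
    apply mul_le_mul_of_nonneg_left _ h1
    have : 0 ≤ y ^ (1 - c) := by positivity
    linarith
  · right
    refine ⟨by linarith, ?_⟩
    rw [Set.uIcc_of_le hxy]
    intro h
    linarith [h.1]

lemma lintegral_add_abs_rpow_neg_le {c x : ℝ} (hc : 1 < c) (hx : 0 < x) :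
    ∫⁻ θ in Set.Ioo (-Real.pi) Real.pi, ENNReal.ofReal ((x + |θ|) ^ (-c)) ≤
      ENNReal.ofReal (2 / (c - 1)) * ENNReal.ofReal (x ^ (1 - c)) := by
  have hpi := Real.pi_pos
  have hcont : Continuous fun θ : ℝ => (x + |θ|) ^ (-c) := by
    apply Continuous.rpow_const (by fun_prop)
    intro θ
    left
    positivity
  have hpos : ∀ θ : ℝ, 0 ≤ (x + |θ|) ^ (-c) := fun θ => by positivity
  have h1 : ∫ θ in (0 : ℝ)..Real.pi, (x + |θ|) ^ (-c) ≤ 1 / (c - 1) * x ^ (1 - c) := by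
    calc ∫ θ in (0 : ℝ)..Real.pi, (x + |θ|) ^ (-c) = ∫ θ in (0 : ℝ)..Real.pi, (x + θ) ^ (-c) := by
          apply intervalIntegral.integral_congr
          intro θ hθ
          rw [Set.uIcc_of_le hpi.le] at hθ
          simp only [abs_of_nonneg hθ.1]
      _ = ∫ t in (x + 0)..(x + Real.pi), t ^ (-c) :=
          intervalIntegral.integral_comp_add_left (fun t => t ^ (-c)) x
      _ ≤ _ := by
          rw [add_zero]
          exact integral_rpow_neg_le hc hx (by linarith)
  have h2 : ∫ θ in (-Real.pi)..0, (x + |θ|) ^ (-c) = ∫ θ in (0 : ℝ)..Real.pi, (x + |θ|) ^ (-c) := by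
    have := intervalIntegral.integral_comp_neg (a := 0) (b := Real.pi)
      (fun θ : ℝ => (x + |θ|) ^ (-c))
    simp only [abs_neg, neg_zero] at this
    exact this.symm
  calc _ ≤ ∫⁻ θ in Set.Ioc (-Real.pi) 0 ∪ Set.Ioc 0 Real.pi, ENNReal.ofReal ((x + |θ|) ^ (-c)) := by
        apply lintegral_mono_set
        rw [Set.Ioc_union_Ioc_eq_Ioc (by linarith) hpi.le]
        exact Set.Ioo_subset_Ioc_self
    _ ≤ _ := lintegral_union_le _ _ _
    _ = ENNReal.ofReal (∫ θ in (-Real.pi)..0, (x + |θ|) ^ (-c)) +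
          ENNReal.ofReal (∫ θ in (0 : ℝ)..Real.pi, (x + |θ|) ^ (-c)) := by
        rw [lintegral_Ioc_ofReal_eq (by linarith) (hcont.intervalIntegrable _ _) fun θ _ => hpos θ,
          lintegral_Ioc_ofReal_eq hpi.le (hcont.intervalIntegrable _ _) fun θ _ => hpos θ]
    _ ≤ ENNReal.ofReal (1 / (c - 1) * x ^ (1 - c)) + ENNReal.ofReal (1 / (c - 1) * x ^ (1 - c)) := by
        rw [h2]
        gcongr
    _ = _ := by
        have h3 : 0 < c - 1 := by linarith
        rw [← ENNReal.ofReal_add (by positivity) (by positivity), ← ENNReal.ofReal_mul (by positivity)]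
        congr 1
        ring

/-- The radial integral arising from `∫ (1 - |z|²)^α |1 - w̄ z|^(-c)`, with `h = 1 - |w|`. -/
noncomputable def radialKernelIntegral (α c h : ℝ) : ℝ≥0∞ :=
  ∫⁻ u in Set.Ioo (0 : ℝ) 1, ENNReal.ofReal (u ^ α * (h + u) ^ (1 - c))

/-- The integral is split at u = h. Since 1 - c < 0, h + u may be replaced by h on the first part
and by u on the second. -/
lemma radialKernelIntegral_le_add {α c h : ℝ} (hα : -1 < α) (hc : 1 < c) (h0 : 0 < h)
    (h1 : h ≤ 1) : radialKernelIntegral α c h ≤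
      ENNReal.ofReal (1 / (α + 1) * h ^ (α + 2 - c)) +
        ENNReal.ofReal (∫ u in h..1, u ^ (α + 1 - c)) := by
  have hα1 : 0 < α + 1 := by linarith
  have hint1 : IntervalIntegrable (fun u : ℝ => u ^ α * h ^ (1 - c)) volume 0 h :=
    (intervalIntegral.intervalIntegrable_rpow' hα).mul_const _
  have hint2 : IntervalIntegrable (fun u : ℝ => u ^ (α + 1 - c)) volume h 1 := by
    apply intervalIntegral.intervalIntegrable_rpow
    right
    rw [Set.uIcc_of_le h1]
    intro h2
    linarith [h2.1]
  calc radialKernelIntegral α c h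
      ≤ ∫⁻ u in Set.Ioc 0 h ∪ Set.Ioc h 1, ENNReal.ofReal (u ^ α * (h + u) ^ (1 - c)) := by
        apply lintegral_mono_set
        rw [Set.Ioc_union_Ioc_eq_Ioc h0.le h1]
        exact Set.Ioo_subset_Ioc_self
    _ ≤ _ := lintegral_union_le _ _ _
    _ ≤ (∫⁻ u in Set.Ioc 0 h, ENNReal.ofReal (u ^ α * h ^ (1 - c))) +
          ∫⁻ u in Set.Ioc h 1, ENNReal.ofReal (u ^ (α + 1 - c)) := by
        refine add_le_add (setLIntegral_mono' measurableSet_Ioc fun u hu => ?_)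
          (setLIntegral_mono' measurableSet_Ioc fun u hu => ?_)
        · apply ENNReal.ofReal_le_ofReal
          have := hu.1
          apply mul_le_mul_of_nonneg_left _ (by positivity)
          exact Real.rpow_le_rpow_of_nonpos h0 (by linarith) (by linarith)
        · apply ENNReal.ofReal_le_ofReal
          have hu0 : 0 < u := h0.trans hu.1
          rw [show α + 1 - c = α + (1 - c) by ring, Real.rpow_add hu0]
          apply mul_le_mul_of_nonneg_left _ (by positivity)
          exact Real.rpow_le_rpow_of_nonpos hu0 (by linarith) (by linarith)
    _ = _ := by
        have e : h ^ (α + 2 - c) = h ^ (α + 1) * h ^ (1 - c) := by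
          rw [← Real.rpow_add h0]
          ring_nf
        rw [lintegral_Ioc_ofReal_eq h0.le hint1 fun u hu => by have := hu.1; positivity,
          lintegral_Ioc_ofReal_eq h1 hint2 fun u hu => by have := h0.trans hu.1; positivity,
          intervalIntegral.integral_mul_const, integral_rpow (Or.inl hα),
          Real.zero_rpow hα1.ne', sub_zero, e]
        congr 2
        ring

lemma radialKernelIntegral_le_of_lt {α c h : ℝ} (hα : -1 < α) (hc : α + 2 < c) (h0 : 0 < h)
    (h1 : h ≤ 1) : radialKernelIntegral α c h ≤
      ENNReal.ofReal (1 / (α + 1) + 1 / (c - α - 2)) * ENNReal.ofReal (h ^ (α + 2 - c)) := by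
  have hα1 : 0 < α + 1 := by linarith
  have hc2 : 0 < c - α - 2 := by linarith
  have h2 := integral_rpow_neg_le (c := c - α - 1) (by linarith) h0 h1
  rw [show -(c - α - 1) = α + 1 - c by ring, show c - α - 1 - 1 = c - α - 2 by ring,
    show 1 - (c - α - 1) = α + 2 - c by ring] at h2
  refine (radialKernelIntegral_le_add hα (by linarith) h0 h1).trans ?_
  rw [← ENNReal.ofReal_mul (by positivity), add_mul, ENNReal.ofReal_add (by positivity)
    (by positivity)]
  gcongr

/-- For c = α + 2 the outer integrand is 1/u, the source of the logarithm in the critical case. -/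
lemma radialKernelIntegral_le_of_eq {α c h : ℝ} (hα : -1 < α) (hc : c = α + 2) (h0 : 0 < h)
    (h1 : h ≤ 1) : radialKernelIntegral α c h ≤
      ENNReal.ofReal (1 / (α + 1) + Real.log (1 / h)) := by
  have hα1 : 0 < α + 1 := by linarith
  refine (radialKernelIntegral_le_add hα (by linarith) h0 h1).trans ?_
  have hlog : 0 ≤ Real.log (1 / h) := Real.log_nonneg (by rwa [one_le_div h0])
  rw [ENNReal.ofReal_add (by positivity) hlog, hc, sub_self, Real.rpow_zero, mul_one,
    show α + 1 - (α + 2) = -1 by ring]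
  simp only [Real.rpow_neg_one]
  rw [integral_inv_of_pos h0 one_pos]

/-- Let K be the norm on the right. Then K ≥ 1 - ρr yields (1 - ρ) + (1 - r) ≤ 2K, and comparison
with |1 - e^(iθ)| ≥ 2|θ|/π yields |θ| ≤ πK ≤ 4K; the total is 6K. -/
lemma norm_one_sub_mul_exp_ge {ρ r θ : ℝ} (hρ0 : 0 ≤ ρ) (hρ : ρ < 1) (hr0 : 0 < r) (hr : r < 1)
    (hθ : |θ| ≤ Real.pi) :
    ((1 - ρ) + (1 - r) + |θ|) / 6 ≤ ‖1 - (ρ : ℂ) * (r * Complex.exp (θ * Complex.I))‖ := by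
  have hpi := Real.pi_pos
  have hpi4 := Real.pi_lt_four
  set K := ‖1 - (ρ : ℂ) * (r * Complex.exp (θ * Complex.I))‖ with hK
  have hρr : ρ * r < 1 := by nlinarith
  have hn : ‖(ρ : ℂ) * (r * Complex.exp (θ * Complex.I))‖ = ρ * r := by
    rw [norm_mul, norm_mul, Complex.norm_exp_ofReal_mul_I, mul_one, Complex.norm_real,
      Complex.norm_real, Real.norm_of_nonneg hρ0, Real.norm_of_nonneg hr0.le]
  have h1 : 1 - ρ * r ≤ K := by
    have := norm_sub_norm_le (1 : ℂ) ((ρ : ℂ) * (r * Complex.exp (θ * Complex.I)))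
    rwa [hn, norm_one] at this
  have h2 : 2 / Real.pi * |θ| ≤ 2 * K := by
    refine (two_div_pi_mul_abs_le_norm_one_sub_exp hθ).trans ?_
    have e : 1 - Complex.exp (θ * Complex.I) = (1 - (ρ : ℂ) * (r * Complex.exp (θ * Complex.I))) -
        ((1 - ρ * r : ℝ) : ℂ) * Complex.exp (θ * Complex.I) := by
      push_cast
      ring
    rw [e]
    refine (norm_sub_le _ _).trans ?_
    rw [norm_mul, Complex.norm_exp_ofReal_mul_I, mul_one, Complex.norm_real,
      Real.norm_of_nonneg (by linarith)]
    linarith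
  have h3 : |θ| ≤ 4 * K := by
    rw [div_mul_eq_mul_div, div_le_iff₀ hpi] at h2
    have hK0 : 0 ≤ K := norm_nonneg _
    nlinarith
  have h4 : (1 - ρ) + (1 - r) ≤ 2 * (1 - ρ * r) := by nlinarith
  linarith

lemma lintegral_rotation (F : ℂ → ℝ≥0∞) (u : Circle) :
    ∫⁻ z in unitDisk, F (u * z) = ∫⁻ z in unitDisk, F z := by
  have hmp := (rotation u).measurePreserving
  have := hmp.setLIntegral_comp_preimage_emb (rotation u).toHomeomorph.measurableEmbedding F unitDisk
  rw [← this]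
  congr 2
  ext z
  rw [Set.mem_preimage, unitDisk, mem_ball_zero_iff, mem_ball_zero_iff, LinearIsometryEquiv.norm_map]

/-- Forelli-Rudin type estimate. -/
lemma exists_lintegral_kernel_le {c : ℝ} (hc : 1 < c) (α : ℝ) :
    ∃ C : ℝ≥0, ∀ w : ℂ, ‖w‖ < 1 →
      ∫⁻ z in unitDisk, ENNReal.ofReal (‖1 - starRingEnd ℂ w * z‖ ^ (-c)) *
        ENNReal.ofReal ((1 - ‖z‖ ^ 2) ^ α) ≤ C * radialKernelIntegral α c (1 - ‖w‖) := by
  refine ⟨Real.toNNReal (4 ^ |α|) * Real.toNNReal (6 ^ c) * Real.toNNReal (2 / (c - 1)),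
    fun w hw => ?_⟩
  set ρ := ‖w‖ with hρ
  have hρ0 : 0 ≤ ρ := norm_nonneg w
  set G : ℂ → ℝ≥0∞ := fun z => ENNReal.ofReal (‖1 - (ρ : ℂ) * z‖ ^ (-c)) *
    ENNReal.ofReal ((1 - ‖z‖ ^ 2) ^ α) with hG
  have hGm : Measurable G := by
    have h1 : Measurable fun z : ℂ => ‖1 - (ρ : ℂ) * z‖ ^ (-c) := by fun_prop
    have h2 : Measurable fun z : ℂ => (1 - ‖z‖ ^ 2) ^ α := by fun_prop
    exact h1.ennreal_ofReal.mul h2.ennreal_ofReal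
  have hrot : ∫⁻ z in unitDisk, ENNReal.ofReal (‖1 - starRingEnd ℂ w * z‖ ^ (-c)) *
      ENNReal.ofReal ((1 - ‖z‖ ^ 2) ^ α) = ∫⁻ z in unitDisk, G z := by
    -- The rotation by -arg w replaces w by its modulus.
    rw [← lintegral_rotation G (Circle.exp (-Complex.arg w))]
    congr 1
    ext z
    simp only [hG]
    have e1 : starRingEnd ℂ w = (ρ : ℂ) * (Circle.exp (-Complex.arg w) : ℂ) := by
      conv_lhs => rw [← Complex.norm_mul_exp_arg_mul_I w]
      rw [map_mul, Complex.conj_ofReal, ← Complex.exp_conj, map_mul, Complex.conj_ofReal,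
        Complex.conj_I, Circle.coe_exp, hρ]
      push_cast
      congr 2
      ring
    rw [e1, mul_assoc, norm_mul, Circle.norm_coe, one_mul]
  rw [hrot, unitDisk, lintegral_ball_eq_polar hGm]
  have hsub : ∫⁻ u in Set.Ioo (0 : ℝ) 1, ENNReal.ofReal (u ^ α * ((1 - ρ) + u) ^ (1 - c)) =
      ∫⁻ r in Set.Ioo (0 : ℝ) 1, ENNReal.ofReal ((1 - r) ^ α * ((1 - ρ) + (1 - r)) ^ (1 - c)) := by
    have hmp : MeasurePreserving (fun r : ℝ => 1 - r) volume volume :=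
      Measure.measurePreserving_sub_left volume (1 : ℝ)
    have hm : Measurable fun u : ℝ => ENNReal.ofReal (u ^ α * ((1 - ρ) + u) ^ (1 - c)) := by
      fun_prop
    rw [← hmp.setLIntegral_comp_preimage measurableSet_Ioo hm]
    congr 2
    ext r
    simp only [Set.mem_preimage, Set.mem_Ioo]
    constructor <;> rintro ⟨h1, h2⟩ <;> constructor <;> linarith
  rw [radialKernelIntegral, hsub, ← lintegral_const_mul' _ _ ENNReal.coe_ne_top]
  apply setLIntegral_mono' measurableSet_Ioo
  rintro r ⟨hr0, hr1⟩
  have hx : 0 < (1 - ρ) + (1 - r) := by linarith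
  have hcirc : ∀ θ : ℝ, circleMap 0 r θ = r * Complex.exp (θ * Complex.I) := fun θ => by
    simp [circleMap]
  have hnorm : ∀ θ : ℝ, ‖(r : ℂ) * Complex.exp (θ * Complex.I)‖ = r := fun θ => by
    rw [norm_mul, Complex.norm_exp_ofReal_mul_I, mul_one, Complex.norm_real,
      Real.norm_of_nonneg hr0.le]
  have h1 : ENNReal.ofReal ((1 - r ^ 2) ^ α) ≤ Real.toNNReal (4 ^ |α|) *
      ENNReal.ofReal ((1 - r) ^ α) := by
    rw [← ENNReal.ofReal, ← ENNReal.ofReal_mul (by positivity)]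
    apply ENNReal.ofReal_le_ofReal
    apply rpow_le_of_comparable α (by linarith) <;> nlinarith
  calc ENNReal.ofReal r * ∫⁻ θ in Set.Ioo (-Real.pi) Real.pi, G (circleMap 0 r θ)
      ≤ 1 * ∫⁻ θ in Set.Ioo (-Real.pi) Real.pi, (Real.toNNReal (6 ^ c) * Real.toNNReal (4 ^ |α|) *
          ENNReal.ofReal ((1 - r) ^ α)) *
            ENNReal.ofReal (((1 - ρ) + (1 - r) + |θ|) ^ (-c)) := by
        refine mul_le_mul' (ENNReal.ofReal_le_one.2 hr1.le) ?_
        apply setLIntegral_mono' measurableSet_Ioo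
        intro θ hθ
        have hθ' : |θ| ≤ Real.pi := abs_le.2 ⟨hθ.1.le, hθ.2.le⟩
        simp only [hG]
        rw [hcirc, hnorm]
        have h2 : ENNReal.ofReal (‖1 - (ρ : ℂ) * (r * Complex.exp (θ * Complex.I))‖ ^ (-c)) ≤
            Real.toNNReal (6 ^ c) * ENNReal.ofReal (((1 - ρ) + (1 - r) + |θ|) ^ (-c)) := by
          rw [← ENNReal.ofReal, ← ENNReal.ofReal_mul (by positivity)]
          apply ENNReal.ofReal_le_ofReal
          have h3 := norm_one_sub_mul_exp_ge hρ0 hw hr0 hr1 hθ'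
          have h4 : 0 < (1 - ρ) + (1 - r) + |θ| := by positivity
          calc _ ≤ (((1 - ρ) + (1 - r) + |θ|) / 6) ^ (-c) :=
                Real.rpow_le_rpow_of_nonpos (by positivity) h3 (by linarith)
            _ = _ := by
                rw [Real.div_rpow h4.le (by norm_num), Real.rpow_neg (by norm_num : (0 : ℝ) ≤ 6),
                  div_inv_eq_mul, mul_comm]
        calc _ ≤ (Real.toNNReal (6 ^ c) * ENNReal.ofReal (((1 - ρ) + (1 - r) + |θ|) ^ (-c))) *
              (Real.toNNReal (4 ^ |α|) * ENNReal.ofReal ((1 - r) ^ α)) := mul_le_mul' h2 h1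
          _ = _ := by ring
    _ = (Real.toNNReal (6 ^ c) * Real.toNNReal (4 ^ |α|) * ENNReal.ofReal ((1 - r) ^ α)) *
          ∫⁻ θ in Set.Ioo (-Real.pi) Real.pi,
            ENNReal.ofReal (((1 - ρ) + (1 - r) + |θ|) ^ (-c)) := by
        rw [one_mul, lintegral_const_mul']
        exact ENNReal.mul_ne_top (ENNReal.mul_ne_top ENNReal.coe_ne_top ENNReal.coe_ne_top)
          ENNReal.ofReal_ne_top
    _ ≤ (Real.toNNReal (6 ^ c) * Real.toNNReal (4 ^ |α|) * ENNReal.ofReal ((1 - r) ^ α)) *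
          (ENNReal.ofReal (2 / (c - 1)) * ENNReal.ofReal (((1 - ρ) + (1 - r)) ^ (1 - c))) :=
        mul_le_mul_right (lintegral_add_abs_rpow_neg_le hc hx) _
    _ = _ := by
        rw [ENNReal.ofReal_mul (by have : 0 < 1 - r := by linarith
                                   positivity)]
        push_cast
        rw [← ENNReal.ofReal, ← ENNReal.ofReal, ← ENNReal.ofReal]
        ring

/-- Both families of test functions have derivatives dominated by a power of the kernel, and only
this bound matters for their energy. -/
lemma exists_dirichletEnergy_le_of_deriv_le {p m : ℝ} (hp : 0 < p) (hm : 1 < m * p) (α : ℝ) :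
    ∃ C : ℝ≥0, ∀ (w : ℂ), ‖w‖ < 1 → ∀ (f : ℂ → ℂ) (A : ℝ), 0 ≤ A →
      (∀ z ∈ unitDisk, ‖deriv f z‖ ≤ A * ‖1 - starRingEnd ℂ w * z‖ ^ (-m)) →
      dirichletEnergy p α f ≤
        C * ENNReal.ofReal (A ^ p) * radialKernelIntegral α (m * p) (1 - ‖w‖) := by
  obtain ⟨C, hC⟩ := exists_lintegral_kernel_le hm α
  refine ⟨(Real.toNNReal Real.pi)⁻¹ * C, fun w hw f A hA hf => ?_⟩
  have hpi : Real.toNNReal Real.pi ≠ 0 := by simpa using Real.pi_pos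
  rw [dirichletEnergy, lintegral_areaDisk, ENNReal.coe_mul, ENNReal.coe_inv hpi, mul_assoc,
    mul_assoc]
  refine mul_le_mul_right ?_ _
  calc ∫⁻ z in unitDisk, ‖deriv f z‖ₑ ^ p * ENNReal.ofReal ((1 - ‖z‖ ^ 2) ^ α)
      ≤ ∫⁻ z in unitDisk, ENNReal.ofReal (A ^ p) *
          (ENNReal.ofReal (‖1 - starRingEnd ℂ w * z‖ ^ (-(m * p))) *
            ENNReal.ofReal ((1 - ‖z‖ ^ 2) ^ α)) := by
        apply setLIntegral_mono' measurableSet_unitDisk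
        intro z hz
        rw [← mul_assoc, ← ENNReal.ofReal_mul (by positivity), ← ofReal_norm,
          ENNReal.ofReal_rpow_of_nonneg (norm_nonneg _) hp.le]
        gcongr
        calc ‖deriv f z‖ ^ p ≤ (A * ‖1 - starRingEnd ℂ w * z‖ ^ (-m)) ^ p :=
              Real.rpow_le_rpow (norm_nonneg _) (hf z hz) hp.le
          _ = _ := by
              rw [Real.mul_rpow hA (by positivity), ← Real.rpow_mul (norm_nonneg _), neg_mul]
    _ = ENNReal.ofReal (A ^ p) * ∫⁻ z in unitDisk,
          ENNReal.ofReal (‖1 - starRingEnd ℂ w * z‖ ^ (-(m * p))) *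
            ENNReal.ofReal ((1 - ‖z‖ ^ 2) ^ α) := lintegral_const_mul' _ _ ENNReal.ofReal_ne_top
    _ ≤ ENNReal.ofReal (A ^ p) * (C * radialKernelIntegral α (m * p) (1 - ‖w‖)) := by
        gcongr
        exact hC w hw
    _ = _ := by ring


/-! ### Necessity through test functions -/

/-- Compactness turns bounded pointwise null sequences into sequences with a subsequence that is
null in `L^q(μ)`. -/
lemma IsCompactDirichlet.exists_subseq_lintegral_tendsto_zero {p α q β : ℝ} {g : ℂ → ℂ}
    (hg : AnalyticOnDisk g) (hq : 0 < q) (hT : IsCompactDirichlet p α q β (volterraOp g))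
    {f : ℕ → ℂ → ℂ} (hf : ∀ n, MemDirichlet p α (f n))
    (hbound : ∃ C : ℝ≥0, ∀ n, dirichletNorm p α (f n) ≤ C)
    (hlim : ∀ z ∈ unitDisk, Tendsto (fun n => f n z) atTop (𝓝 0)) :
    ∃ φ : ℕ → ℕ, StrictMono φ ∧
      Tendsto (fun n => ∫⁻ z, ‖f (φ n) z‖ₑ ^ q ∂volterraMeasure g q β) atTop (𝓝 0) := by
  obtain ⟨φ, h, hφ, hh, hconv⟩ := hT.2 f hf hbound
  refine ⟨φ, hφ, ?_⟩
  set H : ℕ → ℂ → ℂ := fun n => volterraOp g (f (φ n)) - h with hH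
  have hderiv : ∀ n, ∀ z ∈ unitDisk, deriv (H n) z = f (φ n) z * deriv g z - deriv h z := by
    intro n z hz
    exact ((hasDerivAt_volterraOp hg (hf _).1 hz).sub
      (hh.1.differentiableAt (isOpen_unitDisk.mem_nhds hz)).hasDerivAt).deriv
  -- For this weight, free of g, the Dirichlet integral of any u is the integral of |u'|^q, so Fatou
  -- applies to derivatives.
  set ν : Measure ℂ := areaDisk.withDensity fun z => ENNReal.ofReal ((1 - ‖z‖ ^ 2) ^ β) with hν
  have hw : Measurable fun z : ℂ => ENNReal.ofReal ((1 - ‖z‖ ^ 2) ^ β) := by fun_prop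
  have hνmem : ∀ᵐ z ∂ν, z ∈ unitDisk := (withDensity_absolutelyContinuous _ _).ae_le ae_areaDisk_mem
  have hE : ∀ u : ℂ → ℂ, dirichletEnergy q β u = ∫⁻ z, ‖deriv u z‖ₑ ^ q ∂ν := by
    intro u
    rw [hν, lintegral_withDensity_eq_lintegral_mul _ hw ((measurable_deriv u).enorm.pow_const q),
      dirichletEnergy]
    simp only [Pi.mul_apply, mul_comm]
  have hE0 : Tendsto (fun n => dirichletEnergy q β (H n)) atTop (𝓝 0) := by
    have h1 := ((ENNReal.continuous_rpow_const (y := q)).tendsto _).comp hconv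
    rw [ENNReal.zero_rpow_of_pos hq] at h1
    exact tendsto_of_tendsto_of_tendsto_of_le_of_le tendsto_const_nhds h1 (fun _ => zero_le)
      fun n => dirichletEnergy_le_dirichletNorm_rpow hq β (H n)
  -- The derivatives f_n g' - h' tend pointwise to -h' while their energies tend to 0. Hence h' = 0
  -- almost everywhere, and subtracting h does not change the energy of T_g f_n.
  have hzero : ∫⁻ z, ‖-deriv h z‖ₑ ^ q ∂ν = 0 := by
    rw [← nonpos_iff_eq_zero]
    refine le_of_forall_gt_imp_ge_of_dense fun ε hε => ?_
    obtain ⟨N, hN⟩ := (ENNReal.tendsto_nhds_zero.1 hE0 ε hε).exists_forall_of_atTop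
    refine lintegral_enorm_rpow_le_of_tendsto (F := fun n => deriv (H (n + N)))
      (fun n => (measurable_deriv _).aemeasurable) ?_ fun n => ?_
    · filter_upwards [hνmem] with z hz
      have h1 : Tendsto (fun n => f (φ n) z * deriv g z - deriv h z) atTop (𝓝 (-deriv h z)) := by
        have := (((hlim z hz).comp hφ.tendsto_atTop).mul_const (deriv g z)).sub_const (deriv h z)
        simpa using this
      have h2 := h1.comp (tendsto_add_atTop_nat N)
      refine h2.congr fun n => ?_
      rw [hderiv _ z hz]
      rfl
    · rw [← hE]
      exact hN _ (Nat.le_add_left N n)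
  have hae : ∀ᵐ z ∂ν, deriv h z = 0 := by
    simp only [enorm_neg] at hzero
    rw [lintegral_eq_zero_iff ((measurable_deriv h).enorm.pow_const q)] at hzero
    filter_upwards [hzero] with z hz
    simpa [hq, hq.le, not_lt.2 hq.le] using hz
  refine hE0.congr fun n => ?_
  rw [← dirichletEnergy_volterraOp hg (hf _).1 hq, hE, hE]
  apply lintegral_congr_ae
  filter_upwards [hae, hνmem] with z hz hzD
  rw [hderiv n z hzD, hz, sub_zero, (hasDerivAt_volterraOp hg (hf _).1 hzD).deriv]

/-- Necessity of a one-box condition from a family of test functions. -/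
lemma IsCompactDirichlet.carlesonLittleO_of_test {p α q β : ℝ} {g : ℂ → ℂ}
    (hg : AnalyticOnDisk g) (hq : 0 < q) (hT : IsCompactDirichlet p α q β (volterraOp g))
    {ψ : ℝ → ℝ} {l₀ : ℝ} (hl₀ : 0 < l₀) {T : ℝ → ℝ → ℂ → ℂ}
    (hmem : ∀ a l, 0 < l → l < l₀ → MemDirichlet p α (T a l))
    (hbd : ∃ C : ℝ≥0, ∀ a l, 0 < l → l < l₀ → dirichletNorm p α (T a l) ≤ C)
    (hlow : ∃ c : ℝ, 0 < c ∧ ∀ a l, 0 < l → l < l₀ → ∀ z ∈ carlesonSquare a l,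
      c ≤ ‖T a l z‖ ^ q * ψ l)
    (hlim : ∀ z ∈ unitDisk, ∃ b : ℝ → ℝ, Tendsto b (𝓝[>] 0) (𝓝 0) ∧
      ∀ a l, 0 < l → l < l₀ → ‖T a l z‖ ≤ b l) :
    CarlesonLittleO (volterraMeasure g q β) ψ := by
  by_contra hcon
  unfold CarlesonLittleO at hcon
  push Not at hcon
  obtain ⟨ε, hε, hcon⟩ := hcon
  have hsel : ∀ n : ℕ, ∃ al : ℝ × ℝ, 0 < al.2 ∧ al.2 < l₀ ∧ al.2 < 1 / ((n : ℝ) + 1) ∧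
      ENNReal.ofReal (ε * ψ al.2) < volterraMeasure g q β (carlesonSquare al.1 al.2) := by
    intro n
    obtain ⟨a, l, h1, -, h3, h4⟩ := hcon (min l₀ (1 / ((n : ℝ) + 1))) (lt_min hl₀ (by positivity))
    exact ⟨(a, l), h1, h3.trans_le (min_le_left _ _), h3.trans_le (min_le_right _ _), h4⟩
  choose al hpos hlt hsmall hbig using hsel
  obtain ⟨C, hC⟩ := hbd
  obtain ⟨c, hc, hlow⟩ := hlow
  have hl : Tendsto (fun n => (al n).2) atTop (𝓝[>] 0) := by
    rw [tendsto_nhdsWithin_iff]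
    refine ⟨?_, Eventually.of_forall hpos⟩
    exact tendsto_of_tendsto_of_tendsto_of_le_of_le tendsto_const_nhds
      tendsto_one_div_add_atTop_nhds_zero_nat (fun n => (hpos n).le) fun n => (hsmall n).le
  obtain ⟨φ, hφ, hconv⟩ := hT.exists_subseq_lintegral_tendsto_zero hg hq
    (f := fun n => T (al n).1 (al n).2) (fun n => hmem _ _ (hpos n) (hlt n))
    ⟨C, fun n => hC _ _ (hpos n) (hlt n)⟩ (fun z hz => by
      obtain ⟨b, hb, hb'⟩ := hlim z hz
      exact squeeze_zero_norm (fun n => hb' _ _ (hpos n) (hlt n)) (hb.comp hl))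
  have hcε : 0 < ENNReal.ofReal (c * ε) := by
    rw [ENNReal.ofReal_pos]
    positivity
  obtain ⟨n, hn⟩ := (hconv.eventually_lt_const hcε).exists
  set a := (al (φ n)).1
  set l := (al (φ n)).2
  have hl0 : 0 < l := hpos _
  have hll : l < l₀ := hlt _
  -- The square has positive measure by choice. A point in it is needed to read off ψ l > 0 from the
  -- lower bound on the test function.
  have hS : (carlesonSquare a l).Nonempty := by
    by_contra hne
    rw [Set.not_nonempty_iff_eq_empty] at hne
    have := hbig (φ n)
    rw [hne, measure_empty] at this
    exact absurd this not_lt_zero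
  have hψ : 0 < ψ l := by
    obtain ⟨z, hz⟩ := hS
    have h1 := hlow a l hl0 hll z hz
    by_contra h2
    have h3 : ‖T a l z‖ ^ q * ψ l ≤ 0 :=
      mul_nonpos_of_nonneg_of_nonpos (by positivity) (not_lt.1 h2)
    linarith
  have hmeas : AEMeasurable (fun z => ‖T a l z‖ₑ ^ q) (volterraMeasure g q β) :=
    ((hmem a l hl0 hll).1.aemeasurable g q β).enorm.pow_const q
  have h1 := mul_meas_ge_le_lintegral₀ hmeas (ENNReal.ofReal (c / ψ l))
  have h2 : carlesonSquare a l ⊆ {z | ENNReal.ofReal (c / ψ l) ≤ ‖T a l z‖ₑ ^ q} := by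
    intro z hz
    rw [Set.mem_ofPred_eq, ← ofReal_norm, ENNReal.ofReal_rpow_of_nonneg (norm_nonneg _) hq.le]
    apply ENNReal.ofReal_le_ofReal
    rw [div_le_iff₀ hψ]
    exact hlow a l hl0 hll z hz
  -- Chebyshev on the square: |T|^q ≥ c/ψ(l) there and its measure exceeds εψ(l), which keeps the
  -- integrals away from 0.
  have h3 : ENNReal.ofReal (c * ε) ≤ ∫⁻ z, ‖T a l z‖ₑ ^ q ∂volterraMeasure g q β := by
    calc ENNReal.ofReal (c * ε) = ENNReal.ofReal (c / ψ l) * ENNReal.ofReal (ε * ψ l) := by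
          rw [← ENNReal.ofReal_mul (by positivity)]
          congr 1
          field_simp
      _ ≤ ENNReal.ofReal (c / ψ l) * volterraMeasure g q β (carlesonSquare a l) := by
          gcongr
          exact (hbig (φ n)).le
      _ ≤ _ := (mul_le_mul_right (measure_mono h2) _).trans h1
  exact absurd hn (not_lt.2 h3)

/-- The point of modulus `1 - l` below the centre of the arc `[a, a + 2πl]`. -/
noncomputable def arcPoint (a l : ℝ) : ℂ :=
  ((1 - l : ℝ) : ℂ) * Complex.exp (((a + Real.pi * l : ℝ) : ℂ) * Complex.I)

lemma norm_arcPoint {l : ℝ} (a : ℝ) (hl : l ≤ 1) : ‖arcPoint a l‖ = 1 - l := by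
  rw [arcPoint, norm_mul, Complex.norm_exp_ofReal_mul_I, mul_one, Complex.norm_real,
    Real.norm_of_nonneg (by linarith)]

/-- The function `1 - w̄ z` with `w = arcPoint a l`. -/
noncomputable def arcKernel (a l : ℝ) (z : ℂ) : ℂ := 1 - starRingEnd ℂ (arcPoint a l) * z

lemma norm_conj_arcPoint_mul_le {a l : ℝ} {z : ℂ} (hl0 : 0 < l) (hl : l ≤ 1) :
    ‖starRingEnd ℂ (arcPoint a l) * z‖ ≤ ‖z‖ := by
  rw [norm_mul, RCLike.norm_conj, norm_arcPoint a hl]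
  nlinarith [norm_nonneg z]

lemma one_sub_norm_le_norm_arcKernel {a l : ℝ} (z : ℂ) (hl0 : 0 < l) (hl : l ≤ 1) :
    1 - ‖z‖ ≤ ‖arcKernel a l z‖ := by
  have h1 := norm_sub_norm_le (1 : ℂ) (starRingEnd ℂ (arcPoint a l) * z)
  have h2 := norm_conj_arcPoint_mul_le (a := a) (z := z) hl0 hl
  rw [norm_one] at h1
  rw [arcKernel]
  linarith

lemma arcKernel_mem_slitPlane {a l : ℝ} {z : ℂ} (hl0 : 0 < l) (hl : l ≤ 1) (hz : z ∈ unitDisk) :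
    arcKernel a l z ∈ Complex.slitPlane := by
  left
  have hz' : ‖z‖ < 1 := by simpa [unitDisk] using hz
  have h1 := (Complex.re_le_norm (starRingEnd ℂ (arcPoint a l) * z)).trans
    (norm_conj_arcPoint_mul_le hl0 hl)
  rw [arcKernel, Complex.sub_re, Complex.one_re]
  linarith

lemma hasDerivAt_arcKernel (a l : ℝ) (z : ℂ) :
    HasDerivAt (arcKernel a l) (-starRingEnd ℂ (arcPoint a l)) z := by
  have := ((hasDerivAt_id z).const_mul (starRingEnd ℂ (arcPoint a l))).const_sub 1
  rw [mul_one] at this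
  exact this

lemma arcKernel_zero (a l : ℝ) : arcKernel a l 0 = 1 := by
  simp [arcKernel]

/-- The radial part contributes 1 - (1-l)r ≤ 2l, and the angular part at most πl ≤ 4l, half the
length of the arc. -/
lemma norm_arcKernel_le_of_mem {a l : ℝ} {z : ℂ} (hl : l < 1) (hz : z ∈ carlesonSquare a l) :
    ‖arcKernel a l z‖ ≤ 6 * l := by
  obtain ⟨r, θ, hr, hr1, h1, h2, rfl⟩ := hz
  set φ := a + Real.pi * l with hφ
  have hr0 : 0 < r := by linarith
  have hτ : |θ - φ| ≤ Real.pi * l := abs_le.2 ⟨by linarith, by linarith⟩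
  have hpi4 := Real.pi_lt_four
  have hl0 : 0 < l := by linarith
  have e : arcKernel a l (r * Complex.exp (θ * Complex.I)) = ((1 - (1 - l) * r : ℝ) : ℂ) -
      (((1 - l) * r : ℝ) : ℂ) * (Complex.exp (Complex.I * ((θ - φ : ℝ) : ℂ)) - 1) := by
    have e1 : Complex.exp (Complex.I * ((θ - φ : ℝ) : ℂ)) =
        Complex.exp (-(φ : ℂ) * Complex.I) * Complex.exp (θ * Complex.I) := by
      rw [← Complex.exp_add]
      push_cast
      ring_nf
    have e2 : starRingEnd ℂ (arcPoint a l) = ((1 - l : ℝ) : ℂ) * Complex.exp (-(φ : ℂ) * Complex.I) := by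
      rw [arcPoint, map_mul, Complex.conj_ofReal, ← Complex.exp_conj, map_mul, Complex.conj_ofReal,
        Complex.conj_I, mul_neg, neg_mul]
    rw [arcKernel, e1, e2]
    push_cast
    ring
  have hlr : 0 ≤ (1 - l) * r := mul_nonneg (by linarith) hr0.le
  have hlr1 : (1 - l) * r ≤ 1 := by nlinarith
  rw [e]
  refine (norm_sub_le _ _).trans ?_
  rw [norm_mul, Complex.norm_real, Complex.norm_real, Real.norm_of_nonneg (by linarith),
    Real.norm_of_nonneg hlr]
  have h3 : ‖Complex.exp (Complex.I * ((θ - φ : ℝ) : ℂ)) - 1‖ ≤ Real.pi * l :=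
    (Real.norm_exp_I_mul_ofReal_sub_one_le).trans hτ
  have h4 := norm_nonneg (Complex.exp (Complex.I * ((θ - φ : ℝ) : ℂ)) - 1)
  nlinarith

lemma exists_dirichletNorm_le_of_energy {p : ℝ} (hp : 0 < p) (α : ℝ) {ι : Type*} {s : Set ι}
    {T : ι → ℂ → ℂ} {M N : ℝ≥0∞} (hM : M ≠ ∞) (hN : N ≠ ∞) (h0 : ∀ i ∈ s, ‖T i 0‖ₑ ≤ N)
    (hE : ∀ i ∈ s, dirichletEnergy p α (T i) ≤ M) :
    ∃ C : ℝ≥0, ∀ i ∈ s, dirichletNorm p α (T i) ≤ C := by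
  have htop : (N ^ p + M) ^ (1 / p) ≠ ∞ := ENNReal.rpow_ne_top_of_nonneg (by positivity)
    (ENNReal.add_ne_top.2 ⟨ENNReal.rpow_ne_top_of_nonneg hp.le hN, hM⟩)
  refine ⟨((N ^ p + M) ^ (1 / p)).toNNReal, fun i hi => ?_⟩
  rw [ENNReal.coe_toNNReal htop, dirichletNorm_eq]
  exact ENNReal.rpow_le_rpow (add_le_add (ENNReal.rpow_le_rpow (h0 i hi) hp.le) (hE i hi))
    (by positivity)

/-- The test functions are l^(b-η) (1 - w̄z)^(-b) with an integer b > η, so no branch of a power is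
needed. They have size at least a multiple of l^(-η) on the square, bounded energy, and tend to 0 at
fixed z like l^(b-η). -/
lemma IsCompactDirichlet.isVanishingCarleson {p α q β : ℝ} {g : ℂ → ℂ} (hα : -1 < α)
    (hg : AnalyticOnDisk g) (hp : 0 < p) (hq : 0 < q) (h : p < α + 2)
    (hT : IsCompactDirichlet p α q β (volterraOp g)) :
    IsVanishingCarleson (q * (α + 2 - p) / p) (volterraMeasure g q β) := by
  set η := (α + 2 - p) / p with hη
  have hη0 : 0 < η := div_pos (by linarith) hp
  obtain ⟨b, hb⟩ := exists_nat_gt η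
  have hb0 : (0 : ℝ) < b := hη0.trans hb
  have hηp : η * p = α + 2 - p := div_mul_cancel₀ _ hp.ne'
  -- The derivative carries the kernel exponent b + 1, and b > η puts (b+1)p in the range where the
  -- kernel integral is a pure power of l. That power cancels the normalizing factor.
  have hbp : α + 2 < (b + 1 : ℝ) * p := by nlinarith
  set T : ℝ → ℝ → ℂ → ℂ := fun a l z => ((l ^ ((b : ℝ) - η) : ℝ) : ℂ) * (arcKernel a l z ^ b)⁻¹ with hTdef
  have hne : ∀ a l z, 0 < l → l < 1 → z ∈ unitDisk → arcKernel a l z ≠ 0 := fun a l z h1 h2 hz =>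
    Complex.slitPlane_ne_zero (arcKernel_mem_slitPlane h1 h2.le hz)
  have hder : ∀ a l z, 0 < l → l < 1 → z ∈ unitDisk → HasDerivAt (T a l)
      (((l ^ ((b : ℝ) - η) : ℝ) : ℂ) * (-(b * arcKernel a l z ^ (b - 1) *
        -starRingEnd ℂ (arcPoint a l)) / (arcKernel a l z ^ b) ^ 2)) z := by
    intro a l z h1 h2 hz
    exact (((hasDerivAt_arcKernel a l z).pow b).inv (pow_ne_zero _ (hne a l z h1 h2 hz))).const_mul _
  have han : ∀ a l, 0 < l → l < 1 → AnalyticOnDisk (T a l) := fun a l h1 h2 z hz =>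
    (hder a l z h1 h2 hz).differentiableAt.differentiableWithinAt
  have hderle : ∀ a l, 0 < l → l < 1 → ∀ z ∈ unitDisk, ‖deriv (T a l) z‖ ≤
      (b * l ^ ((b : ℝ) - η)) * ‖1 - starRingEnd ℂ (arcPoint a l) * z‖ ^ (-((b : ℝ) + 1)) := by
    intro a l h1 h2 z hz
    have hk : 0 < ‖arcKernel a l z‖ := norm_pos_iff.2 (hne a l z h1 h2 hz)
    rw [(hder a l z h1 h2 hz).deriv]
    change _ ≤ (b * l ^ ((b : ℝ) - η)) * ‖arcKernel a l z‖ ^ (-((b : ℝ) + 1))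
    obtain ⟨j, rfl⟩ : ∃ j, b = j + 1 := Nat.exists_eq_add_of_le' (by exact_mod_cast hb0)
    have hw : ‖arcPoint a l‖ ≤ 1 := by
      rw [norm_arcPoint a h2.le]
      linarith
    rw [norm_mul, norm_div, norm_neg, norm_mul, norm_mul, norm_neg, RCLike.norm_conj, norm_pow,
      norm_pow, norm_pow, Complex.norm_natCast, Complex.norm_real,
      Real.norm_of_nonneg (by positivity), Nat.add_sub_cancel, Real.rpow_neg hk.le,
      show (((j + 1 : ℕ) : ℝ) + 1) = ((j + 2 : ℕ) : ℝ) by push_cast; ring, Real.rpow_natCast]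
    calc _ ≤ l ^ (((j + 1 : ℕ) : ℝ) - η) * (((j + 1 : ℕ) : ℝ) * ‖arcKernel a l z‖ ^ j * 1 /
          (‖arcKernel a l z‖ ^ (j + 1)) ^ 2) := by gcongr
      _ = _ := by
          rw [← pow_mul, show (j + 1) * 2 = j + (j + 2) by ring, pow_add]
          field_simp
  obtain ⟨C, hC⟩ := exists_dirichletEnergy_le_of_deriv_le (m := (b : ℝ) + 1) hp (by linarith) α
  set M : ℝ≥0∞ := C * ENNReal.ofReal ((b : ℝ) ^ p) *
    ENNReal.ofReal (1 / (α + 1) + 1 / (((b : ℝ) + 1) * p - α - 2)) with hM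
  have hMt : M ≠ ∞ := ENNReal.mul_ne_top (ENNReal.mul_ne_top ENNReal.coe_ne_top
    ENNReal.ofReal_ne_top) ENNReal.ofReal_ne_top
  have hE : ∀ a l, 0 < l → l < 1 → dirichletEnergy p α (T a l) ≤ M := by
    intro a l h1 h2
    have hn := norm_arcPoint a h2.le
    have h3 := hC (arcPoint a l) (by rw [hn]; linarith) (T a l) (b * l ^ ((b : ℝ) - η))
      (by positivity) (hderle a l h1 h2)
    rw [hn, sub_sub_cancel] at h3
    refine h3.trans ((mul_le_mul_right (radialKernelIntegral_le_of_lt hα hbp h1 h2.le) _).trans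
      (le_of_eq ?_))
    have h4 : ENNReal.ofReal ((b * l ^ ((b : ℝ) - η)) ^ p) *
        ENNReal.ofReal (l ^ (α + 2 - ((b : ℝ) + 1) * p)) = ENNReal.ofReal ((b : ℝ) ^ p) := by
      rw [← ENNReal.ofReal_mul (by positivity), Real.mul_rpow hb0.le (by positivity),
        ← Real.rpow_mul h1.le, mul_assoc, ← Real.rpow_add h1]
      have : ((b : ℝ) - η) * p + (α + 2 - ((b : ℝ) + 1) * p) = 0 := by linarith
      rw [this, Real.rpow_zero, mul_one]
    rw [hM, ← h4]
    ring
  have hT0 : ∀ a l, 0 < l → l < 1 → ‖T a l 0‖ₑ ≤ 1 := by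
    intro a l h1 h2
    rw [← ofReal_norm, ← ENNReal.ofReal_one]
    apply ENNReal.ofReal_le_ofReal
    simp only [hTdef, arcKernel_zero, one_pow, inv_one, mul_one]
    rw [Complex.norm_real, Real.norm_of_nonneg (by positivity)]
    exact Real.rpow_le_one h1.le h2.le (by linarith)
  refine hT.carlesonLittleO_of_test hg hq one_pos (T := T) (fun a l h1 h2 => ⟨han a l h1 h2, ?_⟩)
    ?_ ⟨6 ^ (-(b : ℝ) * q), by positivity, fun a l h1 h2 z hz => ?_⟩ fun z hz =>
      ⟨fun l => l ^ ((b : ℝ) - η) * ((1 - ‖z‖) ^ b)⁻¹, ?_, fun a l h1 h2 => ?_⟩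
  · rw [dirichletNorm_lt_top_iff hp]
    exact lt_of_le_of_lt (hE a l h1 h2) hMt.lt_top
  · obtain ⟨C', hC'⟩ := exists_dirichletNorm_le_of_energy hp α (ι := ℝ × ℝ)
      (s := {x | 0 < x.2 ∧ x.2 < 1}) (T := fun x => T x.1 x.2) hMt ENNReal.one_ne_top
      (fun x hx => hT0 x.1 x.2 hx.1 hx.2) fun x hx => hE x.1 x.2 hx.1 hx.2
    exact ⟨C', fun a l h1 h2 => hC' (a, l) ⟨h1, h2⟩⟩
  · have hzD : z ∈ unitDisk := by
      obtain ⟨r, θ, hr, hr1, -, -, rfl⟩ := hz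
      rw [unitDisk, mem_ball_zero_iff, norm_mul, Complex.norm_exp_ofReal_mul_I, mul_one,
        Complex.norm_real, Real.norm_of_nonneg (by linarith)]
      exact hr1
    have hk : 0 < ‖arcKernel a l z‖ := norm_pos_iff.2 (hne a l z h1 h2 hzD)
    have hk6 := norm_arcKernel_le_of_mem h2 hz
    have h3 : 6 ^ (-(b : ℝ)) * l ^ (-η) ≤ ‖T a l z‖ := by
      simp only [hTdef]
      rw [norm_mul, Complex.norm_real, Real.norm_of_nonneg (by positivity), norm_inv, norm_pow,
        Real.rpow_neg (by norm_num), Real.rpow_natCast, sub_eq_add_neg, Real.rpow_add h1,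
        Real.rpow_natCast]
      have h4 : ‖arcKernel a l z‖ ^ b ≤ 6 ^ b * l ^ b := by
        rw [← mul_pow]
        gcongr
      calc ((6 : ℝ) ^ b)⁻¹ * l ^ (-η) = l ^ b * l ^ (-η) * (6 ^ b * l ^ b)⁻¹ := by
            field_simp
        _ ≤ _ := by gcongr
    calc (6 : ℝ) ^ (-(b : ℝ) * q) = (6 ^ (-(b : ℝ)) * l ^ (-η)) ^ q * l ^ (q * (α + 2 - p) / p) := by
          rw [Real.mul_rpow (by positivity) (by positivity), ← Real.rpow_mul (by norm_num),
            ← Real.rpow_mul h1.le, mul_assoc, ← Real.rpow_add h1]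
          have : -η * q + q * (α + 2 - p) / p = 0 := by
            rw [hη]
            ring
          rw [this, Real.rpow_zero, mul_one]
      _ ≤ _ := by gcongr
  · have h3 : Tendsto (fun l : ℝ => l ^ ((b : ℝ) - η)) (𝓝[>] 0) (𝓝 0) := by
      have h4 : ContinuousAt (fun l : ℝ => l ^ ((b : ℝ) - η)) 0 :=
        Real.continuousAt_rpow_const _ _ (Or.inr (by linarith))
      have h5 := h4.tendsto
      rw [Real.zero_rpow (by linarith)] at h5
      exact h5.mono_left nhdsWithin_le_nhds
    simpa using h3.mul_const (((1 - ‖z‖) ^ b)⁻¹)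
  · have hz' : ‖z‖ < 1 := by simpa [unitDisk] using hz
    have h3 : 0 < 1 - ‖z‖ := by linarith
    simp only [hTdef]
    rw [norm_mul, Complex.norm_real, Real.norm_of_nonneg (by positivity), norm_inv, norm_pow]
    gcongr
    exact one_sub_norm_le_norm_arcKernel z h1 h2.le

lemma norm_log_arcKernel_le {a l : ℝ} {z : ℂ} (hl0 : 0 < l) (hl : l ≤ 1) (hz : z ∈ unitDisk) :
    ‖Complex.log (arcKernel a l z)‖ ≤ Real.log 2 - Real.log (1 - ‖z‖) + Real.pi := by
  have hz' : ‖z‖ < 1 := by simpa [unitDisk] using hz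
  have h1 := one_sub_norm_le_norm_arcKernel (a := a) z hl0 hl
  have h3 : 0 < 1 - ‖z‖ := by linarith
  have h2 : ‖arcKernel a l z‖ ≤ 2 := by
    rw [arcKernel]
    refine (norm_sub_le _ _).trans ?_
    have := norm_conj_arcPoint_mul_le (a := a) (z := z) hl0 hl
    rw [norm_one]
    linarith
  have h4 := Real.log_le_log h3 h1
  have h5 := Real.log_le_log (h3.trans_le h1) h2
  have h6 : Real.log (1 - ‖z‖) ≤ 0 := Real.log_nonpos h3.le (by linarith [norm_nonneg z])
  have h7 := Real.log_pos one_lt_two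
  refine (Complex.norm_le_abs_re_add_abs_im _).trans ?_
  rw [Complex.log_re, Complex.log_im]
  have h8 := Complex.abs_arg_le_pi (arcKernel a l z)
  have h9 : |Real.log ‖arcKernel a l z‖| ≤ Real.log 2 - Real.log (1 - ‖z‖) :=
    abs_le.2 ⟨by linarith, by linarith⟩
  linarith

/-- With L = log(1/l), the test functions are L^(-1/p) log(1 - w̄z). The critical kernel integral
grows like L, which the factor L^(-1) in the energy absorbs; on the square the modulus is at least
L^(1-1/p)/2. -/
lemma IsCompactDirichlet.carlesonLittleO_log {p α q β : ℝ} {g : ℂ → ℂ} (hα : -1 < α)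
    (hg : AnalyticOnDisk g) (hp : 1 < p) (hq : 0 < q) (h : p = α + 2)
    (hT : IsCompactDirichlet p α q β (volterraOp g)) :
    CarlesonLittleO (volterraMeasure g q β)
      (fun l => (Real.log (1 / l)) ^ ((1 / p - 1) * q)) := by
  have hp0 : 0 < p := by linarith
  set L : ℝ → ℝ := fun l => Real.log (1 / l) with hL
  set T : ℝ → ℝ → ℂ → ℂ := fun a l z => ((L l ^ (-(1 / p)) : ℝ) : ℂ) * Complex.log (arcKernel a l z)
    with hTdef
  -- The threshold 1/36 is where 6l ≤ √l, so that the kernel bound 6l on the square gives |log| ≥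
  -- L/2. It also makes L > log 36 > 1.
  have hl1 : ∀ l : ℝ, l < 1 / 36 → l < 1 := fun l hl => hl.trans (by norm_num)
  have hL36 : ∀ l, 0 < l → l < 1 / 36 → Real.log 36 < L l := by
    intro l h1 h2
    apply Real.log_lt_log (by norm_num)
    rw [lt_one_div (by norm_num) h1]
    exact h2
  have hlog36 : 1 < Real.log 36 := by
    rw [Real.lt_log_iff_exp_lt (by norm_num)]
    have := Real.exp_one_lt_d9
    linarith
  have hL1 : ∀ l, 0 < l → l < 1 / 36 → 1 < L l := fun l h1 h2 => hlog36.trans (hL36 l h1 h2)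
  have hder : ∀ a l z, 0 < l → l < 1 / 36 → z ∈ unitDisk → HasDerivAt (T a l)
      (((L l ^ (-(1 / p)) : ℝ) : ℂ) * (-starRingEnd ℂ (arcPoint a l) / arcKernel a l z)) z := by
    intro a l z h1 h2 hz
    exact ((hasDerivAt_arcKernel a l z).clog
      (arcKernel_mem_slitPlane h1 (hl1 l h2).le hz)).const_mul _
  have han : ∀ a l, 0 < l → l < 1 / 36 → AnalyticOnDisk (T a l) := fun a l h1 h2 z hz =>
    (hder a l z h1 h2 hz).differentiableAt.differentiableWithinAt
  have hderle : ∀ a l, 0 < l → l < 1 / 36 → ∀ z ∈ unitDisk, ‖deriv (T a l) z‖ ≤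
      (L l ^ (-(1 / p))) * ‖1 - starRingEnd ℂ (arcPoint a l) * z‖ ^ (-(1 : ℝ)) := by
    intro a l h1 h2 z hz
    have hLl : 0 < L l := one_pos.trans (hL1 l h1 h2)
    rw [(hder a l z h1 h2 hz).deriv]
    change _ ≤ (L l ^ (-(1 / p))) * ‖arcKernel a l z‖ ^ (-(1 : ℝ))
    rw [norm_mul, norm_div, norm_neg, RCLike.norm_conj, Complex.norm_real,
      Real.norm_of_nonneg (by positivity), norm_arcPoint a (hl1 l h2).le, Real.rpow_neg_one,
      div_eq_mul_inv]
    gcongr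
    calc (1 - l) * ‖arcKernel a l z‖⁻¹ ≤ 1 * ‖arcKernel a l z‖⁻¹ := by
          gcongr
          linarith
      _ = _ := one_mul _
  obtain ⟨C, hC⟩ := exists_dirichletEnergy_le_of_deriv_le (m := 1) hp0 (by linarith) α
  have hα1 : 0 < 1 / (α + 1) := one_div_pos.2 (by linarith)
  set M : ℝ≥0∞ := C * ENNReal.ofReal (1 / (α + 1) + 1) with hM
  have hMt : M ≠ ∞ := ENNReal.mul_ne_top ENNReal.coe_ne_top ENNReal.ofReal_ne_top
  have hE : ∀ a l, 0 < l → l < 1 / 36 → dirichletEnergy p α (T a l) ≤ M := by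
    intro a l h1 h2
    have hLl := hL1 l h1 h2
    have hLl0 : 0 < L l := one_pos.trans hLl
    have hn := norm_arcPoint a (hl1 l h2).le
    have h3 := hC (arcPoint a l) (by rw [hn]; linarith) (T a l) (L l ^ (-(1 / p)))
      (by positivity) (hderle a l h1 h2)
    rw [hn, sub_sub_cancel] at h3
    refine h3.trans ((mul_le_mul_right (radialKernelIntegral_le_of_eq hα (by linarith) h1
      (hl1 l h2).le) _).trans ?_)
    rw [hM, mul_assoc, ← ENNReal.ofReal_mul (by positivity), ← Real.rpow_mul hLl0.le, neg_mul,
      one_div_mul_cancel hp0.ne', Real.rpow_neg_one]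
    refine mul_le_mul_right (ENNReal.ofReal_le_ofReal ?_) _
    rw [inv_mul_le_iff₀ hLl0]
    change 1 / (α + 1) + L l ≤ _
    nlinarith
  have hT0 : ∀ a l, T a l 0 = 0 := by
    intro a l
    simp [hTdef, arcKernel_zero]
  have hLtop : Tendsto L (𝓝[>] 0) atTop := by
    have h1 : Tendsto (fun l : ℝ => 1 / l) (𝓝[>] 0) atTop := by
      simpa using tendsto_inv_nhdsGT_zero (𝕜 := ℝ)
    exact Real.tendsto_log_atTop.comp h1
  refine hT.carlesonLittleO_of_test hg hq (l₀ := 1 / 36) (by norm_num) (T := T)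
    (fun a l h1 h2 => ⟨han a l h1 h2, ?_⟩)
    ?_ ⟨2⁻¹ ^ q, by positivity, fun a l h1 h2 z hz => ?_⟩ fun z hz =>
      ⟨fun l => L l ^ (-(1 / p)) * (Real.log 2 - Real.log (1 - ‖z‖) + Real.pi), ?_,
        fun a l h1 h2 => ?_⟩
  · rw [dirichletNorm_lt_top_iff hp0]
    exact lt_of_le_of_lt (hE a l h1 h2) hMt.lt_top
  · obtain ⟨C', hC'⟩ := exists_dirichletNorm_le_of_energy hp0 α (ι := ℝ × ℝ)
      (s := {x | 0 < x.2 ∧ x.2 < 1 / 36}) (T := fun x => T x.1 x.2) hMt ENNReal.one_ne_top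
      (fun x _ => by simp only [hT0]; simp) fun x hx => hE x.1 x.2 hx.1 hx.2
    exact ⟨C', fun a l h1 h2 => hC' (a, l) ⟨h1, h2⟩⟩
  · have hLl0 : 0 < L l := one_pos.trans (hL1 l h1 h2)
    have hzD : z ∈ unitDisk := by
      obtain ⟨r, θ, hr, hr1, -, -, rfl⟩ := hz
      rw [unitDisk, mem_ball_zero_iff, norm_mul, Complex.norm_exp_ofReal_mul_I, mul_one,
        Complex.norm_real, Real.norm_of_nonneg (by linarith)]
      exact hr1
    have hk : 0 < ‖arcKernel a l z‖ := norm_pos_iff.2 (Complex.slitPlane_ne_zero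
      (arcKernel_mem_slitPlane h1 (hl1 l h2).le hzD))
    have hk6 := norm_arcKernel_le_of_mem (hl1 l h2) hz
    have h3 : L l / 2 ≤ ‖Complex.log (arcKernel a l z)‖ := by
      have h4 : ‖arcKernel a l z‖ ≤ l ^ (1 / 2 : ℝ) := by
        refine hk6.trans ?_
        rw [← Real.sqrt_eq_rpow]
        apply Real.le_sqrt_of_sq_le
        nlinarith
      have h5 := Real.log_le_log hk h4
      rw [Real.log_rpow h1] at h5
      have h6 : L l = -Real.log l := by simp [hL]
      have h7 := Complex.abs_re_le_norm (Complex.log (arcKernel a l z))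
      rw [Complex.log_re] at h7
      have h8 := neg_abs_le (Real.log ‖arcKernel a l z‖)
      linarith
    have h9 : L l ^ (-(1 / p)) * (L l / 2) ≤ ‖T a l z‖ := by
      simp only [hTdef]
      rw [norm_mul, Complex.norm_real, Real.norm_of_nonneg (by positivity)]
      gcongr
    calc (2⁻¹ : ℝ) ^ q = (L l ^ (-(1 / p)) * (L l / 2)) ^ q * L l ^ ((1 / p - 1) * q) := by
          have e : L l ^ (-(1 / p)) * (L l / 2) = L l ^ (1 - 1 / p) * 2⁻¹ := by
            rw [sub_eq_add_neg, Real.rpow_add hLl0, Real.rpow_one]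
            ring
          rw [e, Real.mul_rpow (by positivity) (by positivity), ← Real.rpow_mul hLl0.le,
            mul_right_comm, ← Real.rpow_add hLl0]
          have : (1 - 1 / p) * q + (1 / p - 1) * q = 0 := by ring
          rw [this, Real.rpow_zero, one_mul]
      _ ≤ _ := by gcongr
  · have h3 := (tendsto_rpow_neg_atTop (y := 1 / p) (by positivity)).comp hLtop
    have h4 := h3.mul_const (Real.log 2 - Real.log (1 - ‖z‖) + Real.pi)
    rw [zero_mul] at h4
    exact h4
  · have hLl0 : 0 < L l := one_pos.trans (hL1 l h1 h2)
    simp only [hTdef]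
    rw [norm_mul, Complex.norm_real, Real.norm_of_nonneg (by positivity)]
    gcongr
    exact norm_log_arcKernel_le h1 (hl1 l h2).le hz

/-- The energy of T_g 1 is the total mass of μ. -/
lemma IsCompactDirichlet.isFiniteMeasure {p α q β : ℝ} {g : ℂ → ℂ} (hg : AnalyticOnDisk g)
    (hp : 0 < p) (hq : 0 < q) (hT : IsCompactDirichlet p α q β (volterraOp g)) :
    IsFiniteMeasure (volterraMeasure g q β) := by
  have hone : AnalyticOnDisk fun _ => (1 : ℂ) := differentiableOn_const _
  have h1 : MemDirichlet p α fun _ => (1 : ℂ) := by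
    refine ⟨hone, ?_⟩
    rw [dirichletNorm_lt_top_iff hp, dirichletEnergy]
    simp [hp]
  have h2 := (hT.1 _ h1).2
  rw [dirichletNorm_lt_top_iff hq, dirichletEnergy_volterraOp hg hone hq] at h2
  refine ⟨?_⟩
  simpa using h2

theorem mainTheorem4 (α β p q : ℝ) (g : ℂ → ℂ) (hα : -1 < α) (hβ : -1 < β)
    (hp : 0 < p) (hpq : p < q) (hg : AnalyticOnDisk g) :
    (p < α + 2 →
      (IsCompactDirichlet p α q β (volterraOp g) ↔
        IsVanishingCarleson (q * (α + 2 - p) / p) (volterraMeasure g q β))) ∧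
    (p = α + 2 →
      (IsCompactDirichlet p α q β (volterraOp g) ↔
        CarlesonLittleO (volterraMeasure g q β)
          (fun l => (Real.log (1 / l)) ^ ((1 / p - 1) * q)))) ∧
    (α + 2 < p →
      (IsCompactDirichlet p α q β (volterraOp g) ↔ IsFiniteMeasure (volterraMeasure g q β)) ∧
      (IsFiniteMeasure (volterraMeasure g q β) ↔ MemDirichlet q β g)) := by
  have hq : 0 < q := hp.trans hpq
  -- In the critical case α > -1 forces p = α + 2 > 1, as Hölder in the logarithmic estimate and the
  -- kernel bound both require.
  refine ⟨fun h => ⟨fun hT => hT.isVanishingCarleson hα hg hp hq h, fun hμ => ?_⟩,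
    fun h => ⟨fun hT => hT.carlesonLittleO_log hα hg (by linarith) hq h, fun hμ => ?_⟩,
    fun h => ⟨⟨fun hT => hT.isFiniteMeasure hg hp hq, fun hfin => ?_⟩,
      isFiniteMeasure_volterraMeasure_iff hg hq β⟩⟩
  · have := isFiniteMeasure_of_littleO hg hq β hμ
    exact isCompactDirichlet_of_vanishing hg hp hq (vanishingEmbedding_of_lt hp hpq h hμ)
  · have := isFiniteMeasure_of_littleO hg hq β hμ
    exact isCompactDirichlet_of_vanishing hg hp hq
      (vanishingEmbedding_of_eq (by linarith) hpq h hμ)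
  · exact isCompactDirichlet_of_vanishing hg hp hq (vanishingEmbedding_of_gt hp hpq h)
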